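/- Let $G$ be a finite simple connected graph, $K$ a field, $K[s]$ the polynomial ring with one variable $s_e$ for each edge $e$ of $G$, $K[t]$ the polynomial ring with one variable $t_i$ for each vertex $i$, and $I_G=\ker\pi$ the toric ideal, where $\pi:K[s]\to K[t]$, $s_{\{i,j\}}\mapsto t_it_j$. A nonzero binomial $f=u-v\in I_G$ ($u,v$ monomials) is *primitive* if there is no binomial $g=u'-v'\in I_G$ with $g\ne 0,f$, $u'\mid u$ and $v'\mid v$. Let $w=(e_1,e_2,\dots,e_{2p})$ be an even closed walk in $G$, and let $$f_w=\prod_{k=1}^{p}s_{e_{2k-1}}-\prod_{k=1}^{p}s_{e_{2k}} .$$ Let $G_w=(V(w),E(w))$ be the graph of the vertices and edges of $w$ and $W(w)=(V(w),E(w),\rho)$ the weighted graph with $\rho(e)=\#\{k: e_{2k-1}=e\}-\#\{k: e_{2k}=e\}$. In a weighted graph $W$ with weights $\rho$, let $\deg(i)$ be the number of edges at $i$ and $\deg_W(i)=\sum_{e\ni i}|\rho(e)|$. A bridge is an edge whose removal, and a cut vertex a vertex whose removal, increases the number of connected components. Consider the following two operations on weighted graphs. *Contraction* of a bridge $e=\{i,j\}$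 with $|\rho(e)|=2$: the vertex $j$ and the edge $e$ are removed, every other edge $\{\alpha,j\}$ is replaced by an edge $\{\alpha,i\}$ of the same weight, and the weights of all edges in the component of $i$ of $W-e$ change sign. (Either end of $e$ may play the role of $i$.) *Separation* of a cut vertex $i$ with $\deg(i)=\deg_W(i)=4$ that has two neighbours $k_1,k_2$ along edges of weight $+1$ and two neighbours $l_1,l_2$ along edges of weight $-1$, where in $W-i$ no $k_a$ is connected to an $l_b$: the vertex $i$ and the four edges at $i$ are deleted; then, on the positive side, (a) if $\{k_1,k_2\}$ is not an edge, it is added with weight $+1$; (b) if $\{k_1,k_2\}$ is an edge of weight $+1$, its weight is changed to $+2$ and it is then contracted, where it is required that this contraction is possible, i.e. that $\{k_1,k_2\}$ is a bridge of $W-i$; (c) if $\{k_1,k_2\}$ is an edge of weight $-1$ and the only edge of $W-i$ at $k_1$ and at $k_2$, its weight is changed to $0$; and the same is done on the negative side with $l_1,l_2$ and all signs reversed. Separation of $i$ is defined only if each of the two sides falls under one of the cases (a)–(c). Call $\tilde W$ a *reduction* of $W$ if it is obtained from $W$ by successive contractions and separations and admits no further contraction or separation. Consider the following conditions on $w$.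 (i) $\{e_l: l \text{ odd}\}\cap\{e_l: l\text{ even}\}=\emptyset$; every $i\in V(w)$ satisfies $\deg_{W(w)}(i)\in\{2,4\}$; every $i\in V(w)$ with $\deg_{W(w)}(i)=4$ is a cut vertex of $G_w$. (ii) For a reduction $\tilde W$ of $W(w)$, each connected component of $\tilde W$ is an even cycle or a single edge with weight $0$. **Proposition.** The binomial $f_w$ is primitive if and only if $w$ satisfies (i) and (ii). This holds both when (ii) is required for every reduction $\tilde W$ of $W(w)$ and when (ii) is required only for some reduction. Moreover, if $f_w$ is primitive, then any two reductions of $W(w)$ have the same vertices and the same edges, and their weights agree up to a change of sign on each connected component. -/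

import Mathlib

open SimpleGraph

noncomputable section

namespace GraverWalk

/-! ### The toric ideal of a graph and its primitive binomials -/

section Toric

variable {V : Type*} (K : Type*) [Field K] (G : SimpleGraph V)

/-- The monomial `t_i * t_j` attached to an edge `{i, j}`. -/
def edgeMonomial (e : Sym2 V) : MvPolynomial V K :=
  Sym2.lift ⟨fun i j => MvPolynomial.X i * MvPolynomial.X j, fun _ _ => mul_comm _ _⟩ e

/-- The homomorphism `π : K[s] → K[t]`, `s_e ↦ t_i t_j` for `e = {i, j}`; the variables of the
source are indexed by the edges of `G`, those of the target by the vertices. -/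
def toricMap : MvPolynomial G.edgeSet K →ₐ[K] MvPolynomial V K :=
  MvPolynomial.aeval fun e => edgeMonomial K e.1

/-- The toric ideal `I_G = ker π`. -/
def toricIdeal : Ideal (MvPolynomial G.edgeSet K) :=
  RingHom.ker (toricMap K G)

/-- The monomial `s^x` with exponent vector `x`. -/
def mon (x : G.edgeSet →₀ ℕ) : MvPolynomial G.edgeSet K :=
  MvPolynomial.monomial x 1

/-- A (nonzero) binomial `f = u - v ∈ I_G` is primitive if there is no binomial
`g = u' - v' ∈ I_G`, `g ≠ 0, f`, such that `u' ∣ u` and `v' ∣ v`. -/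
def IsPrimitive (f : MvPolynomial G.edgeSet K) : Prop :=
  f ≠ 0 ∧ f ∈ toricIdeal K G ∧
    ∃ x y : G.edgeSet →₀ ℕ, f = mon K G x - mon K G y ∧
      ¬ ∃ x' y' : G.edgeSet →₀ ℕ,
        mon K G x' - mon K G y' ∈ toricIdeal K G ∧
        mon K G x' - mon K G y' ≠ 0 ∧ mon K G x' - mon K G y' ≠ f ∧
        mon K G x' ∣ mon K G x ∧ mon K G y' ∣ mon K G y

end Toric

/-! ### Closed walks and their binomials -/

section Walks

variable {V : Type*} {G : SimpleGraph V} {v : V}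

/-- The edge at (zero-based) position `k` of the walk. The odd positions `1, 3, 5, …` of the
usual one-based numbering are the even values of `k`. -/
def walkEdge (w : G.Walk v v) (k : Fin w.length) : G.edgeSet :=
  ⟨s(w.getVert k, w.getVert (k + 1)), w.adj_getVert_succ k.2⟩

/-- The binomial `f_w`: the product of the variables of the edges in positions `1, 3, 5, …`
minus the product of the variables of the edges in positions `2, 4, 6, …`. -/
def walkBinomial (K : Type*) [Field K] (w : G.Walk v v) : MvPolynomial G.edgeSet K :=
  (∏ k ∈ Finset.univ.filter (fun k : Fin w.length => Even (k : ℕ)),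
      MvPolynomial.X (walkEdge w k)) -
    ∏ k ∈ Finset.univ.filter (fun k : Fin w.length => Odd (k : ℕ)),
      MvPolynomial.X (walkEdge w k)

open scoped Classical in
/-- The weight `ρ(e)`: the number of occurrences of `e` in positions `1, 3, 5, …` of `w` minus
the number of its occurrences in positions `2, 4, 6, …`. -/
def walkWeight (w : G.Walk v v) (e : Sym2 V) : ℤ :=
  ((Finset.univ.filter fun k : Fin w.length =>
      Even (k : ℕ) ∧ (walkEdge w k : Sym2 V) = e).card : ℤ) -
    ((Finset.univ.filter fun k : Fin w.length =>
      Odd (k : ℕ) ∧ (walkEdge w k : Sym2 V) = e).card : ℤ)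

end Walks

/-! ### Weighted graphs -/

/-- A simple graph with vertex set `verts ⊆ V` and integer edge weights. Only the values of
`weight` on the edges are meaningful. -/
structure WGraph (V : Type*) where
  verts : Set V
  graph : SimpleGraph V
  mem_verts : ∀ {a b : V}, graph.Adj a b → a ∈ verts
  weight : V → V → ℤ
  weight_symm : ∀ a b : V, weight a b = weight b a

/-- The weighted graph `W(w) = (V(w), E(w), ρ)` of a closed walk `w`. -/
def ofWalk {V : Type*} {G : SimpleGraph V} {v : V} (w : G.Walk v v) : WGraph V where
  verts := {a | a ∈ w.support}
  graph :=
    { Adj := fun a b => s(a, b) ∈ w.edges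
      symm := ⟨fun a b h => by rwa [Sym2.eq_swap]⟩
      loopless := ⟨fun a h => (G.loopless.irrefl a) (w.adj_of_mem_edges h)⟩ }
  mem_verts := fun h => w.fst_mem_support_of_mem_edges h
  weight := fun a b => walkWeight w s(a, b)
  weight_symm := fun a b => by rw [Sym2.eq_swap]

namespace WGraph

variable {V : Type*}

/-- The number of edges at `a`. -/
def deg (W : WGraph V) (a : V) : ℕ := (W.graph.neighborSet a).ncard

open scoped Classical in
/-- The weighted degree of `a`: the sum of `|ρ(e)|` over the edges `e` at `a`. -/
def wdeg [Fintype V] (W : WGraph V) (a : V) : ℤ :=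
  ∑ b ∈ Finset.univ.filter (fun b : V => W.graph.Adj a b), |W.weight a b|

/-- Deletion of the vertex `x` and of all the edges at `x`. -/
def del (W : WGraph V) (x : V) : WGraph V where
  verts := W.verts \ {x}
  graph :=
    { Adj := fun a b => W.graph.Adj a b ∧ a ≠ x ∧ b ≠ x
      symm := ⟨fun _ _ h => ⟨h.1.symm, h.2.2, h.2.1⟩⟩
      loopless := ⟨fun a h => W.graph.loopless.irrefl a h.1⟩ }
  mem_verts := fun h => ⟨W.mem_verts h.1, h.2.1⟩
  weight := W.weight
  weight_symm := W.weight_symm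

/-- `x` is a cut vertex: its removal disconnects two other vertices of one component, i.e. it
increases the number of connected components. -/
def IsCutVertex (W : WGraph V) (x : V) : Prop :=
  ∃ a b : V, a ≠ x ∧ b ≠ x ∧ W.graph.Reachable a b ∧ ¬ (W.del x).graph.Reachable a b

/-- The `i`-side of `W` with respect to the edge `{i, j}`: the vertices connected to `i` after
the removal of that edge. -/
def side (W : WGraph V) (i j : V) : Set V :=
  {a | (W.graph.deleteEdges {s(i, j)}).Reachable i a}

/-- `{i, j}` is an edge of weight `±2` which is a bridge, so that it can be contracted. -/
def CanContract (W : WGraph V) (i j : V) : Prop :=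
  W.graph.Adj i j ∧ |W.weight i j| = 2 ∧ W.graph.IsBridge s(i, j)

open scoped Classical in
/-- Contraction of the edge `{i, j}`: the vertex `j` is removed, every other edge `{a, j}` is
replaced by `{a, i}` with the same weight, and the weights of the edges belonging to the
`i`-side are negated. -/
def contract (W : WGraph V) (i j : V) : WGraph V where
  verts := {a | a ∈ W.verts ∧ a ≠ j}
  graph :=
    { Adj := fun a b => a ≠ b ∧ (a ∈ W.verts ∧ a ≠ j) ∧ (b ∈ W.verts ∧ b ≠ j) ∧
        (W.graph.Adj a b ∨ (a = i ∧ W.graph.Adj j b) ∨ (b = i ∧ W.graph.Adj j a))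
      symm := ⟨fun _ _ h => ⟨h.1.symm, h.2.2.1, h.2.1,
        h.2.2.2.elim (fun h' => Or.inl h'.symm) (fun h' => Or.inr h'.symm)⟩⟩
      loopless := ⟨fun _ h => h.1 rfl⟩ }
  mem_verts := fun h => h.2.1
  weight := fun a b =>
    if W.graph.Adj a b then
      if a ∈ W.side i j ∧ b ∈ W.side i j then -W.weight a b else W.weight a b
    else if a = i then W.weight j b
    else if b = i then W.weight j a
    else 0
  weight_symm := fun a b => by
    rw [W.weight_symm a b]
    simp only [W.graph.adj_comm a b, and_comm (a := a ∈ W.side i j)]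
    split_ifs <;> simp_all

open scoped Classical in
/-- The graph `W` with the edge `{k, l}` added, if it is not yet an edge, and given the
weight `c`. -/
def setEdge (W : WGraph V) (k l : V) (c : ℤ) : WGraph V where
  verts := W.verts ∪ {a | k ≠ l ∧ (a = k ∨ a = l)}
  graph := W.graph ⊔ SimpleGraph.fromEdgeSet {s(k, l)}
  mem_verts := fun {a b} h => by
    rcases h with h | h
    · exact Or.inl (W.mem_verts h)
    · rw [SimpleGraph.fromEdgeSet_adj, Set.mem_singleton_iff, Sym2.eq_iff] at h
      rcases h with ⟨⟨rfl, rfl⟩ | ⟨rfl, rfl⟩, h2⟩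
      · exact Or.inr ⟨h2, Or.inl rfl⟩
      · exact Or.inr ⟨h2.symm, Or.inr rfl⟩
  weight := fun a b => if s(a, b) = s(k, l) then c else W.weight a b
  weight_symm := fun a b => by rw [Sym2.eq_swap, W.weight_symm a b]

/-- What separation of a vertex does on the side of that vertex with sign `σ = ±1`. Here `D` is
the graph in which the separated vertex has already been deleted, and `k`, `l` are its two former
neighbours along edges of weight `σ`.
* `a`: if `{k, l}` is not an edge, it is added with weight `σ`.
* `b`: if `{k, l}` is an edge of weight `σ`, its weight becomes `2σ`, and it is contracted,
  provided that this is possible.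
* `c`: if `{k, l}` is an edge of weight `-σ` and there is no further edge at `k` or `l`, its
  weight becomes `0`. -/
inductive SideStep (σ : ℤ) (k l : V) (D : WGraph V) : WGraph V → Prop
  | a : ¬ D.graph.Adj k l → SideStep σ k l D (D.setEdge k l σ)
  | b : D.graph.Adj k l → D.weight k l = σ → (D.setEdge k l (2 * σ)).CanContract k l →
      SideStep σ k l D ((D.setEdge k l (2 * σ)).contract k l)
  | c : D.graph.Adj k l → D.weight k l = -σ →
      (∀ a, D.graph.Adj k a → a = l) → (∀ a, D.graph.Adj l a → a = k) →
      SideStep σ k l D (D.setEdge k l 0)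

/-- `W'` arises from `W` by separation of the vertex `x`: `x` is a cut vertex with
`deg x = wdeg x = 4`, with two edges of weight `+1` (to `k₁`, `k₂`) and two edges of weight `-1`
(to `l₁`, `l₂`), the removal of `x` disconnects its positive side (containing `k₁`, `k₂`) from
its negative side (containing `l₁`, `l₂`), and each of the two sides is of one of the three types
`a`, `b`, `c`. -/
def Separation [Fintype V] (W : WGraph V) (x : V) (W' : WGraph V) : Prop :=
  W.deg x = 4 ∧ W.wdeg x = 4 ∧ W.IsCutVertex x ∧
    ∃ k₁ k₂ l₁ l₂ : V, k₁ ≠ k₂ ∧ l₁ ≠ l₂ ∧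
      (W.graph.Adj x k₁ ∧ W.weight x k₁ = 1) ∧ (W.graph.Adj x k₂ ∧ W.weight x k₂ = 1) ∧
      (W.graph.Adj x l₁ ∧ W.weight x l₁ = -1) ∧ (W.graph.Adj x l₂ ∧ W.weight x l₂ = -1) ∧
      (∀ k ∈ ({k₁, k₂} : Set V), ∀ l ∈ ({l₁, l₂} : Set V),
        ¬ (W.del x).graph.Reachable k l) ∧
      ∃ W₁ : WGraph V, SideStep 1 k₁ k₂ (W.del x) W₁ ∧ SideStep (-1) l₁ l₂ W₁ W'

/-- One operation: a contraction of a bridge of weight `±2` (onto either of its ends) or a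
separation of a vertex. -/
inductive Step [Fintype V] (W : WGraph V) : WGraph V → Prop
  | contraction (i j : V) : W.CanContract i j → Step W (W.contract i j)
  | separation (x : V) (W' : WGraph V) : W.Separation x W' → Step W W'

/-- `W'` is obtained from `W` by recursively applying, in some order, contractions and
separations until none is possible any more. -/
def Reduces [Fintype V] (W W' : WGraph V) : Prop :=
  Relation.ReflTransGen Step W W' ∧ ∀ W'' : WGraph V, ¬ Step W' W''

/-- The connected component of `x` is an even cycle: some cycle of even length contains all edges
of the component. -/
def EvenCycleAt (W : WGraph V) (x : V) : Prop :=
  ∃ c : W.graph.Walk x x, c.IsCycle ∧ Even c.length ∧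
    ∀ a b : V, W.graph.Reachable x a → W.graph.Adj a b → s(a, b) ∈ c.edges

/-- The connected component of `x` is a single edge of weight `0`. -/
def ZeroEdgeAt (W : WGraph V) (x : V) : Prop :=
  ∃ y : V, W.graph.Adj x y ∧ W.weight x y = 0 ∧
    (∀ a, W.graph.Adj x a → a = y) ∧ (∀ a, W.graph.Adj y a → a = x)

/-- Every connected component is an even cycle or an edge of weight `0`. -/
def AllEvenCycleOrZeroEdge (W : WGraph V) : Prop :=
  ∀ x ∈ W.verts, W.EvenCycleAt x ∨ W.ZeroEdgeAt x

/-- The two weighted graphs have the same vertices and edges, and on each connected component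
their weights agree up to a common sign. -/
def EqUpToSign (W W' : WGraph V) : Prop :=
  W.verts = W'.verts ∧ W.graph = W'.graph ∧
    ∃ ε : W.graph.ConnectedComponent → ℤˣ, ∀ a b : V, W.graph.Adj a b →
      W'.weight a b = (ε (W.graph.connectedComponentMk a) : ℤ) * W.weight a b

end WGraph

/-! ### The conditions on a closed walk -/

section Condition

variable {V : Type*} [Fintype V] {G : SimpleGraph V} {v : V}

/-- Part (i): no edge occurs both in an odd and in an even position, every vertex of the walk has
weighted degree `2` or `4`, and those of weighted degree `4` are cut vertices of `G_w`. -/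
def ConditionOne (w : G.Walk v v) : Prop :=
  (∀ k l : Fin w.length, Even (k : ℕ) → Odd (l : ℕ) → walkEdge w k ≠ walkEdge w l) ∧
    (∀ x ∈ (ofWalk w).verts, (ofWalk w).wdeg x = 2 ∨ (ofWalk w).wdeg x = 4) ∧
    ∀ x ∈ (ofWalk w).verts, (ofWalk w).wdeg x = 4 → (ofWalk w).IsCutVertex x

end Condition

end GraverWalk

end

/-!
# Primitive binomials of even closed walks

**Signed multigraphs.** A weighted graph `W` is translated into a multigraph `W.toSigned` whose
edges carry a sign: an edge of weight `c ≠ 0` becomes `|c|` parallel edges of the sign of `c`, and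
an edge of weight `0` becomes one positive and one negative edge. With this convention the three
cases of a separation at `x` are one operation (`SignedGraph.separate`): delete `x`, join its two
positive neighbours by a new positive edge and its two negative neighbours by a new negative edge;
in case (b) a contraction follows. In the graphs that occur every vertex has equally many positive
and negative edges, and one or two of each (`WGraph.Tame`).

**Primitivity.** A vertex `y` *splits* if deleting it disconnects its positive from its negative
neighbours. The binomial `f_w` is primitive if and only if (i) holds and every vertex of weighted
degree `4` splits (`isPrimitive_iff`).
* If they split and `x ≤ X`, `y ≤ Y` are exponent vectors with `π(s^x) = π(s^y)`, where
  `f_w = s^X - s^Y`, then a handshake count over the part of the graph beyond the positive edges at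
  a vertex `a` shows that the degree of `x` at `a` is even (`even_of_splits`) as soon as the degree
  of `X` at `a` is `2`. So at every vertex `(x, y)` is either zero or all of `(X, Y)`, and by
  following the walk the same alternative holds at all vertices (`ConditionOne.minimalPair`).
* Conversely, suppose that `f_w` is primitive. The positions of a segment of `w` between two visits
  of one vertex at times of the same parity would give a smaller binomial, so a vertex is visited at
  most twice, and then at times of opposite parity. If two such pairs of visits interleaved, two
  segments together would give a smaller binomial. So the stretch of `w` between the two visits of
  `x` shares no vertex other than `x` with the rest of `w`, and it carries all edges of one sign
  at `x` (`MinimalPair.splits`).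

**Reductions.** Contraction and separation preserve, in both directions, that all vertices of
signed degree two split; they preserve that all these are cut vertices; and they change neither the
set of vertices of signed degree one nor the relation of being joined, among these, by a path of
edges of one sign (`SignedGraph.Similar`, `Contractible.similar`, `Separable.similar`).
If all vertices of signed degree two split, and there is such a vertex, then some operation is
possible (`Tame.deg_ne_two_of_terminal`). Hence a reduction of such a graph has signed degree one
everywhere, so that its components are alternating cycles or edges of weight `0`; its adjacency is
exactly the preserved relation, which makes it unique, and the signs alternate along each
component. Conversely, if all components of a reduction are cycles or edges of weight `0`, then the
reduction has no cut vertex. As its vertices of signed degree two are cut vertices, there are none,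
and so all vertices of signed degree two of the original graph split.
-/

noncomputable section

namespace GraverWalk

/-! ### Signed multigraphs -/

/-- A multigraph with signed edges: `mult true a b` and `mult false a b` are the numbers of positive
and of negative edges between `a` and `b`. There are no loops. -/
structure SignedGraph (V : Type*) where
  mult : Bool → V → V → ℕ
  symm : ∀ σ a b, mult σ a b = mult σ b a
  irrefl : ∀ σ a, mult σ a a = 0

namespace SignedGraph

variable {V : Type*} {M M' M'' : SignedGraph V}

@[ext]
theorem ext {M M' : SignedGraph V} (h : ∀ σ a b, M.mult σ a b = M'.mult σ a b) : M = M' := by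
  obtain ⟨m, h1, h2⟩ := M
  obtain ⟨m', h1', h2'⟩ := M'
  obtain rfl : m = m' := by
    funext σ a b
    exact h σ a b
  rfl

/-- `a` and `b` are joined by an edge of some sign. -/
def Adj (M : SignedGraph V) (a b : V) : Prop := ∃ σ, 0 < M.mult σ a b

theorem Adj.symm {a b : V} (h : M.Adj a b) : M.Adj b a := by
  obtain ⟨σ, h⟩ := h
  exact ⟨σ, by rwa [M.symm]⟩

theorem Adj.ne {a b : V} (h : M.Adj a b) : a ≠ b := by
  rintro rfl
  obtain ⟨σ, h⟩ := h
  simp [M.irrefl] at h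

/-- `M.Conn y a b`: the vertices `a` and `b` are joined by a path in `M - y`. It holds for `a = b`
even if `a = y`. -/
def Conn (M : SignedGraph V) (y : V) : V → V → Prop :=
  Relation.ReflTransGen fun a b => M.Adj a b ∧ a ≠ y ∧ b ≠ y

theorem Conn.symm {y a b : V} (h : M.Conn y a b) : M.Conn y b a := by
  have : Std.Symm fun a b => M.Adj a b ∧ a ≠ y ∧ b ≠ y := ⟨fun _ _ h => ⟨h.1.symm, h.2.2, h.2.1⟩⟩
  exact Relation.ReflTransGen.stdSymm.symm _ _ h

theorem Conn.map {y y' a b : V} (h : M.Conn y a b) (f : V → V)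
    (hf : ∀ c d, M.Adj c d → c ≠ y → d ≠ y → M'.Conn y' (f c) (f d)) :
    M'.Conn y' (f a) (f b) := by
  induction h with
  | refl => exact .refl
  | tail _ h ih => exact ih.trans (hf _ _ h.1 h.2.1 h.2.2)

theorem Conn.mem_of_closed {y a b : V} {A : Set V} (h : M.Conn y a b) (ha : a ∈ A)
    (hA : ∀ a ∈ A, ∀ b, M.Adj a b → a ≠ y → b ≠ y → b ∈ A) : b ∈ A := by
  induction h with
  | refl => exact ha
  | tail _ h ih => exact hA _ ih _ h.1 h.2.1 h.2.2

/-- Deleting `y` disconnects every positive neighbour of `y` from every negative one. -/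
def Splits (M : SignedGraph V) (y : V) : Prop :=
  ∀ a b, 0 < M.mult true y a → 0 < M.mult false y b → ¬ M.Conn y a b

theorem Splits.not_conn {y : V} (h : M.Splits y) (σ : Bool) {a b : V} (ha : 0 < M.mult σ y a)
    (hb : 0 < M.mult (!σ) y b) : ¬ M.Conn y a b := by
  cases σ
  · exact fun hc => h b a hb ha hc.symm
  · exact h a b ha hb

theorem splits_of (y : V) (σ : Bool)
    (h : ∀ a b, 0 < M.mult σ y a → 0 < M.mult (!σ) y b → ¬ M.Conn y a b) : M.Splits y := by
  intro a b ha hb hc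
  cases σ
  · exact h b a hb ha hc.symm
  · exact h a b ha hb hc

/-- Deleting `y` disconnects two of its neighbours from each other, that is, `y` is a cut vertex. -/
def Cuts (M : SignedGraph V) (y : V) : Prop :=
  ∃ a b, M.Adj y a ∧ M.Adj y b ∧ ¬ M.Conn y a b

/-- The map `f` carries the neighbours of `y` in `M` onto the neighbours of `y` in `M'`, with all
signs at `y` changed if `c = true`, and respects which of them are connected after the deletion of
`y`. The properties of splitting and cutting depend on no more than that. -/
structure LocalIso (M M' : SignedGraph V) (y : V) (f : V → V) (c : Bool) : Prop where
  map : ∀ τ a, 0 < M.mult τ y a → 0 < M'.mult (xor c τ) y (f a)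
  lift : ∀ τ b, 0 < M'.mult (xor c τ) y b → ∃ a, f a = b ∧ 0 < M.mult τ y a
  conn : ∀ a b, M.Adj y a → M.Adj y b → (M.Conn y a b ↔ M'.Conn y (f a) (f b))

theorem LocalIso.splits_iff {y : V} {f : V → V} {c : Bool} (h : LocalIso M M' y f c) :
    M.Splits y ↔ M'.Splits y := by
  constructor
  · intro hs
    refine splits_of y c fun a b ha hb => ?_
    obtain ⟨a', rfl, ha'⟩ := h.lift false a (by simpa using ha)
    obtain ⟨b', rfl, hb'⟩ := h.lift true b (by simpa using hb)
    rw [← h.conn a' b' ⟨_, ha'⟩ ⟨_, hb'⟩]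
    exact hs.not_conn false ha' hb'
  · intro hs a b ha hb
    rw [h.conn a b ⟨true, ha⟩ ⟨false, hb⟩]
    exact hs.not_conn _ (h.map _ _ ha) (by simpa using h.map _ _ hb)

theorem LocalIso.cuts {y : V} {f : V → V} {c : Bool} (h : LocalIso M M' y f c)
    (hc : M.Cuts y) : M'.Cuts y := by
  obtain ⟨a, b, ha, hb, hab⟩ := hc
  refine ⟨f a, f b, ?_, ?_, by rwa [← h.conn a b ha hb]⟩
  · obtain ⟨σ, ha⟩ := ha
    exact ⟨_, h.map _ _ ha⟩
  · obtain ⟨σ, hb⟩ := hb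
    exact ⟨_, h.map _ _ hb⟩

section Finite

variable [Fintype V]

/-- The number of edges of sign `σ` at `y`. -/
def deg (M : SignedGraph V) (σ : Bool) (y : V) : ℕ := ∑ b, M.mult σ y b

theorem mult_le_deg (M : SignedGraph V) (σ : Bool) (y b : V) : M.mult σ y b ≤ M.deg σ y :=
  Finset.single_le_sum (f := fun b => M.mult σ y b) (fun _ _ => Nat.zero_le _) (Finset.mem_univ b)

theorem mult_add_mult_le_deg (M : SignedGraph V) (σ : Bool) (y : V) {b c : V} (h : b ≠ c) :
    M.mult σ y b + M.mult σ y c ≤ M.deg σ y := by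
  classical
  rw [← Finset.sum_pair (f := fun b => M.mult σ y b) h]
  exact Finset.sum_le_sum_of_subset (Finset.subset_univ _)

theorem mult_add_mult_add_mult_le_deg (M : SignedGraph V) (σ : Bool) (y : V) {b c d : V}
    (h : b ≠ c) (h1 : b ≠ d) (h2 : c ≠ d) :
    M.mult σ y b + M.mult σ y c + M.mult σ y d ≤ M.deg σ y := by
  classical
  have : ∑ x ∈ ({b, c, d} : Finset V), M.mult σ y x ≤ M.deg σ y :=
    Finset.sum_le_sum_of_subset (Finset.subset_univ _)
  rw [Finset.sum_insert (by simp [h, h1]), Finset.sum_pair h2] at this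
  omega

theorem exists_mult_pos (M : SignedGraph V) {σ : Bool} {y : V} (h : 0 < M.deg σ y) :
    ∃ b, 0 < M.mult σ y b := by
  by_contra! h'
  have : M.deg σ y = 0 := Finset.sum_eq_zero fun b _ => by simpa using h' b
  omega

theorem exists_pair_of_deg_eq_two (M : SignedGraph V) {σ : Bool} {y : V}
    (h : M.deg σ y = 2) (h1 : ∀ b, M.mult σ y b ≤ 1) :
    ∃ p q, p ≠ q ∧ M.mult σ y p = 1 ∧ M.mult σ y q = 1 := by
  classical
  obtain ⟨p, hp⟩ := M.exists_mult_pos (σ := σ) (y := y) (by omega)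
  have hp1 := h1 p
  have e := Finset.add_sum_erase Finset.univ (fun b => M.mult σ y b) (Finset.mem_univ p)
  have : ∑ b ∈ Finset.univ.erase p, M.mult σ y b = 1 := by
    have : M.deg σ y = ∑ b, M.mult σ y b := rfl
    omega
  obtain ⟨q, hq, hq0⟩ := Finset.exists_ne_zero_of_sum_ne_zero (this.symm ▸ one_ne_zero)
  exact ⟨p, q, (Finset.ne_of_mem_erase hq).symm, by omega, by have := h1 q; omega⟩

/-- Every vertex has as many positive as negative edges, and at most two of each. -/
structure Balanced (M : SignedGraph V) : Prop where
  deg_eq : ∀ σ y, M.deg σ y = M.deg true y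
  deg_le : ∀ y, M.deg true y ≤ 2

theorem Balanced.deg_le' (h : M.Balanced) (σ : Bool) (y : V) : M.deg σ y ≤ 2 := by
  rw [h.deg_eq]; exact h.deg_le y

/-- Every vertex with two edges of each sign splits. -/
def AllSplit (M : SignedGraph V) : Prop := ∀ y, M.deg true y = 2 → M.Splits y

/-- Every vertex with two edges of each sign is a cut vertex. -/
def AllCut (M : SignedGraph V) : Prop := ∀ y, M.deg true y = 2 → M.Cuts y

theorem Splits.cuts (hM : M.Balanced) {y : V} (h : M.Splits y) (hy : 0 < M.deg true y) :
    M.Cuts y := by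
  obtain ⟨a, ha⟩ := M.exists_mult_pos hy
  obtain ⟨b, hb⟩ := M.exists_mult_pos (σ := false) (y := y) (by rwa [hM.deg_eq])
  exact ⟨a, b, ⟨_, ha⟩, ⟨_, hb⟩, h a b ha hb⟩

/-- Reachability along edges of sign `σ`. -/
def Mono (M : SignedGraph V) (σ : Bool) : V → V → Prop :=
  Relation.ReflTransGen fun a b => 0 < M.mult σ a b

/-- Two different vertices with a single edge of each sign which are joined by a path all of whose
edges have the same sign. -/
def Linked (M : SignedGraph V) (a b : V) : Prop :=
  a ≠ b ∧ M.deg true a = 1 ∧ M.deg true b = 1 ∧ ∃ σ, M.Mono σ a b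

/-- The relation between a balanced signed graph `M` and the graph `M'` that an operation makes of
it: everything about `M` that is needed later and that the operations leave alone. -/
structure Similar (M M' : SignedGraph V) : Prop where
  balanced : M'.Balanced
  allSplit : M.AllSplit ↔ M'.AllSplit
  allCut : M.AllCut → M'.AllCut
  deg_one : ∀ y, M.deg true y = 1 ↔ M'.deg true y = 1
  linked : ∀ a b, M.Linked a b ↔ M'.Linked a b

theorem Similar.refl (h : M.Balanced) : Similar M M :=
  ⟨h, Iff.rfl, id, fun _ => Iff.rfl, fun _ _ => Iff.rfl⟩

theorem Similar.trans (h : Similar M M') (h' : Similar M' M'') : Similar M M'' :=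
  ⟨h'.balanced, h.allSplit.trans h'.allSplit, h'.allCut ∘ h.allCut,
    fun y => (h.deg_one y).trans (h'.deg_one y), fun a b => (h.linked a b).trans (h'.linked a b)⟩

end Finite

/-- A path is mapped to a path by a map that need be a morphism only along paths satisfying the
invariant `p`. -/
theorem reflTransGen_map_of_inv {r r' : V → V → Prop} (p : V → Prop) (f : V → V)
    (h : ∀ c d, p c → r c d → p d ∧ Relation.ReflTransGen r' (f c) (f d)) {a b : V} (ha : p a)
    (hab : Relation.ReflTransGen r a b) : Relation.ReflTransGen r' (f a) (f b) := by
  suffices p b ∧ Relation.ReflTransGen r' (f a) (f b) from this.2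
  induction hab with
  | refl => exact ⟨ha, .refl⟩
  | tail _ hcd ih =>
    obtain ⟨h1, h2⟩ := h _ _ ih.1 hcd
    exact ⟨h1, ih.2.trans h2⟩

/-! ### Contraction of signed multigraphs -/

open scoped Classical in
/-- Contraction of the edges between `i` and `j`, where `A` is the side of `i`: the signs of the
edges within `A` are reversed, and the edges from `j` to vertices outside `A` are attached to `i`
instead. -/
def contract (M : SignedGraph V) (i j : V) (A : Set V) : SignedGraph V where
  mult τ a b :=
    if a = j ∨ b = j then 0
    else if a ∈ A then
      if b ∈ A then M.mult (!τ) a b else if a = i then M.mult τ j b else 0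
    else if b ∈ A then
      if b = i then M.mult τ j a else 0
    else M.mult τ a b
  symm τ a b := by
    rw [M.symm τ a b, M.symm (!τ) a b]
    simp only [or_comm (a := a = j)]
    split_ifs <;> simp_all
  irrefl τ a := by
    simp only [M.irrefl]
    split_ifs <;> rfl

/-- There are precisely two edges between `i` and `j`, both of sign `σ`, and all paths between the
vertex set `A ∋ i` and its complement `∋ j` use them. -/
structure Contractible (M : SignedGraph V) (σ : Bool) (i j : V) (A : Set V) : Prop where
  mult_eq : M.mult σ i j = 2
  mult_not : M.mult (!σ) i j = 0
  mem : i ∈ A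
  not_mem : j ∉ A
  cross : ∀ a ∈ A, ∀ b ∉ A, M.Adj a b → a = i ∧ b = j

namespace Contractible

variable {σ : Bool} {i j : V} {A : Set V}

theorem ne (h : M.Contractible σ i j A) : i ≠ j := fun e => h.not_mem (e ▸ h.mem)

theorem ne_of_not_mem (h : M.Contractible σ i j A) {b : V} (hb : b ∉ A) : b ≠ i :=
  fun e => hb (e ▸ h.mem)

theorem mult_cross (h : M.Contractible σ i j A) (τ : Bool) {a b : V} (ha : a ∈ A) (hb : b ∉ A)
    (hab : ¬ (a = i ∧ b = j)) : M.mult τ a b = 0 := by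
  by_contra h0
  exact hab (h.cross a ha b hb ⟨τ, Nat.pos_of_ne_zero h0⟩)

theorem contract_mem_mem (h : M.Contractible σ i j A) (τ : Bool) {a b : V} (ha : a ∈ A)
    (hb : b ∈ A) : (M.contract i j A).mult τ a b = M.mult (!τ) a b := by
  have h1 : a ≠ j := fun e => h.not_mem (e ▸ ha)
  have h2 : b ≠ j := fun e => h.not_mem (e ▸ hb)
  simp [contract, ha, hb, h1, h2]

/-- Outside `A`, contraction renames `j` to `i`. With the transposition in place of the renaming,
row sums can be compared without treating the removed vertex separately. -/
theorem contract_not_mem (h : M.Contractible σ i j A) (τ : Bool) {a b : V} (ha : a ∉ A)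
    (haj : a ≠ j) [DecidableEq V] :
    (M.contract i j A).mult τ a b = M.mult τ a (Equiv.swap i j b) := by
  by_cases hb : b = j
  · subst hb
    rw [Equiv.swap_apply_right, M.symm, h.mult_cross τ h.mem ha (by tauto)]
    simp [contract]
  by_cases hbi : b = i
  · subst hbi
    rw [Equiv.swap_apply_left, M.symm]
    simp [contract, ha, haj, hb, h.mem]
  rw [Equiv.swap_apply_of_ne_of_ne hbi hb]
  by_cases hbA : b ∈ A
  · rw [M.symm, h.mult_cross τ hbA ha (by tauto)]
    simp [contract, ha, haj, hb, hbA, hbi]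
  · simp [contract, ha, haj, hb, hbA]

theorem contract_left (h : M.Contractible σ i j A) (τ : Bool) {b : V} (hb : b ∉ A) (hbj : b ≠ j) :
    (M.contract i j A).mult τ i b = M.mult τ j b := by
  simp [contract, h.mem, hb, hbj, h.ne]

theorem contract_mem_not_mem (_h : M.Contractible σ i j A) (τ : Bool) {a b : V} (ha : a ∈ A)
    (hai : a ≠ i) (hb : b ∉ A) : (M.contract i j A).mult τ a b = 0 := by
  simp [contract, ha, hai, hb]

theorem contract_removed (M : SignedGraph V) (i j : V) (A : Set V) (τ : Bool) (b : V) :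
    (M.contract i j A).mult τ j b = 0 := by
  simp [contract]

theorem not_conn_left (h : M.Contractible σ i j A) {a b : V} (ha : a ∈ A) (hb : b ∉ A) :
    ¬ M.Conn i a b := fun hc => hb <| hc.mem_of_closed ha fun c hc d hd hci _ => by
  by_contra hdA
  exact hci (h.cross c hc d hdA hd).1

theorem not_conn_right (h : M.Contractible σ i j A) {a b : V} (ha : a ∈ A) (hb : b ∉ A) :
    ¬ M.Conn j a b := fun hc => hb <| hc.mem_of_closed ha fun c hc d hd _ hdj => by
  by_contra hdA
  exact hdj (h.cross c hc d hdA hd).2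

open scoped Classical in
/-- Away from the contracted edge a vertex sees the same picture before and after, up to a change of
all signs on the side `A`. -/
theorem localIso (h : M.Contractible σ i j A) {y : V} (hyi : y ≠ i) (hyj : y ≠ j) :
    LocalIso M (M.contract i j A) y (fun a => if a = j then i else a) (decide (y ∈ A)) := by
  have hij := h.ne
  have adjf : ∀ a b, M.Adj a b → (if a = j then i else a) ≠ (if b = j then i else b) →
      (M.contract i j A).Adj (if a = j then i else a) (if b = j then i else b) := by
    intro a b hab hne
    by_cases haA : a ∈ A
    · have haj : a ≠ j := fun e => h.not_mem (e ▸ haA)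
      by_cases hbA : b ∈ A
      · have hbj : b ≠ j := fun e => h.not_mem (e ▸ hbA)
        obtain ⟨τ, hab⟩ := hab
        simp only [haj, hbj, if_false]
        exact ⟨!τ, by rwa [h.contract_mem_mem _ haA hbA, Bool.not_not]⟩
      · obtain ⟨rfl, rfl⟩ := h.cross a haA b hbA hab
        simp [haj] at hne
    · by_cases hbA : b ∈ A
      · obtain ⟨rfl, rfl⟩ := h.cross b hbA a haA hab.symm
        simp [hij] at hne
      · obtain ⟨τ, hab⟩ := hab
        refine ⟨τ, ?_⟩
        by_cases haj : a = j
        · have hbj : b ≠ j := by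
            rintro rfl
            exact hne (by simp [haj])
          simp only [haj, hbj, if_true, if_false]
          rw [h.contract_left τ hbA hbj, ← haj]
          exact hab
        · by_cases hbj : b = j
          · simp only [haj, hbj, if_true, if_false]
            rw [SignedGraph.symm, h.contract_left τ haA haj, M.symm, ← hbj]
            exact hab
          · simp only [haj, hbj, if_false]
            rw [h.contract_not_mem τ haA haj, Equiv.swap_apply_of_ne_of_ne _ hbj]
            · exact hab
            · rintro rfl; exact hbA h.mem
  have ij : M.Conn y i j := Relation.ReflTransGen.single
    ⟨⟨σ, by rw [h.mult_eq]; norm_num⟩, hyi.symm, hyj.symm⟩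
  have step : ∀ a b, (M.contract i j A).Adj a b → a ≠ y → b ≠ y → M.Conn y a b := by
    intro a b hab hay hby
    obtain ⟨τ, hab⟩ := hab
    have haj : a ≠ j := by
      rintro rfl
      rw [contract_removed] at hab
      exact lt_irrefl _ hab
    have hbj : b ≠ j := by
      rintro rfl
      rw [SignedGraph.symm, contract_removed] at hab
      exact lt_irrefl _ hab
    by_cases haA : a ∈ A
    · by_cases hbA : b ∈ A
      · rw [h.contract_mem_mem _ haA hbA] at hab
        exact .single ⟨⟨_, hab⟩, hay, hby⟩
      · by_cases hai : a = i
        · subst hai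
          rw [h.contract_left _ hbA hbj] at hab
          exact ij.tail ⟨⟨_, hab⟩, hyj.symm, hby⟩
        · rw [h.contract_mem_not_mem _ haA hai hbA] at hab
          exact absurd hab (lt_irrefl _)
    · by_cases hbA : b ∈ A
      · by_cases hbi : b = i
        · subst hbi
          rw [SignedGraph.symm, h.contract_left _ haA haj] at hab
          exact Conn.symm (ij.tail ⟨⟨_, hab⟩, hyj.symm, hay⟩)
        · rw [SignedGraph.symm, h.contract_mem_not_mem _ hbA hbi haA] at hab
          exact absurd hab (lt_irrefl _)
      · rw [h.contract_not_mem _ haA haj, Equiv.swap_apply_of_ne_of_ne _ hbj] at hab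
        · exact .single ⟨⟨_, hab⟩, hay, hby⟩
        · rintro rfl; exact hbA h.mem
  have fne : ∀ a, a ≠ y → (if a = j then i else a) ≠ y := by
    intro a ha
    split_ifs
    · exact hyi.symm
    · exact ha
  have toF : ∀ a, M.Conn y a (if a = j then i else a) := by
    intro a
    split_ifs with e
    · rw [e]; exact ij.symm
    · exact .refl
  refine ⟨?_, ?_, ?_⟩
  · intro τ a ha
    by_cases hyA : y ∈ A
    · have haA : a ∈ A := by
        by_contra haA
        exact hyi (h.cross y hyA a haA ⟨_, ha⟩).1
      have haj : a ≠ j := fun e => h.not_mem (e ▸ haA)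
      simp only [haj, if_false, hyA, decide_true, Bool.true_xor]
      rwa [h.contract_mem_mem _ hyA haA, Bool.not_not]
    · have hai : a ≠ i := by
        rintro rfl
        exact hyj (h.cross a h.mem y hyA (Adj.symm ⟨_, ha⟩)).2
      simp only [hyA, decide_false, Bool.false_xor]
      rw [h.contract_not_mem _ hyA hyj]
      split_ifs with e
      · rw [Equiv.swap_apply_left, ← e]; exact ha
      · rwa [Equiv.swap_apply_of_ne_of_ne hai e]
  · intro τ b hb
    have hbj : b ≠ j := by
      rintro rfl
      rw [SignedGraph.symm, contract_removed] at hb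
      exact lt_irrefl _ hb
    by_cases hyA : y ∈ A
    · simp only [hyA, decide_true, Bool.true_xor] at hb
      by_cases hbA : b ∈ A
      · refine ⟨b, by simp [hbj], ?_⟩
        rwa [h.contract_mem_mem _ hyA hbA, Bool.not_not] at hb
      · rw [h.contract_mem_not_mem _ hyA hyi hbA] at hb
        exact absurd hb (lt_irrefl _)
    · simp only [hyA, decide_false, Bool.false_xor] at hb
      rw [h.contract_not_mem _ hyA hyj] at hb
      refine ⟨_, ?_, hb⟩
      by_cases hbi : b = i
      · simp [hbi]
      · rw [Equiv.swap_apply_of_ne_of_ne hbi hbj]; simp [hbj]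
  · intro a b ha hb
    constructor
    · intro hc
      refine hc.map (fun a => if a = j then i else a) fun c d hcd hc hd => ?_
      by_cases e : (if c = j then i else c) = (if d = j then i else d)
      · simp only [e]; exact .refl
      · exact .single ⟨adjf c d hcd e, fne c hc, fne d hd⟩
    · intro hc
      have : M.Conn y (if a = j then i else a) (if b = j then i else b) :=
        hc.map id step
      exact ((toF a).trans this).trans (toF b).symm

variable [Fintype V]

theorem deg_left (h : M.Contractible σ i j A) (hM : M.Balanced) : M.deg true i = 2 := by
  have h1 := M.mult_le_deg σ i j
  have h2 := hM.deg_le' σ i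
  rw [h.mult_eq] at h1
  rw [← hM.deg_eq σ]
  omega

theorem deg_right (h : M.Contractible σ i j A) (hM : M.Balanced) : M.deg true j = 2 := by
  have h1 := M.mult_le_deg σ j i
  have h2 := hM.deg_le' σ j
  rw [M.symm, h.mult_eq] at h1
  rw [← hM.deg_eq σ]
  omega

theorem mult_left (h : M.Contractible σ i j A) (hM : M.Balanced) {b : V} (hb : b ≠ j) :
    M.mult σ i b = 0 := by
  have h1 := M.mult_add_mult_le_deg σ i hb
  have h2 := hM.deg_le' σ i
  rw [h.mult_eq] at h1
  omega

theorem mult_right (h : M.Contractible σ i j A) (hM : M.Balanced) {b : V} (hb : b ≠ i) :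
    M.mult σ j b = 0 := by
  have h1 := M.mult_add_mult_le_deg σ j hb
  have h2 := hM.deg_le' σ j
  rw [M.symm σ j i, h.mult_eq] at h1
  omega

theorem deg_removed (M : SignedGraph V) (i j : V) (A : Set V) (τ : Bool) :
    (M.contract i j A).deg τ j = 0 :=
  Finset.sum_eq_zero fun b _ => contract_removed M i j A τ b

theorem deg_contract (h : M.Contractible σ i j A) (hM : M.Balanced) (τ : Bool) {y : V}
    (hy : y ≠ j) : (M.contract i j A).deg τ y = M.deg true y := by
  classical
  by_cases hyi : y = i
  · subst hyi
    -- The edges of sign `τ` at the merged vertex come from those of sign `!τ` at one end and those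
    -- of sign `τ` at the other end; the two contracted edges are among exactly one of these.
    have key : (M.contract y j A).deg τ y + 2 = M.deg (!τ) y + M.deg τ j := by
      have e : ∀ b, (M.contract y j A).mult τ y b +
          ((if b = y then M.mult τ j y else 0) + (if b = j then M.mult (!τ) y j else 0))
          = M.mult (!τ) y b + M.mult τ j b := by
        intro b
        by_cases hbj : b = j
        · subst hbj
          simp [(M.contract y b A).symm τ y b, contract_removed, hy.symm, M.irrefl]
        by_cases hby : b = y
        · subst hby
          simp [hbj, SignedGraph.irrefl]
        by_cases hbA : b ∈ A
        · rw [h.contract_mem_mem τ h.mem hbA, M.symm τ j b,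
            h.mult_cross τ hbA h.not_mem (by tauto)]
          simp [hbj, hby]
        · rw [h.contract_left τ hbA hbj, h.mult_cross (!τ) h.mem hbA (by tauto)]
          simp [hbj, hby]
      have e2 := Finset.sum_congr (rfl : (Finset.univ : Finset V) = Finset.univ) fun b _ => e b
      rw [Finset.sum_add_distrib, Finset.sum_add_distrib, Finset.sum_add_distrib] at e2
      simp only [Finset.sum_ite_eq', Finset.mem_univ, if_true] at e2
      have e3 : M.mult τ j y + M.mult (!τ) y j = 2 := by
        rw [M.symm]
        have := h.mult_eq
        have := h.mult_not
        cases σ <;> cases τ <;> simp_all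
      rw [e3] at e2
      exact e2
    have := h.deg_left hM
    have := h.deg_right hM
    have := hM.deg_eq (!τ) y
    have := hM.deg_eq τ j
    omega
  by_cases hyA : y ∈ A
  · rw [← hM.deg_eq (!τ)]
    refine Finset.sum_congr rfl fun b _ => ?_
    by_cases hb : b ∈ A
    · exact h.contract_mem_mem τ hyA hb
    · rw [h.contract_mem_not_mem τ hyA hyi hb, h.mult_cross _ hyA hb (by tauto)]
  · rw [← hM.deg_eq τ]
    unfold deg
    rw [← Equiv.sum_comp (Equiv.swap i j)]
    exact Finset.sum_congr rfl fun b _ => by rw [h.contract_not_mem τ hyA hy, Equiv.swap_apply_self]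

theorem balanced (h : M.Contractible σ i j A) (hM : M.Balanced) : (M.contract i j A).Balanced := by
  constructor
  · intro τ y
    by_cases hy : y = j
    · subst hy; simp [deg_removed]
    · rw [h.deg_contract hM _ hy, h.deg_contract hM _ hy]
  · intro y
    by_cases hy : y = j
    · subst hy; simp [deg_removed]
    · rw [h.deg_contract hM _ hy]; exact hM.deg_le y

theorem splits_left (h : M.Contractible σ i j A) (hM : M.Balanced) : M.Splits i := by
  refine splits_of i σ fun a b ha hb hc => ?_
  have haj : a = j := by
    by_contra haj
    simp [h.mult_left hM haj] at ha
  have hbA : b ∈ A := by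
    by_contra hbA
    obtain ⟨-, rfl⟩ := h.cross i h.mem b hbA ⟨_, hb⟩
    simp [h.mult_not] at hb
  subst haj
  exact h.not_conn_left hbA h.not_mem hc.symm

theorem splits_right (h : M.Contractible σ i j A) (hM : M.Balanced) : M.Splits j := by
  refine splits_of j σ fun a b ha hb hc => ?_
  have haj : a = i := by
    by_contra haj
    simp [h.mult_right hM haj] at ha
  subst haj
  refine h.not_conn_right h.mem (fun hbA => ?_) hc
  obtain ⟨rfl, -⟩ := h.cross b hbA j h.not_mem (Adj.symm ⟨_, hb⟩)
  rw [M.symm, h.mult_not] at hb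
  exact lt_irrefl _ hb

/-- Since the edge between `i` and `j` takes up all edges of sign `σ` at both ends, the edges
remaining at the new vertex have one sign towards `A` and the other one away from `A`: it splits. -/
theorem splits_contract (h : M.Contractible σ i j A) (hM : M.Balanced) :
    (M.contract i j A).Splits i := by
  refine splits_of i σ fun a b ha hb hc => ?_
  have haj : a ≠ j := by
    rintro rfl
    rw [SignedGraph.symm, contract_removed] at ha
    exact lt_irrefl _ ha
  have hbj : b ≠ j := by
    rintro rfl
    rw [SignedGraph.symm, contract_removed] at hb
    exact lt_irrefl _ hb
  have hai : a ≠ i := fun e => Adj.ne ⟨_, ha⟩ e.symm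
  have haA : a ∈ A := by
    by_contra haA
    rw [h.contract_left _ haA haj, h.mult_right hM hai] at ha
    exact lt_irrefl _ ha
  have hbA : b ∉ A := by
    intro hbA
    rw [h.contract_mem_mem _ h.mem hbA, Bool.not_not, h.mult_left hM hbj] at hb
    exact lt_irrefl _ hb
  refine hbA (hc.mem_of_closed haA fun c hc d hd hci _ => ?_)
  by_contra hdA
  obtain ⟨τ, hd⟩ := hd
  rw [h.contract_mem_not_mem τ hc hci hdA] at hd
  exact lt_irrefl _ hd

/-- A path of constant sign between vertices of degree one cannot switch sides of the contracted
edge: there is no edge of sign `!σ` between `i` and `j`, and no way to reach them by other edges of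
sign `σ`. -/
theorem mono_iff (h : M.Contractible σ i j A) (hM : M.Balanced) {a b : V}
    (ha : M.deg true a = 1) (hb : M.deg true b = 1) :
    (∃ τ, M.Mono τ a b) ↔ ∃ τ, (M.contract i j A).Mono τ a b := by
  classical
  have hi := h.deg_left hM
  have hj := h.deg_right hM
  have hai : a ≠ i := by rintro rfl; omega
  have haj : a ≠ j := by rintro rfl; omega
  have hbi : b ≠ i := by rintro rfl; omega
  have hbj : b ≠ j := by rintro rfl; omega
  have key : ∀ τ, τ ≠ σ → τ = !σ := by cases σ <;> simp
  constructor
  · rintro ⟨τ, hc⟩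
    by_cases haA : a ∈ A
    -- The path stays within `A`: it can leave only along an edge from `i` to `j`, which
    -- has sign `σ`, and a path of sign `σ` does not reach `i`, as all edges of sign `σ` at `i`
    -- lead to `j`.
    · refine ⟨!τ, reflTransGen_map_of_inv (fun c => c ∈ A ∧ (τ = σ → c ≠ i)) id
        (fun c d hc hcd => ?_) ⟨haA, fun _ => hai⟩ hc⟩
      have hdA : d ∈ A := by
        by_contra hdA
        obtain ⟨rfl, rfl⟩ := h.cross c hc.1 d hdA ⟨_, hcd⟩
        by_cases e : τ = σ
        · exact hc.2 e rfl
        · rw [key τ e, h.mult_not] at hcd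
          exact lt_irrefl _ hcd
      refine ⟨⟨hdA, ?_⟩, .single ?_⟩
      · rintro rfl rfl
        rw [M.symm, h.mult_left hM (fun e => h.not_mem (e ▸ hc.1))] at hcd
        exact lt_irrefl _ hcd
      · simp only [id]
        rwa [h.contract_mem_mem _ hc.1 hdA, Bool.not_not]
    · have := reflTransGen_map_of_inv (r' := fun a b => 0 < (M.contract i j A).mult τ a b)
        (fun c => c ∉ A ∧ (τ = σ → c ≠ j)) (fun c => if c = j then i else c)
        (fun c d hc hcd => ?_) ⟨haA, fun _ => haj⟩ hc
      · simp only [haj, hbj, if_false] at this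
        exact ⟨τ, this⟩
      have hdA : d ∉ A := by
        intro hdA
        obtain ⟨rfl, rfl⟩ := h.cross d hdA c hc.1 (Adj.symm ⟨_, hcd⟩)
        by_cases e : τ = σ
        · exact hc.2 e rfl
        · rw [key τ e, M.symm, h.mult_not] at hcd
          exact lt_irrefl _ hcd
      refine ⟨⟨hdA, ?_⟩, .single ?_⟩
      · rintro rfl rfl
        rw [M.symm, h.mult_right hM (h.ne_of_not_mem hc.1)] at hcd
        exact lt_irrefl _ hcd
      · by_cases hcj : c = j
        · have hdj : d ≠ j := fun e => Adj.ne ⟨τ, hcd⟩ (hcj.trans e.symm)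
          simp only [hcj, hdj, if_true, if_false]
          rw [h.contract_left τ hdA hdj, ← hcj]
          exact hcd
        · simp only [hcj, if_false]
          rw [h.contract_not_mem τ hc.1 hcj]
          split_ifs with e
          · rw [Equiv.swap_apply_left, ← e]; exact hcd
          · rw [Equiv.swap_apply_of_ne_of_ne (h.ne_of_not_mem hdA) e]; exact hcd
  -- In the contracted graph, the edges at `i` have sign `σ` towards `A` and sign `!σ`
  -- away from `A`.
  · rintro ⟨τ, hc⟩
    have hnj : ∀ {c d}, 0 < (M.contract i j A).mult τ c d → d ≠ j := by
      rintro c d hcd rfl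
      rw [SignedGraph.symm, contract_removed] at hcd
      exact lt_irrefl _ hcd
    by_cases haA : a ∈ A
    · refine ⟨!τ, reflTransGen_map_of_inv (fun c => c ∈ A ∧ (τ ≠ σ → c ≠ i)) id
        (fun c d hc hcd => ?_) ⟨haA, fun _ => hai⟩ hc⟩
      have hdj := hnj hcd
      have hdA : d ∈ A := by
        by_contra hdA
        by_cases e : c = i
        · subst e
          have e : τ = σ := not_not.1 fun e => hc.2 e rfl
          rw [h.contract_left _ hdA hdj, e,
            h.mult_right hM (h.ne_of_not_mem hdA)] at hcd
          exact lt_irrefl _ hcd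
        · rw [h.contract_mem_not_mem _ hc.1 e hdA] at hcd
          exact lt_irrefl _ hcd
      rw [h.contract_mem_mem _ hc.1 hdA] at hcd
      refine ⟨⟨hdA, ?_⟩, .single hcd⟩
      rintro e rfl
      rw [key τ e, Bool.not_not, M.symm,
        h.mult_left hM (fun e => h.not_mem (e ▸ hc.1))] at hcd
      exact lt_irrefl _ hcd
    · have := reflTransGen_map_of_inv (r' := fun a b => 0 < M.mult τ a b)
        (fun c => (c ∉ A ∧ c ≠ j) ∨ (c = i ∧ τ ≠ σ)) (fun c => if c = i then j else c)
        (fun c d hc hcd => ?_) (.inl ⟨haA, haj⟩) hc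
      · simp only [hai, hbi, if_false] at this
        exact ⟨τ, this⟩
      have hdj := hnj hcd
      rcases hc with ⟨hcA, hcj⟩ | ⟨rfl, e⟩
      · have hci : c ≠ i := fun e => hcA (e ▸ h.mem)
        simp only [hci, if_false]
        rw [h.contract_not_mem _ hcA hcj] at hcd
        by_cases hdi : d = i
        · subst hdi
          rw [Equiv.swap_apply_left] at hcd
          refine ⟨.inr ⟨rfl, ?_⟩, .single (by simpa using hcd)⟩
          rintro rfl
          rw [M.symm, h.mult_right hM hci] at hcd
          exact lt_irrefl _ hcd
        · rw [Equiv.swap_apply_of_ne_of_ne hdi hdj] at hcd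
          simp only [hdi, if_false]
          refine ⟨.inl ⟨fun hdA => hdi ?_, hdj⟩, .single hcd⟩
          exact (h.cross d hdA c hcA (Adj.symm ⟨_, hcd⟩)).1
      · have hdi : d ≠ c := fun e => Adj.ne ⟨τ, hcd⟩ e.symm
        have hdA : d ∉ A := by
          intro hdA
          rw [h.contract_mem_mem _ h.mem hdA, key τ e, Bool.not_not,
            h.mult_left hM hdj] at hcd
          exact lt_irrefl _ hcd
        rw [h.contract_left _ hdA hdj] at hcd
        simp only [hdi, if_true, if_false]
        exact ⟨.inl ⟨hdA, hdj⟩, .single hcd⟩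

theorem similar (h : M.Contractible σ i j A) (hM : M.Balanced) :
    Similar M (M.contract i j A) := by
  have hi := h.deg_left hM
  have hj := h.deg_right hM
  have deg_one : ∀ y, M.deg true y = 1 ↔ (M.contract i j A).deg true y = 1 := by
    intro y
    by_cases hy : y = j
    · subst hy; rw [deg_removed, hj]; norm_num
    · rw [h.deg_contract hM _ hy]
  refine ⟨h.balanced hM, ⟨?_, ?_⟩, ?_, deg_one, ?_⟩
  · intro hs y hy
    by_cases hyj : y = j
    · subst hyj; rw [deg_removed] at hy; omega
    by_cases hyi : y = i
    · subst hyi; exact h.splits_contract hM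
    rw [← (h.localIso hyi hyj).splits_iff]
    exact hs y (by rwa [h.deg_contract hM _ hyj] at hy)
  · intro hs y hy
    by_cases hyj : y = j
    · subst hyj; exact h.splits_right hM
    by_cases hyi : y = i
    · subst hyi; exact h.splits_left hM
    rw [(h.localIso hyi hyj).splits_iff]
    exact hs y (by rwa [h.deg_contract hM _ hyj])
  · intro hs y hy
    by_cases hyj : y = j
    · subst hyj; rw [deg_removed] at hy; omega
    by_cases hyi : y = i
    · subst hyi; exact (h.splits_contract hM).cuts (h.balanced hM) (by omega)
    exact (h.localIso hyi hyj).cuts (hs y (by rwa [h.deg_contract hM _ hyj] at hy))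
  · intro a b
    unfold Linked
    rw [← deg_one a, ← deg_one b]
    refine and_congr_right fun _ => and_congr_right fun ha => and_congr_right fun hb =>
      h.mono_iff hM ha hb

end Contractible

end SignedGraph

/-! ### Separation of signed multigraphs -/

namespace SignedGraph

variable {V : Type*} {M : SignedGraph V}

open scoped Classical in
/-- Deletion of the vertex `x` together with its edges. -/
def del (M : SignedGraph V) (x : V) : SignedGraph V where
  mult τ a b := if a = x ∨ b = x then 0 else M.mult τ a b
  symm τ a b := by simp only [M.symm τ a b, or_comm (a := a = x)]
  irrefl τ a := by simp [M.irrefl]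

open scoped Classical in
/-- One more edge of sign `σ` between `k` and `l`; nothing happens if `k = l`. -/
def addEdge (M : SignedGraph V) (σ : Bool) (k l : V) : SignedGraph V where
  mult τ a b := M.mult τ a b + if τ = σ ∧ a ≠ b ∧ s(a, b) = s(k, l) then 1 else 0
  symm τ a b := by
    simp only [M.symm τ a b, ne_comm (a := a), Sym2.eq_swap (a := a)]
  irrefl τ a := by simp [M.irrefl]

theorem addEdge_contract {i j k l : V} {A : Set V} (hi : i ∈ A) (hk : k ∉ A) (hl : l ∉ A)
    (hkj : k ≠ j) (hlj : l ≠ j) (σ : Bool) :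
    (M.contract i j A).addEdge σ k l = (M.addEdge σ k l).contract i j A := by
  ext τ a b
  have hki : k ≠ i := fun e => hk (e ▸ hi)
  have hli : l ≠ i := fun e => hl (e ▸ hi)
  by_cases e : s(a, b) = s(k, l)
  · rcases Sym2.eq_iff.1 e with ⟨rfl, rfl⟩ | ⟨rfl, rfl⟩ <;>
      simp [addEdge, contract, *]
  · have e1 : ∀ x y, x ∈ A → s(x, y) ≠ s(k, l) := by
      intro x y hx h
      rcases Sym2.eq_iff.1 h with ⟨rfl, rfl⟩ | ⟨rfl, rfl⟩ <;> contradiction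
    have e2 : ∀ y, s(j, y) ≠ s(k, l) := by
      intro y h
      rcases Sym2.eq_iff.1 h with ⟨rfl, rfl⟩ | ⟨rfl, rfl⟩ <;> contradiction
    simp only [addEdge, contract, e, e2, and_false, if_false, add_zero]

/-- Separation of the vertex `x` with positive neighbours `p true`, `q true` and negative neighbours
`p false`, `q false`: the vertex `x` is deleted, and each of the two pairs is joined by a new edge
of its sign. -/
def separate (M : SignedGraph V) (x : V) (p q : Bool → V) : SignedGraph V :=
  ((M.del x).addEdge true (p true) (q true)).addEdge false (p false) (q false)

open scoped Classical in
/-- The vertex `x` has exactly two edges of each sign `τ`, to different vertices `p τ` and `q τ`,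
and the other vertices fall into a positive side `A true` and a negative side `A false` with no edge
between them. -/
structure Separable (M : SignedGraph V) (x : V) (p q : Bool → V) (A : Bool → Set V) : Prop where
  ne : ∀ τ, p τ ≠ q τ
  mult : ∀ τ b, M.mult τ x b = (if b = p τ then 1 else 0) + (if b = q τ then 1 else 0)
  p_mem : ∀ τ, p τ ∈ A τ
  q_mem : ∀ τ, q τ ∈ A τ
  not_mem : ∀ τ, x ∉ A τ
  disj : ∀ τ, ∀ a ∈ A τ, a ∉ A (!τ)
  cover : ∀ a, a ≠ x → ∃ τ, a ∈ A τ
  closed : ∀ τ, ∀ a ∈ A τ, ∀ b, M.Adj a b → b ≠ x → b ∈ A τ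

namespace Separable

variable {x : V} {p q : Bool → V} {A : Bool → Set V}

theorem p_ne (h : M.Separable x p q A) (τ : Bool) : p τ ≠ x :=
  fun e => h.not_mem τ (e ▸ h.p_mem τ)

theorem q_ne (h : M.Separable x p q A) (τ : Bool) : q τ ≠ x :=
  fun e => h.not_mem τ (e ▸ h.q_mem τ)

theorem mult_pos_iff (h : M.Separable x p q A) (τ : Bool) (b : V) :
    0 < M.mult τ x b ↔ b = p τ ∨ b = q τ := by
  rw [h.mult]
  split_ifs <;> simp_all

theorem not_mem_of_mem (h : M.Separable x p q A) {σ τ : Bool} {a : V} (ha : a ∈ A σ)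
    (hb : a ∈ A τ) : σ = τ := by
  by_contra hne
  have : τ = !σ := by revert hne; cases σ <;> cases τ <;> simp
  exact h.disj σ a ha (this ▸ hb)

theorem eq_of_adj (h : M.Separable x p q A) {σ τ : Bool} {a : V} (ha : a ∈ A σ)
    (hab : 0 < M.mult τ x a) : τ = σ ∧ (a = p σ ∨ a = q σ) := by
  obtain hab' | hab' := (h.mult_pos_iff τ a).1 hab
  · obtain rfl := h.not_mem_of_mem ha (hab' ▸ h.p_mem τ)
    exact ⟨rfl, .inl hab'⟩
  · obtain rfl := h.not_mem_of_mem ha (hab' ▸ h.q_mem τ)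
    exact ⟨rfl, .inr hab'⟩

open scoped Classical in
theorem separate_mult (h : M.Separable x p q A) (τ : Bool) (a b : V) :
    (M.separate x p q).mult τ a b = if a = x ∨ b = x then 0 else
      M.mult τ a b + if (a = p τ ∧ b = q τ) ∨ (a = q τ ∧ b = p τ) then 1 else 0 := by
  have key : ∀ τ, (a ≠ b ∧ s(a, b) = s(p τ, q τ)) ↔
      ((a = p τ ∧ b = q τ) ∨ (a = q τ ∧ b = p τ)) := by
    intro τ
    rw [Sym2.eq_iff, and_iff_right_iff_imp]
    rintro (⟨rfl, rfl⟩ | ⟨rfl, rfl⟩)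
    · exact h.ne τ
    · exact (h.ne τ).symm
  have key2 : a = x ∨ b = x → ∀ τ, ¬ ((a = p τ ∧ b = q τ) ∨ (a = q τ ∧ b = p τ)) := by
    rintro hx τ (⟨rfl, rfl⟩ | ⟨rfl, rfl⟩) <;> rcases hx with hx | hx
    · exact h.p_ne τ hx
    · exact h.q_ne τ hx
    · exact h.q_ne τ hx
    · exact h.p_ne τ hx
  by_cases hx : a = x ∨ b = x
  · cases τ <;> simp only [separate, addEdge, del, key, key2 hx, hx] <;> simp
  · cases τ <;> simp only [separate, addEdge, del, key, hx] <;> simp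

theorem separate_pos_iff (h : M.Separable x p q A) (τ : Bool) (a b : V) :
    0 < (M.separate x p q).mult τ a b ↔ a ≠ x ∧ b ≠ x ∧
      (0 < M.mult τ a b ∨ (a = p τ ∧ b = q τ) ∨ (a = q τ ∧ b = p τ)) := by
  classical
  rw [h.separate_mult]
  by_cases hx : a = x ∨ b = x
  · rw [if_pos hx]
    simp only [lt_irrefl, false_iff]
    tauto
  · rw [if_neg hx]
    split_ifs <;> simp_all

theorem separate_removed (h : M.Separable x p q A) (τ : Bool) (b : V) :
    (M.separate x p q).mult τ x b = 0 := by
  classical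
  rw [h.separate_mult]
  simp

theorem splits (h : M.Separable x p q A) : M.Splits x := by
  intro a b ha hb hc
  have ha' : a ∈ A true := by
    rcases (h.mult_pos_iff _ _).1 ha with rfl | rfl
    exacts [h.p_mem _, h.q_mem _]
  have hb' : b ∈ A false := by
    rcases (h.mult_pos_iff _ _).1 hb with rfl | rfl
    exacts [h.p_mem _, h.q_mem _]
  exact h.disj _ _ (hc.mem_of_closed ha' fun a ha b hab _ hb => h.closed _ a ha b hab hb) hb'

open scoped Classical in
/-- On its own side of `x`, a vertex `y` sees the same picture before and after separation. The
whole other side, including `x`, is collapsed to that one of `p σ`, `q σ` which is not `y`. -/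
theorem localIso (h : M.Separable x p q A) {σ : Bool} {y : V} (hy : y ∈ A σ) :
    LocalIso M (M.separate x p q) y
      (fun a => if a ∈ A σ then a else if y = p σ then q σ else p σ) false := by
  have hyx : y ≠ x := fun e => h.not_mem σ (e ▸ hy)
  obtain ⟨r, hr⟩ : ∃ r, r = if y = p σ then q σ else p σ := ⟨_, rfl⟩
  rw [← hr]
  have hrA : r ∈ A σ := by
    rw [hr]; split_ifs
    exacts [h.q_mem σ, h.p_mem σ]
  have hry : r ≠ y := by
    rw [hr]; split_ifs with e
    · rw [e]; exact (h.ne σ).symm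
    · exact fun e' => e e'.symm
  have hr' : r = p σ ∨ r = q σ := by
    rw [hr]; split_ifs <;> simp
  have toR : ∀ a, a = p σ ∨ a = q σ → a ≠ y → (M.separate x p q).Conn y a r := by
    intro a ha hay
    by_cases har : a = r
    · rw [har]; exact .refl
    refine .single ⟨⟨σ, ?_⟩, hay, hry⟩
    rw [h.separate_pos_iff]
    refine ⟨?_, ?_, .inr ?_⟩
    · rcases ha with rfl | rfl
      exacts [h.p_ne σ, h.q_ne σ]
    · rcases hr' with e | e <;> rw [e]
      exacts [h.p_ne σ, h.q_ne σ]
    · rcases ha with rfl | rfl <;> rcases hr' with e | e <;> simp_all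
  have adjx : ∀ a, M.Adj a x → a ∈ A σ → a = p σ ∨ a = q σ := by
    rintro a ⟨τ, ha⟩ haA
    rw [M.symm] at ha
    exact (h.eq_of_adj haA ha).2
  have collapse : ∀ a b, M.Adj a b → a ≠ y → b ≠ y → a ∈ A σ →
      (M.separate x p q).Conn y a (if b ∈ A σ then b else r) := by
    intro a b hab ha hb haA
    split_ifs with hbA
    · obtain ⟨τ, hab⟩ := hab
      refine .single ⟨⟨τ, (h.separate_pos_iff _ _ _).2 ⟨?_, ?_, .inl hab⟩⟩, ha, hb⟩
      · exact fun e => h.not_mem σ (e ▸ haA)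
      · exact fun e => h.not_mem σ (e ▸ hbA)
    · have : b = x := by
        by_contra hbx
        exact hbA (h.closed σ a haA b hab hbx)
      subst this
      exact toR a (adjx a hab haA) ha
  have xp : ∀ τ, M.Adj x (p τ) := fun τ => ⟨τ, (h.mult_pos_iff _ _).2 (.inl rfl)⟩
  have xq : ∀ τ, M.Adj x (q τ) := fun τ => ⟨τ, (h.mult_pos_iff _ _).2 (.inr rfl)⟩
  have step : ∀ a b, (M.separate x p q).Adj a b → a ≠ y → b ≠ y → M.Conn y a b := by
    rintro a b ⟨τ, hab⟩ ha hb
    rw [h.separate_pos_iff] at hab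
    rcases hab.2.2 with hab | ⟨rfl, rfl⟩ | ⟨rfl, rfl⟩
    · exact .single ⟨⟨τ, hab⟩, ha, hb⟩
    · exact .tail (.single ⟨(xp τ).symm, ha, hyx.symm⟩) ⟨xq τ, hyx.symm, hb⟩
    · exact .tail (.single ⟨(xq τ).symm, ha, hyx.symm⟩) ⟨xp τ, hyx.symm, hb⟩
  have toF : ∀ a, M.Adj y a → M.Conn y a (if a ∈ A σ then a else r) := by
    intro a ha
    split_ifs with haA
    · exact .refl
    · have : a = x := by
        by_contra hbx
        exact haA (h.closed σ y hy a ha hbx)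
      subst this
      refine .single ⟨?_, hyx.symm, hry⟩
      rcases hr' with e | e <;> rw [e]
      exacts [xp σ, xq σ]
  refine ⟨?_, ?_, ?_⟩
  · intro τ a ha
    rw [Bool.false_xor, h.separate_pos_iff]
    refine ⟨hyx, ?_⟩
    split_ifs with haA
    · exact ⟨fun e => h.not_mem σ (e ▸ haA), .inl ha⟩
    · have : a = x := by
        by_contra hbx
        exact haA (h.closed σ y hy a ⟨_, ha⟩ hbx)
      subst this
      rw [M.symm] at ha
      obtain ⟨rfl, hya⟩ := h.eq_of_adj hy ha
      refine ⟨fun e => h.not_mem τ (e ▸ hrA), .inr ?_⟩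
      have hne := h.ne τ
      rcases hya with e | e <;> rcases hr' with e' | e' <;> simp_all
  · intro τ b hb
    rw [Bool.false_xor, h.separate_pos_iff] at hb
    obtain ⟨-, hbx, hb | hb⟩ := hb
    · refine ⟨b, ?_, hb⟩
      simp [h.closed σ y hy b ⟨_, hb⟩ hbx]
    · have hyτ : y = p τ ∨ y = q τ := by tauto
      have hστ : σ = τ := by
        rcases hyτ with e | e
        · exact h.not_mem_of_mem hy (e ▸ h.p_mem τ)
        · exact h.not_mem_of_mem hy (e ▸ h.q_mem τ)
      subst hστ
      refine ⟨x, ?_, ?_⟩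
      · rw [if_neg (h.not_mem σ), hr]
        have := h.ne σ
        rcases hb with ⟨e, e'⟩ | ⟨e, e'⟩
        · simp [e, e']
        · simp [e, e', this.symm]
      · rw [M.symm, h.mult_pos_iff]; exact hyτ
  · intro a b ha hb
    constructor
    · intro hc
      refine hc.map (fun a => if a ∈ A σ then a else r) fun c d hcd hc hd => ?_
      by_cases hcA : c ∈ A σ
      · have := collapse c d hcd hc hd hcA
        simpa only [hcA, if_true] using this
      · by_cases hdA : d ∈ A σ
        · have := collapse d c hcd.symm hd hc hdA
          simpa only [hdA, if_true] using this.symm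
        · simp only [hcA, hdA, if_false]; exact .refl
    · intro hc
      exact ((toF a ha).trans (hc.map id step)).trans (toF b hb).symm

/-- The new edge of sign `τ` replaces the passage through `x` along its two edges of sign `τ`. -/
theorem mono_iff (h : M.Separable x p q A) (τ : Bool) {a b : V} (ha : a ≠ x) (hb : b ≠ x) :
    M.Mono τ a b ↔ (M.separate x p q).Mono τ a b := by
  classical
  have xp : 0 < M.mult τ x (p τ) := (h.mult_pos_iff _ _).2 (.inl rfl)
  have xq : 0 < M.mult τ x (q τ) := (h.mult_pos_iff _ _).2 (.inr rfl)
  have px := h.p_ne τ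
  have qx := h.q_ne τ
  have pq : 0 < (M.separate x p q).mult τ (p τ) (q τ) :=
    (h.separate_pos_iff _ _ _).2 ⟨px, qx, .inr (.inl ⟨rfl, rfl⟩)⟩
  constructor
  · intro hc
    have := reflTransGen_map_of_inv (r' := fun a b => 0 < (M.separate x p q).mult τ a b)
      (fun _ => True) (fun c => if c = x then p τ else c)
      (fun c d _ hcd => ⟨trivial, ?_⟩) trivial hc
    · simp only [ha, hb, if_false] at this
      exact this
    by_cases hcx : c = x
    · have hdx : d ≠ x := fun e => Adj.ne ⟨τ, hcd⟩ (hcx.trans e.symm)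
      rw [hcx, h.mult_pos_iff] at hcd
      simp only [hcx, hdx, if_true, if_false]
      rcases hcd with rfl | rfl
      · exact .refl
      · exact .single pq
    · by_cases hdx : d = x
      · rw [hdx, M.symm, h.mult_pos_iff] at hcd
        simp only [hcx, hdx, if_true, if_false]
        rcases hcd with rfl | rfl
        · exact .refl
        · exact .single (by rwa [SignedGraph.symm])
      · simp only [hcx, hdx, if_false]
        exact .single ((h.separate_pos_iff _ _ _).2 ⟨hcx, hdx, .inl hcd⟩)
  · intro hc
    refine reflTransGen_map_of_inv (fun _ => True) id
      (fun c d _ hcd => ⟨trivial, ?_⟩) trivial hc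
    rcases ((h.separate_pos_iff _ _ _).1 hcd).2.2 with hcd | ⟨rfl, rfl⟩ | ⟨rfl, rfl⟩
    · exact .single hcd
    · exact .tail (.single (by rwa [M.symm])) xq
    · exact .tail (.single (by rwa [M.symm])) xp

variable [Fintype V]

theorem deg_removed (h : M.Separable x p q A) (τ : Bool) : (M.separate x p q).deg τ x = 0 :=
  Finset.sum_eq_zero fun b _ => h.separate_removed τ b

theorem deg_self (h : M.Separable x p q A) (τ : Bool) : M.deg τ x = 2 := by
  classical
  unfold deg
  simp only [h.mult]
  rw [Finset.sum_add_distrib]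
  simp

theorem deg_separate (h : M.Separable x p q A) (τ : Bool) {y : V} (hy : y ≠ x) :
    (M.separate x p q).deg τ y = M.deg τ y := by
  classical
  have hpq := h.ne τ
  have e : ∀ b, (M.separate x p q).mult τ y b + (if b = x then M.mult τ y x else 0) =
      M.mult τ y b + ((if b = q τ then (if y = p τ then 1 else 0) else 0) +
        (if b = p τ then (if y = q τ then 1 else 0) else 0)) := by
    intro b
    rw [h.separate_mult]
    by_cases hbx : b = x
    · subst hbx
      simp [(h.p_ne τ).symm, (h.q_ne τ).symm]
    · simp only [hy, hbx, or_false, if_false, add_zero]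
      congr 1
      by_cases h1 : y = p τ <;> by_cases h2 : b = q τ <;> by_cases h3 : y = q τ <;>
        by_cases h4 : b = p τ <;> simp_all
  have e2 := Finset.sum_congr (rfl : (Finset.univ : Finset V) = Finset.univ) fun b _ => e b
  rw [Finset.sum_add_distrib, Finset.sum_add_distrib, Finset.sum_add_distrib] at e2
  simp only [Finset.sum_ite_eq', Finset.mem_univ, if_true] at e2
  rw [M.symm τ y x, h.mult] at e2
  unfold deg
  omega

theorem balanced (h : M.Separable x p q A) (hM : M.Balanced) : (M.separate x p q).Balanced := by
  constructor
  · intro τ y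
    by_cases hy : y = x
    · subst hy; simp [h.deg_removed]
    · rw [h.deg_separate _ hy, h.deg_separate _ hy, hM.deg_eq]
  · intro y
    by_cases hy : y = x
    · subst hy; simp [h.deg_removed]
    · rw [h.deg_separate _ hy]; exact hM.deg_le y

theorem similar (h : M.Separable x p q A) (hM : M.Balanced) :
    Similar M (M.separate x p q) := by
  have hx := h.deg_self true
  have deg_one : ∀ y, M.deg true y = 1 ↔ (M.separate x p q).deg true y = 1 := by
    intro y
    by_cases hy : y = x
    · subst hy; rw [h.deg_removed, hx]; norm_num
    · rw [h.deg_separate _ hy]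
  have split : ∀ y, y ≠ x → (M.Splits y ↔ (M.separate x p q).Splits y) := by
    intro y hy
    obtain ⟨σ, hσ⟩ := h.cover y hy
    exact (h.localIso hσ).splits_iff
  refine ⟨h.balanced hM, ⟨?_, ?_⟩, ?_, deg_one, ?_⟩
  · intro hs y hy
    by_cases hyx : y = x
    · subst hyx; rw [h.deg_removed] at hy; omega
    rw [← split y hyx]
    exact hs y (by rwa [h.deg_separate _ hyx] at hy)
  · intro hs y hy
    by_cases hyx : y = x
    · subst hyx; exact h.splits
    rw [split y hyx]
    exact hs y (by rwa [h.deg_separate _ hyx])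
  · intro hs y hy
    by_cases hyx : y = x
    · subst hyx; rw [h.deg_removed] at hy; omega
    obtain ⟨σ, hσ⟩ := h.cover y hyx
    exact (h.localIso hσ).cuts (hs y (by rwa [h.deg_separate _ hyx] at hy))
  · intro a b
    unfold Linked
    rw [← deg_one a, ← deg_one b]
    refine and_congr_right fun _ => and_congr_right fun ha => and_congr_right fun hb => ?_
    have hax : a ≠ x := by rintro rfl; omega
    have hbx : b ≠ x := by rintro rfl; omega
    simp only [h.mono_iff _ hax hbx]

end Separable
end SignedGraph

/-! ### Contractions after a separation -/

namespace SignedGraph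

variable {V : Type*} {M N : SignedGraph V}

theorem Contractible.addEdge {σ τ : Bool} {i j k l : V} {A : Set V} (h : M.Contractible σ i j A)
    (hk : k ∉ A) (hl : l ∉ A) : (M.addEdge τ k l).Contractible σ i j A := by
  have e : ∀ a b, a ∈ A → s(a, b) ≠ s(k, l) := by
    intro a b ha e
    rcases Sym2.eq_iff.1 e with ⟨rfl, rfl⟩ | ⟨rfl, rfl⟩ <;> contradiction
  refine ⟨?_, ?_, h.mem, h.not_mem, fun a ha b hb hab => h.cross a ha b hb ?_⟩
  · simp [SignedGraph.addEdge, e _ _ h.mem, h.mult_eq]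
  · simp [SignedGraph.addEdge, e _ _ h.mem, h.mult_not]
  · obtain ⟨ρ, hab⟩ := hab
    exact ⟨ρ, by simpa [SignedGraph.addEdge, e _ _ ha] using hab⟩

/-- The graph `N`, with vertex set `T`, is either `M` itself, with vertex set `S`, or the result of
contracting onto `k` two edges of sign `σ` between `k` and `l`, the side of `k` being inside `R`. -/
def Fused (M : SignedGraph V) (S : Set V) (σ : Bool) (k l : V) (R : Set V) (N : SignedGraph V)
    (T : Set V) : Prop :=
  (N = M ∧ T = S) ∨
    ∃ A ⊆ R, M.Contractible σ k l A ∧ N = M.contract k l A ∧ T = S \ {l}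

theorem Fused.addEdge {S T R : Set V} {σ τ : Bool} {k l p q : V} (h : Fused M S σ k l R N T)
    (hl : l ∈ R) (hp : p ∉ R) (hq : q ∉ R) :
    Fused (M.addEdge τ p q) S σ k l R (N.addEdge τ p q) T := by
  obtain ⟨rfl, rfl⟩ | ⟨A, hA, hc, rfl, rfl⟩ := h
  · exact .inl ⟨rfl, rfl⟩
  · have hpA : p ∉ A := fun h => hp (hA h)
    have hqA : q ∉ A := fun h => hq (hA h)
    refine .inr ⟨A, hA, hc.addEdge hpA hqA, ?_, rfl⟩
    exact addEdge_contract hc.mem hpA hqA (fun e => hp (e ▸ hl)) (fun e => hq (e ▸ hl)) τ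

theorem Fused.similar [Fintype V] {S T R : Set V} {σ : Bool} {k l : V}
    (h : Fused M S σ k l R N T) (hM : M.Balanced) : Similar M N := by
  obtain ⟨rfl, rfl⟩ | ⟨A, hA, hc, rfl, rfl⟩ := h
  · exact .refl hM
  · exact hc.similar hM

theorem Fused.mem_iff [Fintype V] {S T R : Set V} {σ : Bool} {k l : V}
    (h : Fused M S σ k l R N T) (hM : M.Balanced) (hS : ∀ y, y ∈ S ↔ 0 < M.deg true y) :
    ∀ y, y ∈ T ↔ 0 < N.deg true y := by
  obtain ⟨rfl, rfl⟩ | ⟨A, hA, hc, rfl, rfl⟩ := h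
  · exact hS
  · intro y
    by_cases hy : y = l
    · subst hy
      simp [Contractible.deg_removed]
    · rw [hc.deg_contract hM _ hy, ← hS]
      simp [hy]

end SignedGraph

namespace WGraph

variable {V : Type*} {W W' D : WGraph V}

/-! ### Weighted graphs as signed multigraphs -/

/-- The integer `1` or `-1` that belongs to a sign. -/
def signOf (τ : Bool) : ℤ := bif τ then 1 else -1

/-- The number of edges of sign `τ` that stand for an edge of weight `c`: it is `|c|` for the sign
of `c` and `0` for the other sign if `c ≠ 0`, and an edge of weight `0` stands for one edge of each
sign. -/
def count (c : ℤ) (τ : Bool) : ℕ := if c = 0 then 1 else (signOf τ * c).toNat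

theorem count_neg (c : ℤ) (τ : Bool) : count (-c) τ = count c (!τ) := by
  cases τ <;> simp [count, signOf]

theorem count_pos_of_pos {c : ℤ} {τ : Bool} (h : 0 < signOf τ * c) : count c τ = (signOf τ * c) ∧
    count c (!τ) = 0 := by
  cases τ <;> simp only [count, signOf, cond_true, cond_false, Bool.not_true, Bool.not_false]
    at h ⊢ <;> constructor <;> split_ifs <;> omega

open scoped Classical in
/-- The signed multigraph of a weighted graph; see `WGraph.count` for edges of weight `0`. -/
def toSigned (W : WGraph V) : SignedGraph V where
  mult τ a b := if W.graph.Adj a b then count (W.weight a b) τ else 0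
  symm τ a b := by rw [W.weight_symm]; simp only [W.graph.adj_comm a b]
  irrefl τ a := by simp

theorem toSigned_mult_of_adj {a b : V} (h : W.graph.Adj a b) (τ : Bool) :
    W.toSigned.mult τ a b = count (W.weight a b) τ := by
  simp [toSigned, h]

theorem toSigned_mult_of_not_adj {a b : V} (h : ¬ W.graph.Adj a b) (τ : Bool) :
    W.toSigned.mult τ a b = 0 := by
  simp [toSigned, h]

theorem exists_count_pos (c : ℤ) : ∃ τ, 0 < count c τ := by
  rcases lt_trichotomy c 0 with h | h | h
  · refine ⟨false, ?_⟩
    simp only [count, signOf, cond_false]; split_ifs <;> omega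
  · exact ⟨true, by simp [count, h]⟩
  · refine ⟨true, ?_⟩
    simp only [count, signOf, cond_true]; split_ifs <;> omega

@[simp]
theorem toSigned_adj {a b : V} : W.toSigned.Adj a b ↔ W.graph.Adj a b := by
  constructor
  · rintro ⟨τ, h⟩
    by_contra hn
    rw [toSigned_mult_of_not_adj hn] at h
    exact lt_irrefl _ h
  · intro h
    obtain ⟨τ, hτ⟩ := exists_count_pos (W.weight a b)
    exact ⟨τ, by rwa [toSigned_mult_of_adj h]⟩

theorem toSigned_del (W : WGraph V) (x : V) : (W.del x).toSigned = W.toSigned.del x := by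
  ext τ a b
  by_cases hx : a = x ∨ b = x
  · rw [toSigned_mult_of_not_adj (fun h => by rcases hx with e | e; exacts [h.2.1 e, h.2.2 e])]
    simp [SignedGraph.del, hx]
  · have : (W.del x).graph.Adj a b ↔ W.graph.Adj a b :=
      ⟨fun h => h.1, fun h => ⟨h, fun e => hx (.inl e), fun e => hx (.inr e)⟩⟩
    have e : (W.toSigned.del x).mult τ a b = W.toSigned.mult τ a b := by
      simp [SignedGraph.del, hx]
    rw [e]
    by_cases hab : W.graph.Adj a b
    · rw [toSigned_mult_of_adj hab, toSigned_mult_of_adj (this.2 hab)]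
      rfl
    · rw [toSigned_mult_of_not_adj hab, toSigned_mult_of_not_adj fun h => hab (this.1 h)]

theorem reachable_del_iff {x a b : V} :
    (W.del x).graph.Reachable a b ↔ W.toSigned.Conn x a b := by
  rw [SimpleGraph.reachable_iff_reflTransGen]
  simp only [SignedGraph.Conn, toSigned_adj]
  rfl

/-- Every edge of weight `0` is a connected component. -/
def Isolated (W : WGraph V) : Prop :=
  ∀ a b, W.graph.Adj a b → W.weight a b = 0 → ∀ c, W.graph.Adj a c → c = b

/-! ### Contraction of weighted graphs -/

theorem mem_side_self (W : WGraph V) (i j : V) : i ∈ W.side i j := Reachable.refl i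

theorem not_mem_side {i j : V} (h : W.graph.IsBridge s(i, j)) : j ∉ W.side i j :=
  SimpleGraph.isBridge_iff.1 h

theorem mem_side_of_adj {i j a b : V} (ha : a ∈ W.side i j) (hab : W.graph.Adj a b)
    (hne : s(a, b) ≠ s(i, j)) : b ∈ W.side i j :=
  Reachable.trans (v := a) ha (Adj.reachable (by
    rw [SimpleGraph.deleteEdges_adj]
    exact ⟨hab, hne⟩))

theorem cross_side {i j a b : V} (hb : W.graph.IsBridge s(i, j)) (ha : a ∈ W.side i j)
    (hb' : b ∉ W.side i j) (hab : W.graph.Adj a b) : a = i ∧ b = j := by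
  by_contra hne
  refine hb' (mem_side_of_adj ha hab fun e => ?_)
  rcases Sym2.eq_iff.1 e with h | ⟨rfl, rfl⟩
  · exact hne h
  · exact not_mem_side hb ha

theorem CanContract.contractible {i j : V} (h : W.CanContract i j) {σ : Bool}
    (hσ : W.weight i j = 2 * signOf σ) :
    W.toSigned.Contractible σ i j (W.side i j) := by
  have := count_pos_of_pos (c := W.weight i j) (τ := σ) (by rw [hσ]; cases σ <;> simp [signOf])
  refine ⟨?_, ?_, mem_side_self W i j, not_mem_side h.2.2,
    fun a ha b hb hab => cross_side h.2.2 ha hb (toSigned_adj.1 hab)⟩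
  · rw [toSigned_mult_of_adj h.1]
    have := this.1
    rw [hσ] at this ⊢
    have e : signOf σ * (2 * signOf σ) = 2 := by cases σ <;> simp [signOf]
    omega
  · rw [toSigned_mult_of_adj h.1]
    exact this.2

theorem CanContract.exists_sign {i j : V} (h : W.CanContract i j) :
    ∃ σ, W.weight i j = 2 * signOf σ := by
  rcases (abs_eq (by norm_num : (0 : ℤ) ≤ 2)).1 h.2.1 with e | e
  · exact ⟨true, by simp [signOf, e]⟩
  · exact ⟨false, by simp [signOf, e]⟩

theorem contract_adj_iff {i j : V} (hij : W.graph.Adj i j) {a b : V} :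
    (W.contract i j).graph.Adj a b ↔ a ≠ b ∧ a ≠ j ∧ b ≠ j ∧
      (W.graph.Adj a b ∨ (a = i ∧ W.graph.Adj j b) ∨ (b = i ∧ W.graph.Adj j a)) := by
  constructor
  · rintro ⟨h1, h2, h3, h4⟩
    exact ⟨h1, h2.2, h3.2, h4⟩
  · rintro ⟨h1, h2, h3, h4⟩
    refine ⟨h1, ⟨?_, h2⟩, ⟨?_, h3⟩, h4⟩
    · rcases h4 with h | ⟨rfl, h⟩ | ⟨rfl, h⟩
      exacts [W.mem_verts h, W.mem_verts hij, W.mem_verts h.symm]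
    · rcases h4 with h | ⟨rfl, h⟩ | ⟨rfl, h⟩
      exacts [W.mem_verts h.symm, W.mem_verts h.symm, W.mem_verts hij]

/-- Contraction of weighted graphs is contraction of signed multigraphs. The two definitions agree
because no vertex is adjacent to both ends of a bridge. -/
theorem CanContract.toSigned_contract {i j : V} (h : W.CanContract i j) :
    (W.contract i j).toSigned = W.toSigned.contract i j (W.side i j) := by
  obtain ⟨σ, hσ⟩ := h.exists_sign
  have hc := h.contractible hσ
  have mixed : ∀ τ a b, a ∈ W.side i j → b ∉ W.side i j → a ≠ j → b ≠ j →
      (W.contract i j).toSigned.mult τ a b =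
        (W.toSigned.contract i j (W.side i j)).mult τ a b := by
    intro τ a b ha hb haj hbj
    have hab : ¬ W.graph.Adj a b := fun hab => hbj (cross_side h.2.2 ha hb hab).2
    have hbi : b ≠ i := fun e => hb (e ▸ mem_side_self W i j)
    by_cases hai : a = i
    · subst hai
      rw [hc.contract_left τ hb hbj]
      by_cases hjb : W.graph.Adj j b
      · rw [toSigned_mult_of_adj ((contract_adj_iff h.1).2
          ⟨hbi.symm, haj, hbj, .inr (.inl ⟨rfl, hjb⟩)⟩),
          toSigned_mult_of_adj hjb]
        simp [WGraph.contract, hab]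
      · rw [toSigned_mult_of_not_adj hjb, toSigned_mult_of_not_adj]
        rw [contract_adj_iff h.1]
        tauto
    · rw [hc.contract_mem_not_mem τ ha hai hb, toSigned_mult_of_not_adj]
      rw [contract_adj_iff h.1]
      tauto
  ext τ a b
  by_cases hj : a = j ∨ b = j
  · rw [toSigned_mult_of_not_adj]
    · simp [SignedGraph.contract, hj]
    · rw [contract_adj_iff h.1]
      tauto
  have haj : a ≠ j := fun e => hj (.inl e)
  have hbj : b ≠ j := fun e => hj (.inr e)
  by_cases ha : a ∈ W.side i j
  · by_cases hb : b ∈ W.side i j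
    · rw [hc.contract_mem_mem τ ha hb]
      by_cases hab : W.graph.Adj a b
      · rw [toSigned_mult_of_adj hab, toSigned_mult_of_adj
          ((contract_adj_iff h.1).2 ⟨hab.ne, haj, hbj, .inl hab⟩), ← count_neg]
        simp [WGraph.contract, hab, ha, hb]
      · rw [toSigned_mult_of_not_adj hab, toSigned_mult_of_not_adj]
        rw [contract_adj_iff h.1]
        rintro ⟨hne, -, -, h1 | ⟨rfl, h1⟩ | ⟨rfl, h1⟩⟩
        · exact hab h1
        · exact hne (cross_side h.2.2 hb (not_mem_side h.2.2) h1.symm).1.symm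
        · exact hne (cross_side h.2.2 ha (not_mem_side h.2.2) h1.symm).1
    · exact mixed τ a b ha hb haj hbj
  · by_cases hb : b ∈ W.side i j
    · rw [SignedGraph.symm, SignedGraph.symm _ τ a b]
      exact mixed τ b a hb ha hbj haj
    · classical
      have hai : a ≠ i := fun e => ha (e ▸ mem_side_self W i j)
      have hbi : b ≠ i := fun e => hb (e ▸ mem_side_self W i j)
      rw [hc.contract_not_mem τ ha haj, Equiv.swap_apply_of_ne_of_ne hbi hbj]
      by_cases hab : W.graph.Adj a b
      · rw [toSigned_mult_of_adj hab, toSigned_mult_of_adj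
          ((contract_adj_iff h.1).2 ⟨hab.ne, haj, hbj, .inl hab⟩)]
        simp [WGraph.contract, hab, ha]
      · rw [toSigned_mult_of_not_adj hab, toSigned_mult_of_not_adj]
        rw [contract_adj_iff h.1]
        tauto

theorem CanContract.isolated {i j : V} (h : W.CanContract i j) (hW : W.Isolated) :
    (W.contract i j).Isolated := by
  have w0 : W.weight i j ≠ 0 := by
    intro e
    have := h.2.1
    simp [e] at this
  have hi : ∀ b, W.graph.Adj i b → W.weight i b ≠ 0 := fun b hb e =>
    w0 (by rw [hW i b hb e j h.1]; exact e)
  have hj : ∀ b, W.graph.Adj j b → W.weight j b ≠ 0 := fun b hb e =>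
    w0 (by rw [W.weight_symm, hW j b hb e i h.1.symm]; exact e)
  intro a b hab h0 c hac
  rw [contract_adj_iff h.1] at hab hac
  by_cases hab' : W.graph.Adj a b
  · have h0' : W.weight a b = 0 := by
      simp only [WGraph.contract, hab', if_true] at h0
      split_ifs at h0 <;> omega
    have hai : a ≠ i := by rintro rfl; exact hi b hab' h0'
    rcases hac.2.2.2 with h1 | ⟨h1, -⟩ | ⟨h1, h2⟩
    · exact hW a b hab' h0' c h1
    · exact absurd h1 hai
    · exact absurd (hW a b hab' h0' j h2.symm).symm hab.2.2.1
  · exfalso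
    simp only [WGraph.contract, hab', if_false] at h0
    rcases hab.2.2.2 with h1 | ⟨rfl, h1⟩ | ⟨rfl, h1⟩
    · exact hab' h1
    · simp only [if_true] at h0
      exact hj b h1 h0
    · rw [if_neg hab.1, if_pos rfl] at h0
      exact hj a h1 h0

/-! ### Changing the weight of an edge -/

theorem setEdge_adj {k l : V} (hkl : k ≠ l) (c : ℤ) {a b : V} :
    (D.setEdge k l c).graph.Adj a b ↔ D.graph.Adj a b ∨ s(a, b) = s(k, l) := by
  simp only [setEdge, SimpleGraph.sup_adj, SimpleGraph.fromEdgeSet_adj, Set.mem_singleton_iff]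
  refine or_congr_right ⟨fun h => h.1, fun h => ⟨h, ?_⟩⟩
  rintro rfl
  rcases Sym2.eq_iff.1 h with ⟨rfl, rfl⟩ | ⟨rfl, rfl⟩ <;> exact hkl rfl

theorem setEdge_weight_of_ne {k l : V} {c : ℤ} {a b : V} (h : s(a, b) ≠ s(k, l)) :
    (D.setEdge k l c).weight a b = D.weight a b := by
  simp [setEdge, h]

theorem setEdge_weight_of_eq {k l : V} {c : ℤ} {a b : V} (h : s(a, b) = s(k, l)) :
    (D.setEdge k l c).weight a b = c := by
  simp [setEdge, h]

theorem setEdge_verts {k l : V} (hk : k ∈ D.verts) (hl : l ∈ D.verts) (c : ℤ) :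
    (D.setEdge k l c).verts = D.verts := by
  ext a
  simp only [setEdge, Set.mem_union, Set.mem_ofPred_eq, or_iff_left_iff_imp]
  rintro ⟨-, rfl | rfl⟩ <;> assumption

/-- Replacing the weight of `{k, l}` by `c` adds an edge of sign `σ` if `c` has been chosen
accordingly. -/
theorem toSigned_setEdge {k l : V} (hkl : k ≠ l) {c : ℤ} {σ : Bool}
    (hc : ∀ τ, count c τ = D.toSigned.mult τ k l + if τ = σ then 1 else 0) :
    (D.setEdge k l c).toSigned = D.toSigned.addEdge σ k l := by
  ext τ a b
  by_cases e : s(a, b) = s(k, l)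
  · rw [toSigned_mult_of_adj ((setEdge_adj hkl c).2 (.inr e)), setEdge_weight_of_eq e, hc]
    rcases Sym2.eq_iff.1 e with ⟨rfl, rfl⟩ | ⟨rfl, rfl⟩
    · simp [SignedGraph.addEdge, hkl]
    · simp [SignedGraph.addEdge, hkl.symm, D.toSigned.symm τ a b]
  · by_cases hab : D.graph.Adj a b
    · rw [toSigned_mult_of_adj ((setEdge_adj hkl c).2 (.inl hab)), setEdge_weight_of_ne e]
      simp [SignedGraph.addEdge, e, toSigned_mult_of_adj hab]
    · rw [toSigned_mult_of_not_adj (by rw [setEdge_adj hkl]; tauto)]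
      simp [SignedGraph.addEdge, e, toSigned_mult_of_not_adj hab]

theorem isolated_setEdge {k l : V} (hkl : k ≠ l) {c : ℤ} (hD : D.Isolated)
    (hk : ∀ a, D.graph.Adj k a → a ≠ l → D.weight k a ≠ 0)
    (hl : ∀ a, D.graph.Adj l a → a ≠ k → D.weight l a ≠ 0)
    (hc : c ≠ 0 ∨ ((∀ a, D.graph.Adj k a → a = l) ∧ ∀ a, D.graph.Adj l a → a = k)) :
    (D.setEdge k l c).Isolated := by
  intro a b hab h0 d had
  rw [setEdge_adj hkl] at hab had
  by_cases e : s(a, b) = s(k, l)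
  · rw [setEdge_weight_of_eq e] at h0
    obtain ⟨h1, h2⟩ := hc.resolve_left (fun h => h h0)
    rcases Sym2.eq_iff.1 e with ⟨rfl, rfl⟩ | ⟨rfl, rfl⟩
    · rcases had with h | h
      · exact h1 d h
      · rcases Sym2.eq_iff.1 h with ⟨h, h'⟩ | ⟨h, h'⟩
        · exact h'
        · exact absurd h hkl
    · rcases had with h | h
      · exact h2 d h
      · rcases Sym2.eq_iff.1 h with ⟨h, h'⟩ | ⟨h, h'⟩
        · exact absurd h.symm hkl
        · exact h'
  · rw [setEdge_weight_of_ne e] at h0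
    replace hab := hab.resolve_right e
    have hak : a ≠ k := by
      rintro rfl
      exact hk b hab (fun h => e (by rw [h])) h0
    have hal : a ≠ l := by
      rintro rfl
      exact hl b hab (fun h => e (by rw [h, Sym2.eq_swap])) h0
    refine hD a b hab h0 d (had.resolve_right fun h => ?_)
    rcases Sym2.eq_iff.1 h with ⟨h, h'⟩ | ⟨h, h'⟩
    · exact hak h
    · exact hal h

/-! ### The two sides of a separated vertex -/

/-- All three cases of a separation add an edge of sign `σ` to the signed multigraph; in case `b` a
contraction follows. -/
theorem SideStep.cases {σ : Bool} {k l : V} (h : SideStep (signOf σ) k l D W) (hkl : k ≠ l)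
    (hD : D.Isolated) (hk : ∀ a, D.graph.Adj k a → D.weight k a ≠ 0)
    (hl : ∀ a, D.graph.Adj l a → D.weight l a ≠ 0) :
    ∃ c, (D.setEdge k l c).Isolated ∧
      (D.setEdge k l c).toSigned = D.toSigned.addEdge σ k l ∧
      (W = D.setEdge k l c ∨ ((D.setEdge k l c).CanContract k l ∧ c = 2 * signOf σ ∧
        W = (D.setEdge k l c).contract k l)) := by
  have s0 : signOf σ ≠ 0 := by cases σ <;> simp [signOf]
  have hk' := fun a ha (_ : a ≠ l) => hk a ha
  have hl' := fun a ha (_ : a ≠ k) => hl a ha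
  cases h with
  | a h =>
    refine ⟨_, isolated_setEdge hkl hD hk' hl' (.inl s0), toSigned_setEdge hkl fun τ => ?_,
      .inl rfl⟩
    rw [toSigned_mult_of_not_adj h]
    cases σ <;> cases τ <;> simp [count, signOf]
  | b h hw hc =>
    refine ⟨_, isolated_setEdge hkl hD hk' hl' (.inl (by simpa using s0)),
      toSigned_setEdge hkl fun τ => ?_, .inr ⟨hc, rfl, rfl⟩⟩
    rw [toSigned_mult_of_adj h, hw]
    cases σ <;> cases τ <;> simp [count, signOf]
  | c h hw h1 h2 =>
    refine ⟨_, isolated_setEdge hkl hD hk' hl' (.inr ⟨h1, h2⟩), toSigned_setEdge hkl fun τ => ?_,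
      .inl rfl⟩
    rw [toSigned_mult_of_adj h, hw]
    cases σ <;> cases τ <;> simp [count, signOf]

theorem SideStep.isolated {σ : Bool} {k l : V} (h : SideStep (signOf σ) k l D W) (hkl : k ≠ l)
    (hD : D.Isolated) (hk : ∀ a, D.graph.Adj k a → D.weight k a ≠ 0)
    (hl : ∀ a, D.graph.Adj l a → D.weight l a ≠ 0) : W.Isolated := by
  obtain ⟨c, h1, -, rfl | ⟨h2, -, rfl⟩⟩ := h.cases hkl hD hk hl
  · exact h1
  · exact h2.isolated h1

theorem side_setEdge_subset {k l : V} {c : ℤ} {R : Set V} (hkR : k ∈ R)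
    (hR : ∀ a ∈ R, ∀ b, D.graph.Adj a b → b ∈ R) : (D.setEdge k l c).side k l ⊆ R := by
  intro a ha
  have : D.graph.Reachable k a := by
    refine Reachable.mono (fun a b hab => ?_) ha
    rw [SimpleGraph.deleteEdges_adj] at hab
    rcases hab.1 with h | h
    · exact h
    · rw [SimpleGraph.fromEdgeSet_adj] at h
      exact absurd h.1 hab.2
  rw [SimpleGraph.reachable_iff_reflTransGen] at this
  clear ha
  induction this with
  | refl => exact hkR
  | tail _ h ih => exact hR _ ih _ h

theorem SideStep.fused {σ : Bool} {k l : V} (h : SideStep (signOf σ) k l D W) (hkl : k ≠ l)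
    (hD : D.Isolated) (hk : ∀ a, D.graph.Adj k a → D.weight k a ≠ 0)
    (hl : ∀ a, D.graph.Adj l a → D.weight l a ≠ 0) (hkD : k ∈ D.verts) (hlD : l ∈ D.verts)
    {R : Set V} (hkR : k ∈ R) (hR : ∀ a ∈ R, ∀ b, D.graph.Adj a b → b ∈ R) :
    SignedGraph.Fused (D.toSigned.addEdge σ k l) D.verts σ k l R W.toSigned W.verts := by
  obtain ⟨c, -, h1, rfl | ⟨h2, rfl, rfl⟩⟩ := h.cases hkl hD hk hl
  · exact .inl ⟨h1, setEdge_verts hkD hlD c⟩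
  · refine .inr ⟨_, side_setEdge_subset hkR hR, ?_, by rw [← h1, h2.toSigned_contract], ?_⟩
    · rw [← h1]
      exact h2.contractible (setEdge_weight_of_eq rfl)
    · rw [← setEdge_verts hkD hlD (2 * signOf σ)]
      rfl

/-- The operation on one side of a separated vertex does not affect the other side. -/
theorem SideStep.agree {σ : ℤ} {k l : V} (h : SideStep σ k l D W) (hkl : k ≠ l)
    {R : Set V} (hkR : k ∈ R) (hlR : l ∈ R) (hR : ∀ a ∈ R, ∀ b, D.graph.Adj a b → b ∈ R)
    {y : V} (hy : y ∉ R) (a : V) :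
    (W.graph.Adj y a ↔ D.graph.Adj y a) ∧ (D.graph.Adj y a → W.weight y a = D.weight y a) := by
  have hyk : y ≠ k := fun e => hy (e ▸ hkR)
  have hyl : y ≠ l := fun e => hy (e ▸ hlR)
  have hne : s(y, a) ≠ s(k, l) := by
    intro e
    rcases Sym2.eq_iff.1 e with ⟨h, -⟩ | ⟨h, -⟩
    exacts [hyk h, hyl h]
  have set : ∀ c, ((D.setEdge k l c).graph.Adj y a ↔ D.graph.Adj y a) ∧
      ((D.setEdge k l c).weight y a = D.weight y a) := fun c =>
    ⟨by rw [setEdge_adj hkl]; tauto, setEdge_weight_of_ne hne⟩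
  have hyside : ∀ c, y ∉ (D.setEdge k l c).side k l := fun c h =>
    hy (side_setEdge_subset hkR hR h)
  cases h with
  | a h => exact ⟨(set _).1, fun _ => (set _).2⟩
  | c h hw h1 h2 => exact ⟨(set _).1, fun _ => (set _).2⟩
  | b h hw hc =>
    constructor
    · rw [contract_adj_iff hc.1, (set _).1]
      constructor
      · rintro ⟨-, -, -, h1 | ⟨h1, -⟩ | ⟨-, h1⟩⟩
        · exact h1
        · exact absurd h1 hyk
        · rw [setEdge_adj hkl] at h1
          rcases h1 with h1 | h1
          · exact absurd (hR l hlR y h1) hy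
          · rcases Sym2.eq_iff.1 h1 with ⟨-, h1⟩ | ⟨-, h1⟩
            exacts [absurd h1 hyl, absurd h1 hyk]
      · intro h1
        exact ⟨h1.ne, hyl, fun e => hy (hR l hlR y (e ▸ h1.symm)), .inl h1⟩
    · intro h1
      rw [← (set (2 * σ)).2]
      simp [WGraph.contract, (set _).1, h1, hyside]

theorem SideStep.verts_subset {σ : ℤ} {k l : V} (h : SideStep σ k l D W) :
    W.verts ⊆ D.verts ∪ {k, l} := by
  have set : ∀ c, (D.setEdge k l c).verts ⊆ D.verts ∪ {k, l} := by
    intro c a ha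
    exact ha.imp id (fun h => h.2)
  cases h with
  | a h => exact set _
  | c h hw h1 h2 => exact set _
  | b h hw hc => exact fun a ha => set _ ha.1

/-! ### Operations as operations on signed multigraphs -/

/-- The invariant of the weighted graphs that come up in a reduction. There are no isolated
vertices, and no edge of weight `0` has a neighbouring edge. -/
structure Tame [Fintype V] (W : WGraph V) : Prop where
  balanced : W.toSigned.Balanced
  mem_verts_iff : ∀ y, y ∈ W.verts ↔ 0 < W.toSigned.deg true y
  isolated : W.Isolated

variable [Fintype V]

theorem Separation.exists_separable (hT : W.Tame) {x : V} {k₁ k₂ l₁ l₂ : V} (hk : k₁ ≠ k₂)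
    (hl : l₁ ≠ l₂)
    (hk₁ : W.graph.Adj x k₁ ∧ W.weight x k₁ = 1) (hk₂ : W.graph.Adj x k₂ ∧ W.weight x k₂ = 1)
    (hl₁ : W.graph.Adj x l₁ ∧ W.weight x l₁ = -1) (hl₂ : W.graph.Adj x l₂ ∧ W.weight x l₂ = -1)
    (hkl : ∀ k ∈ ({k₁, k₂} : Set V), ∀ l ∈ ({l₁, l₂} : Set V),
        ¬ (W.del x).graph.Reachable k l) :
    ∃ A, W.toSigned.Separable x (fun τ => bif τ then k₁ else l₁) (fun τ => bif τ then k₂ else l₂)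
      A := by
  classical
  have hne : ∀ τ : Bool, (bif τ then k₁ else l₁) ≠ (bif τ then k₂ else l₂) := by
    intro τ; cases τ
    exacts [hl, hk]
  have hp : ∀ τ : Bool, W.toSigned.mult τ x (bif τ then k₁ else l₁) = 1 := by
    intro τ; cases τ
    · simp [toSigned_mult_of_adj hl₁.1, hl₁.2, count, signOf]
    · simp [toSigned_mult_of_adj hk₁.1, hk₁.2, count, signOf]
  have hq : ∀ τ : Bool, W.toSigned.mult τ x (bif τ then k₂ else l₂) = 1 := by
    intro τ; cases τ
    · simp [toSigned_mult_of_adj hl₂.1, hl₂.2, count, signOf]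
    · simp [toSigned_mult_of_adj hk₂.1, hk₂.2, count, signOf]
  -- the positive side; all other vertices are put on the negative side
  let R : Set V := {a | (W.del x).graph.Reachable k₁ a ∨ (W.del x).graph.Reachable k₂ a}
  have hR : ∀ a b, W.graph.Adj a b → a ≠ x → b ≠ x → a ∈ R → b ∈ R := by
    intro a b hab ha hb h
    have : (W.del x).graph.Adj a b := ⟨hab, ha, hb⟩
    exact h.imp (fun h => h.trans this.reachable) (fun h => h.trans this.reachable)
  have hxR : x ∉ R := by
    have : ∀ k, k ≠ x → ¬ (W.del x).graph.Reachable k x := by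
      intro k hkx h
      obtain h | ⟨c, -, h⟩ := ((SimpleGraph.reachable_iff_reflTransGen _ _).1 h).cases_tail
      · exact hkx h.symm
      · exact h.2.2 rfl
    rintro (h | h)
    · exact this _ hk₁.1.ne.symm h
    · exact this _ hk₂.1.ne.symm h
  refine ⟨fun τ => bif τ then R else {a | a ∉ R ∧ a ≠ x}, hne, ?_, ?_, ?_, ?_, ?_, ?_, ?_⟩
  · intro τ b
    by_cases h1 : b = (bif τ then k₁ else l₁)
    · rw [if_pos h1, if_neg (h1 ▸ hne τ), h1, hp]
    by_cases h2 : b = (bif τ then k₂ else l₂)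
    · rw [if_neg h1, if_pos h2, h2, hq]
    rw [if_neg h1, if_neg h2]
    have := W.toSigned.mult_add_mult_add_mult_le_deg τ x (hne τ) (Ne.symm h1) (Ne.symm h2)
    have := hT.balanced.deg_le' τ x
    rw [hp, hq] at *
    omega
  · intro τ; cases τ
    · refine ⟨?_, hl₁.1.ne.symm⟩
      rintro (h | h)
      · exact hkl k₁ (by simp) l₁ (by simp) h
      · exact hkl k₂ (by simp) l₁ (by simp) h
    · exact .inl (Reachable.refl _)
  · intro τ; cases τ
    · refine ⟨?_, hl₂.1.ne.symm⟩
      rintro (h | h)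
      · exact hkl k₁ (by simp) l₂ (by simp) h
      · exact hkl k₂ (by simp) l₂ (by simp) h
    · exact .inr (Reachable.refl _)
  · intro τ; cases τ
    · exact fun h => h.2 rfl
    · exact hxR
  · intro τ a ha; cases τ
    · exact ha.1
    · exact fun h => h.1 ha
  · intro a ha
    by_cases h : a ∈ R
    · exact ⟨true, h⟩
    · exact ⟨false, h, ha⟩
  · intro τ a ha b hab hb
    rw [toSigned_adj] at hab
    cases τ
    · exact ⟨fun h => ha.1 (hR b a hab.symm hb ha.2 h), hb⟩
    · exact hR a b hab (fun e => hxR (e ▸ ha)) hb ha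

/-- An operation preserves tameness and leads to a similar signed multigraph: a contraction is one
contraction of signed multigraphs, and a separation is one separation followed by up to two
contractions. -/
theorem Step.tame_similar (hT : W.Tame) (h : Step W W') :
    W'.Tame ∧ SignedGraph.Similar W.toSigned W'.toSigned := by
  cases h with
  | contraction i j h =>
    obtain ⟨σ, hσ⟩ := h.exists_sign
    have hc := h.contractible hσ
    have hF : SignedGraph.Fused W.toSigned W.verts σ i j Set.univ (W.contract i j).toSigned
        (W.contract i j).verts :=
      .inr ⟨_, Set.subset_univ _, hc, h.toSigned_contract, rfl⟩
    have hs := hF.similar hT.balanced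
    exact ⟨⟨hs.balanced, hF.mem_iff hT.balanced hT.mem_verts_iff, h.isolated hT.isolated⟩, hs⟩
  | separation x W' h =>
    obtain ⟨-, -, -, k₁, k₂, l₁, l₂, hk, hl, hk₁, hk₂, hl₁, hl₂, hkl, W₁, s₁, s₂⟩ := h
    obtain ⟨A, hA⟩ := Separation.exists_separable hT hk hl hk₁ hk₂ hl₁ hl₂ hkl
    have noZero : ∀ k, W.graph.Adj x k → ∀ a, (W.del x).graph.Adj k a →
        (W.del x).weight k a ≠ 0 := fun k hk a ha h0 =>
      ha.2.2 (hT.isolated k a ha.1 h0 x hk.symm).symm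
    have isoD : (W.del x).Isolated := fun a b hab h0 c hac =>
      hT.isolated a b hab.1 h0 c hac.1
    have mem : ∀ k, W.graph.Adj x k → k ∈ (W.del x).verts := fun k hk =>
      ⟨W.mem_verts hk.symm, hk.ne.symm⟩
    have clos : ∀ a ∈ A true, ∀ b, (W.del x).graph.Adj a b → b ∈ A true := fun a ha b hab =>
      hA.closed true a ha b (toSigned_adj.2 hab.1) hab.2.2
    have hl₁A : l₁ ∉ A true := fun h => hA.disj true l₁ h (hA.p_mem false)
    have hl₂A : l₂ ∉ A true := fun h => hA.disj true l₂ h (hA.q_mem false)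
    have F₁ := SideStep.fused (σ := true) s₁ hk isoD (noZero _ hk₁.1) (noZero _ hk₂.1)
      (mem _ hk₁.1) (mem _ hk₂.1) (R := A true) (hA.p_mem true) clos
    have iso₁ := SideStep.isolated (σ := true) s₁ hk isoD (noZero _ hk₁.1) (noZero _ hk₂.1)
    have ag := fun y (hy : y ∉ A true) a => s₁.agree hk (hA.p_mem true) (hA.q_mem true) clos hy a
    have noZero₁ : ∀ l, W.graph.Adj x l → l ∉ A true → ∀ a, W₁.graph.Adj l a →
        W₁.weight l a ≠ 0 := by
      intro l hl hlA a ha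
      have := ag l hlA a
      rw [this.2 (this.1.1 ha)]
      exact noZero l hl a (this.1.1 ha)
    have mem₁ : ∀ l, W.graph.Adj x l → l ∉ A true → l ∈ W₁.verts := by
      intro l hl hlA
      obtain ⟨-, e⟩ | ⟨-, -, -, -, e⟩ := F₁
      · rw [e]; exact mem l hl
      · rw [e]; exact ⟨mem l hl, fun e => hlA (e ▸ hA.q_mem true)⟩
    have F₂ := SideStep.fused (σ := false) s₂ hl iso₁ (noZero₁ _ hl₁.1 hl₁A)
      (noZero₁ _ hl₂.1 hl₂A) (mem₁ _ hl₁.1 hl₁A) (mem₁ _ hl₂.1 hl₂A) (R := Set.univ)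
      trivial (fun _ _ _ _ => trivial)
    -- A contraction on the positive side commutes with the new edge on the negative side.
    have F₁' := F₁.addEdge (τ := false) (p := l₁) (q := l₂) (hA.q_mem true) hl₁A hl₂A
    rw [toSigned_del] at F₁'
    change SignedGraph.Fused (W.toSigned.separate x (fun τ => bif τ then k₁ else l₁)
      (fun τ => bif τ then k₂ else l₂)) _ _ _ _ _ _ _ at F₁'
    have S₀ := hA.similar hT.balanced
    have S₁ := F₁'.similar S₀.balanced
    have S₂ := F₂.similar S₁.balanced
    refine ⟨⟨S₂.balanced, ?_, ?_⟩, S₀.trans (S₁.trans S₂)⟩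
    · refine F₂.mem_iff S₁.balanced (F₁'.mem_iff S₀.balanced fun y => ?_)
      by_cases hy : y = x
      · subst hy
        simp [hA.deg_removed, WGraph.del]
      · rw [hA.deg_separate _ hy, ← hT.mem_verts_iff]
        simp [WGraph.del, hy]
    · exact SideStep.isolated (σ := false) s₂ hl iso₁ (noZero₁ _ hl₁.1 hl₁A)
        (noZero₁ _ hl₂.1 hl₂A)

theorem tame_similar_of_reflTransGen (hT : W.Tame) (h : Relation.ReflTransGen Step W W') :
    W'.Tame ∧ SignedGraph.Similar W.toSigned W'.toSigned := by
  induction h with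
  | refl => exact ⟨hT, .refl hT.balanced⟩
  | tail _ h ih =>
    obtain ⟨h1, h2⟩ := h.tame_similar ih.1
    exact ⟨h1, ih.2.trans h2⟩

/-! ### Existence of reductions -/

theorem Step.verts_ssubset (h : Step W W') : W'.verts ⊂ W.verts := by
  cases h with
  | contraction i j h =>
    refine ⟨fun a ha => ha.1, fun hs => ?_⟩
    exact (hs (W.mem_verts h.1.symm)).2 rfl
  | separation x W' h =>
    obtain ⟨-, -, -, k₁, k₂, l₁, l₂, hk, hl, hk₁, hk₂, hl₁, hl₂, hkl, W₁, s₁, s₂⟩ := h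
    have mem : ∀ k, W.graph.Adj x k → k ∈ W.verts \ {x} := fun k hk =>
      ⟨W.mem_verts hk.symm, hk.ne.symm⟩
    have h1 : W₁.verts ⊆ W.verts \ {x} := by
      intro a ha
      rcases s₁.verts_subset ha with h | rfl | rfl
      exacts [h, mem _ hk₁.1, mem _ hk₂.1]
    have h2 : W'.verts ⊆ W.verts \ {x} := by
      intro a ha
      rcases s₂.verts_subset ha with h | rfl | rfl
      exacts [h1 h, mem _ hl₁.1, mem _ hl₂.1]
    exact ⟨fun a ha => (h2 ha).1, fun hs => (h2 (hs (W.mem_verts hk₁.1))).2 rfl⟩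

/-- Every operation removes a vertex, so that reductions exist. -/
theorem exists_reduces (W : WGraph V) : ∃ W', W.Reduces W' := by
  induction hn : W.verts.ncard using Nat.strong_induction_on generalizing W with
  | _ n ih =>
    by_cases h : ∃ W', Step W W'
    · obtain ⟨W', h⟩ := h
      obtain ⟨W'', h1, h2⟩ := ih _ (hn ▸ Set.ncard_lt_ncard h.verts_ssubset) W' rfl
      exact ⟨W'', .head h h1, h2⟩
    · exact ⟨W, .refl, fun W' h' => h ⟨W', h'⟩⟩

end WGraph

/-! ### Possible operations -/

/-- The handshake lemma. -/
theorem even_sum_sum_of_symm {V : Type*} (s : Finset V) (h : V → V → ℤ)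
    (hs : ∀ a b, h a b = h b a) (h0 : ∀ a, h a a = 0) : Even (∑ a ∈ s, ∑ b ∈ s, h a b) := by
  classical
  rw [← ZMod.intCast_eq_zero_iff_even, ← Finset.sum_product', Int.cast_sum]
  refine Finset.sum_involution (fun x _ => x.swap) ?_ ?_ ?_ ?_
  · rintro ⟨a, b⟩ -
    simp only [Prod.swap]
    rw [hs b a]
    exact CharTwo.add_self_eq_zero _
  · rintro ⟨a, b⟩ - hne e
    simp only [Prod.swap, Prod.mk.injEq] at e
    obtain ⟨rfl, -⟩ := e
    simp [h0] at hne
  · rintro ⟨a, b⟩ hab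
    simpa [and_comm] using hab
  · rintro ⟨a, b⟩ -
    rfl

/-- A vertex connected to `a` is connected to a neighbour of `a` without passing through `a`. -/
theorem exists_adj_reflTransGen_avoiding {V : Type*} {G : SimpleGraph V} {a c : V}
    (h : G.Reachable a c) (hne : c ≠ a) :
    ∃ n, G.Adj a n ∧ Relation.ReflTransGen (fun u v => G.Adj u v ∧ u ≠ a ∧ v ≠ a) n c := by
  rw [SimpleGraph.reachable_iff_reflTransGen] at h
  induction h with
  | refl => exact absurd rfl hne
  | @tail c d _ h ih =>
    by_cases hc : c = a
    · subst hc
      exact ⟨d, h, .refl⟩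
    · obtain ⟨n, h1, h2⟩ := ih hc
      exact ⟨n, h1, h2.tail ⟨h, hc, hne⟩⟩

namespace WGraph

variable {V : Type*} {W W' D : WGraph V}

theorem exists_sideStep {σ : Bool} {k l : V} (hkl : k ≠ l)
    (h1 : D.graph.Adj k l → D.weight k l = signOf σ ∨ D.weight k l = -signOf σ)
    (h2 : D.graph.Adj k l → D.weight k l = signOf σ → D.graph.IsBridge s(k, l))
    (h3 : D.graph.Adj k l → D.weight k l = -signOf σ →
      (∀ a, D.graph.Adj k a → a = l) ∧ ∀ a, D.graph.Adj l a → a = k) :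
    ∃ W, SideStep (signOf σ) k l D W := by
  by_cases h : D.graph.Adj k l
  · rcases h1 h with hw | hw
    · refine ⟨_, .b h hw ⟨(setEdge_adj hkl _).2 (.inl h), ?_, ?_⟩⟩
      · rw [setEdge_weight_of_eq rfl]
        cases σ <;> simp [signOf]
      · have := h2 h hw
        rw [SimpleGraph.isBridge_iff] at this ⊢
        refine fun hr => this (hr.mono fun a b hab => ?_)
        rw [SimpleGraph.deleteEdges_adj] at hab ⊢
        exact ⟨((setEdge_adj hkl _).1 hab.1).resolve_right hab.2, hab.2⟩
    · exact ⟨_, .c h hw (h3 h hw).1 (h3 h hw).2⟩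
  · exact ⟨_, .a h⟩

theorem exists_mult_pos_of_adj {a b : V} (h : W.graph.Adj a b) : ∃ σ, 0 < W.toSigned.mult σ a b :=
  toSigned_adj.2 h

theorem adj_of_mult_pos {a b : V} {σ : Bool} (h : 0 < W.toSigned.mult σ a b) : W.graph.Adj a b :=
  toSigned_adj.1 ⟨σ, h⟩

theorem weight_eq_of_count_pos {c : ℤ} {σ : Bool} (hc : c ≠ 0) (h : 0 < count c σ) :
    c = count c σ * signOf σ := by
  cases σ <;> simp only [count, signOf, hc, if_false, cond_true, cond_false] at h ⊢ <;> omega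

theorem signOf_not (σ : Bool) : signOf (!σ) = -signOf σ := by cases σ <;> simp [signOf]

theorem eq_zero_of_count_pos {c : ℤ} (h : ∀ σ, 0 < count c σ) : c = 0 := by
  by_contra hc
  have h1 := weight_eq_of_count_pos hc (h true)
  have h2 := weight_eq_of_count_pos hc (h false)
  have := h true
  have := h false
  simp only [signOf, cond_true, cond_false] at h1 h2
  omega

theorem conn_of_adj_avoiding {a u v : V}
    (h : Relation.ReflTransGen (fun u v => W.graph.Adj u v ∧ u ≠ a ∧ v ≠ a) u v) :
    W.toSigned.Conn a u v :=
  Relation.ReflTransGen.mono (fun _ _ h => ⟨toSigned_adj.2 h.1, h.2⟩) _ _ h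

variable [Fintype V]

/-- If all vertices of degree two split, then an edge of weight `±2` is a bridge: a second path
between its ends would start at `a` with an edge of the other sign, and would make `a` violate
splitting. -/
theorem Tame.canContract (hT : W.Tame) (hs : W.toSigned.AllSplit) {σ : Bool} {a b : V}
    (h : 2 ≤ W.toSigned.mult σ a b) : W.CanContract a b := by
  have hab := adj_of_mult_pos (lt_of_lt_of_le two_pos h)
  have hd := hT.balanced.deg_le' σ a
  have hm := W.toSigned.mult_le_deg σ a b
  have hda := hT.balanced.deg_eq σ a
  rw [toSigned_mult_of_adj hab] at h hm
  have w0 : W.weight a b ≠ 0 := by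
    intro e
    simp [e, count] at h
  refine ⟨hab, ?_, ?_⟩
  · rw [weight_eq_of_count_pos w0 (lt_of_lt_of_le two_pos h),
      show count (W.weight a b) σ = 2 by omega]
    cases σ <;> simp [signOf]
  · rw [SimpleGraph.isBridge_iff]
    intro hr
    obtain ⟨n, h1, h2⟩ := exists_adj_reflTransGen_avoiding hr hab.ne.symm
    rw [SimpleGraph.deleteEdges_adj] at h1
    have hnb : b ≠ n := by
      rintro rfl
      exact h1.2 rfl
    have hc : W.toSigned.Conn a n b := conn_of_adj_avoiding
      (Relation.ReflTransGen.mono (fun u v huv =>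
        ⟨(SimpleGraph.deleteEdges_adj.1 huv.1).1, huv.2⟩) _ _ h2)
    obtain ⟨τ, hτ⟩ := exists_mult_pos_of_adj h1.1
    have hτσ : τ = !σ := by
      rw [Bool.eq_not]
      rintro rfl
      have := W.toSigned.mult_add_mult_le_deg τ a hnb
      rw [toSigned_mult_of_adj hab] at this
      omega
    subst hτσ
    refine (hs a (by omega)).not_conn σ ?_ hτ hc.symm
    rw [toSigned_mult_of_adj hab]; omega

/-- Let `k` and `l` be neighbours of `y` along edges of sign `σ`, and let all weights be `0` or
`±1`. If `{k, l}` is an edge, splitting at `k` puts it into case (b) or (c) of a separation,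
according to its sign. -/
theorem Tame.sideStep_hyps (hT : W.Tame) (hs : W.toSigned.AllSplit)
    (hm : ∀ σ a b, W.toSigned.mult σ a b ≤ 1) {y k l : V} {σ : Bool} (hkl : k ≠ l)
    (hk : W.toSigned.mult σ y k = 1) (hl : W.toSigned.mult σ y l = 1)
    (h : (W.del y).graph.Adj k l) :
    (W.weight k l = signOf σ ∨ W.weight k l = -signOf σ) ∧
    (W.weight k l = signOf σ → (W.del y).graph.IsBridge s(k, l)) ∧
    (W.weight k l = -signOf σ → ∀ a, (W.del y).graph.Adj k a → a = l) := by
  have hyk : W.graph.Adj y k := adj_of_mult_pos (σ := σ) (by omega)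
  have hyl : W.graph.Adj y l := adj_of_mult_pos (σ := σ) (by omega)
  have w0 : W.weight k l ≠ 0 := fun e => hyl.ne (hT.isolated k l h.1 e y hyk.symm)
  have hky := W.toSigned.symm σ y k
  refine ⟨?_, fun hw => ?_, fun hw a ha => ?_⟩
  · obtain ⟨τ, hτ⟩ := exists_mult_pos_of_adj h.1
    have := hm τ k l
    rw [toSigned_mult_of_adj h.1] at this hτ
    have e := weight_eq_of_count_pos w0 hτ
    rw [show count (W.weight k l) τ = 1 by omega] at e
    rw [e]
    cases τ <;> cases σ <;> simp [signOf]
  · rw [SimpleGraph.isBridge_iff]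
    intro hr
    obtain ⟨n, h1, h2⟩ := exists_adj_reflTransGen_avoiding hr hkl.symm
    rw [SimpleGraph.deleteEdges_adj] at h1
    have hnl : l ≠ n := by
      rintro rfl
      exact h1.2 rfl
    have hny : y ≠ n := h1.1.2.2.symm
    have hc : W.toSigned.Conn k n l := conn_of_adj_avoiding
      (Relation.ReflTransGen.mono (fun u v huv =>
        ⟨(SimpleGraph.deleteEdges_adj.1 huv.1).1.1, huv.2⟩) _ _ h2)
    have hkl1 : W.toSigned.mult σ k l = 1 := by
      rw [toSigned_mult_of_adj h.1, hw]
      cases σ <;> simp [count, signOf]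
    have d1 := W.toSigned.mult_add_mult_le_deg σ k hyl.ne
    have d2 := hT.balanced.deg_le' σ k
    have d3 := hT.balanced.deg_eq σ k
    obtain ⟨τ, hτ⟩ := exists_mult_pos_of_adj h1.1.1
    have hτσ : τ = !σ := by
      rw [Bool.eq_not]
      rintro rfl
      have := W.toSigned.mult_add_mult_add_mult_le_deg τ k hyl.ne hny hnl
      omega
    subst hτσ
    exact (hs k (by omega)).not_conn σ (by omega) hτ hc.symm
  · by_contra hal
    have hkl1 : W.toSigned.mult (!σ) k l = 1 := by
      rw [toSigned_mult_of_adj h.1, hw, count_neg, Bool.not_not]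
      cases σ <;> simp [count, signOf]
    obtain ⟨τ, hτ⟩ := exists_mult_pos_of_adj ha.1
    have d2 := hT.balanced.deg_le' τ k
    have d3 := hT.balanced.deg_eq τ k
    have hd : 2 ≤ W.toSigned.deg τ k := by
      by_cases e : τ = σ
      · subst e
        have := W.toSigned.mult_add_mult_le_deg τ k ha.2.2
        omega
      · obtain rfl := Bool.eq_not.2 e
        have := W.toSigned.mult_add_mult_le_deg (!σ) k hal
        omega
    refine (hs k (by omega)).not_conn σ (a := y) (b := l) (by omega) (by omega) ?_
    exact .single ⟨toSigned_adj.2 hyl, hyk.ne, hkl.symm⟩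

/-- If all vertices of degree two split and no edge has weight `±2`, then every vertex of degree two
can be separated. -/
theorem Tame.exists_separation (hT : W.Tame) (hs : W.toSigned.AllSplit)
    (hm : ∀ σ a b, W.toSigned.mult σ a b ≤ 1) {y : V} (hy : W.toSigned.deg true y = 2) :
    ∃ W', W.Separation y W' := by
  classical
  have hsy := hs y hy
  have ex : ∀ σ, ∃ p q, p ≠ q ∧ W.toSigned.mult σ y p = 1 ∧ W.toSigned.mult σ y q = 1 := fun σ =>
    W.toSigned.exists_pair_of_deg_eq_two (by rw [hT.balanced.deg_eq, hy]) fun b => hm σ y b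
  have wt : ∀ σ p q, p ≠ q → W.toSigned.mult σ y p = 1 → W.toSigned.mult σ y q = 1 →
      W.graph.Adj y p ∧ W.weight y p = signOf σ := by
    intro σ p q hpq hp hq
    have hyp : W.graph.Adj y p := adj_of_mult_pos (σ := σ) (by omega)
    have hyq : W.graph.Adj y q := adj_of_mult_pos (σ := σ) (by omega)
    have w0 : W.weight y p ≠ 0 := fun e => hpq (hT.isolated y p hyp e q hyq).symm
    rw [toSigned_mult_of_adj hyp] at hp
    refine ⟨hyp, ?_⟩
    rw [weight_eq_of_count_pos w0 (σ := σ) (by omega), hp]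
    simp
  obtain ⟨k₁, k₂, hk, mk₁, mk₂⟩ := ex true
  obtain ⟨l₁, l₂, hl, ml₁, ml₂⟩ := ex false
  have hk₁ := wt true k₁ k₂ hk mk₁ mk₂
  have hk₂ := wt true k₂ k₁ hk.symm mk₂ mk₁
  have hl₁ := wt false l₁ l₂ hl ml₁ ml₂
  have hl₂ := wt false l₂ l₁ hl.symm ml₂ ml₁
  simp only [signOf, cond_true, cond_false] at hk₁ hk₂ hl₁ hl₂
  have diff : ∀ k l, W.weight y k = 1 → W.weight y l = -1 → k ≠ l := by
    rintro k l h1 h2 rfl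
    omega
  have nbr : ∀ a, W.graph.Adj y a ↔ a ∈ ({k₁, k₂, l₁, l₂} : Finset V) := by
    intro a
    simp only [Finset.mem_insert, Finset.mem_singleton]
    constructor
    · intro ha
      obtain ⟨τ, hτ⟩ := exists_mult_pos_of_adj ha
      by_contra! hne
      obtain ⟨n1, n2, n3, n4⟩ := hne
      have := hT.balanced.deg_le' τ y
      cases τ
      · have := W.toSigned.mult_add_mult_add_mult_le_deg false y hl n3.symm n4.symm
        omega
      · have := W.toSigned.mult_add_mult_add_mult_le_deg true y hk n1.symm n2.symm
        omega
    · rintro (rfl | rfl | rfl | rfl)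
      exacts [hk₁.1, hk₂.1, hl₁.1, hl₂.1]
  have d1 := diff k₁ l₁ hk₁.2 hl₁.2
  have d2 := diff k₁ l₂ hk₁.2 hl₂.2
  have d3 := diff k₂ l₁ hk₂.2 hl₁.2
  have d4 := diff k₂ l₂ hk₂.2 hl₂.2
  have sep : ∀ k ∈ ({k₁, k₂} : Set V), ∀ l ∈ ({l₁, l₂} : Set V),
      ¬ (W.del y).graph.Reachable k l := by
    intro k hk l hl
    rw [reachable_del_iff]
    have h1 : 0 < W.toSigned.mult true y k := by
      rcases hk with rfl | rfl <;> omega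
    have h2 : 0 < W.toSigned.mult false y l := by
      rcases hl with rfl | rfl <;> omega
    exact hsy k l h1 h2
  have mk₁' := sep k₁ (by simp)
  have mk₂' := sep k₂ (by simp)
  let R : Set V := {a | (W.del y).graph.Reachable k₁ a ∨ (W.del y).graph.Reachable k₂ a}
  have hR : ∀ a ∈ R, ∀ b, (W.del y).graph.Adj a b → b ∈ R := fun a ha b hab =>
    ha.imp (fun h => h.trans hab.reachable) (fun h => h.trans hab.reachable)
  have hl₁R : l₁ ∉ R := fun h => h.elim (mk₁' l₁ (by simp)) (mk₂' l₁ (by simp))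
  have hl₂R : l₂ ∉ R := fun h => h.elim (mk₁' l₂ (by simp)) (mk₂' l₂ (by simp))
  have K := hT.sideStep_hyps hs hm hk mk₁ mk₂
  have K' := hT.sideStep_hyps hs hm hk.symm mk₂ mk₁
  have L := hT.sideStep_hyps hs hm hl ml₁ ml₂
  have L' := hT.sideStep_hyps hs hm hl.symm ml₂ ml₁
  obtain ⟨W₁, s₁⟩ : ∃ W₁, SideStep (signOf true) k₁ k₂ (W.del y) W₁ := by
    refine exists_sideStep hk (fun h => (K h).1) (fun h => (K h).2.1) fun h hw =>
      ⟨(K h).2.2 hw, (K' h.symm).2.2 ?_⟩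
    rw [W.weight_symm]; exact hw
  have ag := fun z (hz : z ∉ R) a => s₁.agree hk (R := R) (.inl (Reachable.refl _))
    (.inr (Reachable.refl _)) hR hz a
  obtain ⟨W₂, s₂⟩ : ∃ W₂, SideStep (signOf false) l₁ l₂ W₁ W₂ := by
    have adj : W₁.graph.Adj l₁ l₂ → (W.del y).graph.Adj l₁ l₂ := (ag l₁ hl₁R l₂).1.1
    have wgt : W₁.graph.Adj l₁ l₂ → W₁.weight l₁ l₂ = W.weight l₁ l₂ := fun h =>
      (ag l₁ hl₁R l₂).2 (adj h)
    refine exists_sideStep hl ?_ ?_ ?_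
    · intro h
      rw [wgt h]
      exact (L (adj h)).1
    · intro h hw
      rw [wgt h] at hw
      have := (L (adj h)).2.1 hw
      rw [SimpleGraph.isBridge_iff] at this ⊢
      intro hr
      rw [SimpleGraph.reachable_iff_reflTransGen] at hr
      have key : ∀ z, Relation.ReflTransGen (W₁.graph.deleteEdges {s(l₁, l₂)}).Adj l₁ z →
          z ∉ R ∧ ((W.del y).graph.deleteEdges {s(l₁, l₂)}).Reachable l₁ z := by
        intro z hz
        induction hz with
        | refl => exact ⟨hl₁R, Reachable.refl _⟩
        | @tail b c _ hbc ih =>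
          rw [SimpleGraph.deleteEdges_adj] at hbc
          have hbc' := (ag b ih.1 c).1.1 hbc.1
          refine ⟨fun hc => ih.1 (hR c hc b hbc'.symm), ih.2.trans (Adj.reachable ?_)⟩
          exact SimpleGraph.deleteEdges_adj.2 ⟨hbc', hbc.2⟩
      exact this (key l₂ hr).2
    · intro h hw
      rw [wgt h] at hw
      refine ⟨fun a ha => (L (adj h)).2.2 hw a ((ag l₁ hl₁R a).1.1 ha), fun a ha =>
        (L' (adj h).symm).2.2 ?_ a ((ag l₂ hl₂R a).1.1 ha)⟩
      rw [W.weight_symm]; exact hw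
  refine ⟨W₂, ?_, ?_, ⟨k₁, l₁, hk₁.1.ne.symm, hl₁.1.ne.symm,
    hk₁.1.symm.reachable.trans hl₁.1.reachable, mk₁' l₁ (by simp)⟩,
    k₁, k₂, l₁, l₂, hk, hl, hk₁, hk₂, hl₁, hl₂, sep, W₁, s₁, s₂⟩
  · have : W.graph.neighborSet y = (({k₁, k₂, l₁, l₂} : Finset V) : Set V) := by
      ext a
      exact nbr a
    rw [WGraph.deg, this, Set.ncard_coe_finset]
    simp [hk, hl, d1, d2, d3, d4]
  · have : Finset.univ.filter (fun b : V => W.graph.Adj y b) = {k₁, k₂, l₁, l₂} := by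
      ext a
      simp only [Finset.mem_filter, Finset.mem_univ, true_and]
      exact nbr a
    unfold WGraph.wdeg
    rw [show Finset.univ.filter (fun b : V => W.graph.Adj y b) = {k₁, k₂, l₁, l₂} by convert this]
    rw [Finset.sum_insert (by simp [hk, d1, d2]), Finset.sum_insert (by simp [d3, d4]),
      Finset.sum_insert (by simp [hl]), Finset.sum_singleton, hk₁.2, hk₂.2, hl₁.2, hl₂.2]
    norm_num

/-- A graph admitting no further step whose vertices are all split has no vertex of degree two. -/
theorem Tame.deg_ne_two_of_terminal (hT : W.Tame) (hs : W.toSigned.AllSplit)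
    (hterm : ∀ W', ¬ Step W W') (y : V) : W.toSigned.deg true y ≠ 2 := by
  intro hy
  have hm : ∀ σ a b, W.toSigned.mult σ a b ≤ 1 := by
    intro σ a b
    by_contra! h
    exact hterm _ (.contraction a b (hT.canContract hs h))
  obtain ⟨W', h⟩ := hT.exists_separation hs hm hy
  exact hterm _ (.separation y W' h)

end WGraph

/-! ### Graphs without vertices of degree two -/

namespace WGraph

variable {V : Type*} {W W₁ W₂ W' : WGraph V}

theorem conn_of_mem_support_of_isPath {u y z : V} (p : W.graph.Walk u y) (hp : p.IsPath)
    (hz : z ∈ p.support) (hzy : z ≠ y) : W.toSigned.Conn y u z := by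
  induction p with
  | nil => simp at hz; exact absurd hz hzy
  | @cons u u' y h p ih =>
    rw [Walk.cons_isPath_iff] at hp
    rw [Walk.support_cons, List.mem_cons] at hz
    have huy : u ≠ y := fun e => hp.2 (e ▸ p.end_mem_support)
    rcases hz with rfl | hz
    · exact .refl
    · by_cases hu' : u' = y
      · subst hu'
        rw [Walk.isPath_iff_nil, ← Walk.eq_nil_iff_nil] at hp
        rw [hp.1] at hz
        simp at hz
        exact absurd hz hzy
      · exact .head ⟨toSigned_adj.2 h, huy, hu'⟩ (ih hp.1 hz hzy)

/-- A vertex whose component is a cycle is no cut vertex. -/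
theorem EvenCycleAt.not_cuts {y : V} (h : W.EvenCycleAt y) : ¬ W.toSigned.Cuts y := by
  rintro ⟨a, b, ha, hb, hab⟩
  obtain ⟨c, hc, -, hcov⟩ := h
  rw [toSigned_adj] at ha hb
  have mem : ∀ a, W.graph.Adj y a → a ∈ c.support := fun a ha =>
    c.snd_mem_support_of_mem_edges (hcov y a (Reachable.refl _) ha)
  have ha' := mem a ha
  have hb' := mem b hb
  cases c with
  | nil => exact absurd hc Walk.not_isCycle_nil
  | cons h p =>
    rw [Walk.cons_isCycle_iff] at hc
    rw [Walk.support_cons, List.mem_cons] at ha' hb'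
    have h1 := conn_of_mem_support_of_isPath p hc.1 (ha'.resolve_left ha.ne.symm) ha.ne.symm
    have h2 := conn_of_mem_support_of_isPath p hc.1 (hb'.resolve_left hb.ne.symm) hb.ne.symm
    exact hab (h1.symm.trans h2)

theorem ZeroEdgeAt.not_cuts {y : V} (h : W.ZeroEdgeAt y) : ¬ W.toSigned.Cuts y := by
  rintro ⟨a, b, ha, hb, hab⟩
  obtain ⟨z, -, -, h1, -⟩ := h
  rw [toSigned_adj] at ha hb
  rw [h1 a ha, h1 b hb] at hab
  exact hab .refl

theorem IsCutVertex.cuts {x : V} (h : W.IsCutVertex x) : W.toSigned.Cuts x := by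
  obtain ⟨a, b, ha, hb, hab, hnot⟩ := h
  by_contra hc
  have all : ∀ a b, W.graph.Adj x a → W.graph.Adj x b → W.toSigned.Conn x a b := by
    intro a b ha hb
    by_contra hn
    exact hc ⟨a, b, toSigned_adj.2 ha, toSigned_adj.2 hb, hn⟩
  rw [reachable_del_iff] at hnot
  rw [SimpleGraph.reachable_iff_reflTransGen] at hab
  suffices H : (b ≠ x → W.toSigned.Conn x a b) ∧
      (b = x → ∃ n, W.graph.Adj x n ∧ W.toSigned.Conn x a n) from hnot (H.1 hb)
  clear hb hnot
  induction hab with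
  | refl => exact ⟨fun _ => .refl, fun e => absurd e ha⟩
  | @tail c d _ hcd ih =>
    by_cases hcx : c = x
    · subst hcx
      obtain ⟨n, hn, hcn⟩ := ih.2 rfl
      exact ⟨fun _ => hcn.trans (all n d hn hcd), fun e => absurd e hcd.ne.symm⟩
    · have hc' := ih.1 hcx
      refine ⟨fun hd => hc'.tail ⟨toSigned_adj.2 hcd, hcx, hd⟩, ?_⟩
      rintro rfl
      exact ⟨c, hcd.symm, hc'⟩

theorem isCutVertex_of_cuts {x : V} (h : W.toSigned.Cuts x) : W.IsCutVertex x := by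
  obtain ⟨a, b, ha, hb, hab⟩ := h
  rw [toSigned_adj] at ha hb
  exact ⟨a, b, ha.ne.symm, hb.ne.symm, ha.symm.reachable.trans hb.reachable, by
    rwa [reachable_del_iff]⟩

theorem weight_eq_zero_of_mult_pos {a b : V} (h : ∀ σ, 0 < W.toSigned.mult σ a b) :
    W.weight a b = 0 := by
  have hab := adj_of_mult_pos (h true)
  exact eq_zero_of_count_pos fun σ => by
    have := h σ
    rwa [toSigned_mult_of_adj hab] at this

variable [Fintype V]

theorem Tame.allSplit_of_allEvenCycleOrZeroEdge (hT : W.Tame) (hc : W.toSigned.AllCut)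
    (h : W.AllEvenCycleOrZeroEdge) : W.toSigned.AllSplit := by
  intro y hy
  exfalso
  rcases h y ((hT.mem_verts_iff y).2 (by omega)) with h | h
  · exact h.not_cuts (hc y hy)
  · exact h.not_cuts (hc y hy)

theorem Tame.exists_mult_pos (hT : W.Tame) {x : V} (hx : x ∈ W.verts) (σ : Bool) :
    ∃ a, 0 < W.toSigned.mult σ x a := by
  apply W.toSigned.exists_mult_pos
  rw [hT.balanced.deg_eq]
  exact (hT.mem_verts_iff x).1 hx

theorem Tame.eq_of_mult_pos (hT : W.Tame) (h2 : ∀ y, W.toSigned.deg true y ≠ 2) {σ : Bool}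
    {x a b : V} (ha : 0 < W.toSigned.mult σ x a) (hb : 0 < W.toSigned.mult σ x b) : a = b := by
  by_contra hab
  have := W.toSigned.mult_add_mult_le_deg σ x hab
  have := hT.balanced.deg_eq σ x
  have := hT.balanced.deg_le x
  have := h2 x
  omega

/-- The graph of the edges of nonzero weight. -/
def nonzeroPart (W : WGraph V) : SimpleGraph V where
  Adj a b := W.graph.Adj a b ∧ W.weight a b ≠ 0
  symm := ⟨fun a b h => ⟨h.1.symm, by rw [W.weight_symm]; exact h.2⟩⟩
  loopless := ⟨fun a h => W.graph.loopless.irrefl a h.1⟩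

theorem Tame.neighborSet_nonzeroPart (hT : W.Tame) (h2 : ∀ y, W.toSigned.deg true y ≠ 2)
    {x a : V} (hxa : W.nonzeroPart.Adj x a) :
    ∃ p n, p ≠ n ∧ W.nonzeroPart.neighborSet x = {p, n} := by
  have hx := W.mem_verts hxa.1
  obtain ⟨p, hp⟩ := hT.exists_mult_pos hx true
  obtain ⟨n, hn⟩ := hT.exists_mult_pos hx false
  have hpn : p ≠ n := by
    rintro rfl
    have hw := weight_eq_zero_of_mult_pos (Bool.forall_bool.2 ⟨hn, hp⟩)
    have := hT.isolated x p (adj_of_mult_pos hp) hw a hxa.1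
    exact hxa.2 (this ▸ hw)
  refine ⟨p, n, hpn, ?_⟩
  ext b
  simp only [SimpleGraph.mem_neighborSet, Set.mem_insert_iff, Set.mem_singleton_iff]
  constructor
  · intro hb
    obtain ⟨τ, hτ⟩ := exists_mult_pos_of_adj hb.1
    cases τ
    · exact .inr (hT.eq_of_mult_pos h2 hτ hn)
    · exact .inl (hT.eq_of_mult_pos h2 hτ hp)
  · have nz : ∀ b c σ, 0 < W.toSigned.mult σ x b → 0 < W.toSigned.mult (!σ) x c → b ≠ c →
        W.nonzeroPart.Adj x b := fun b c σ hb hc hbc =>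
      ⟨adj_of_mult_pos hb, fun h0 => hbc
        (hT.isolated x b (adj_of_mult_pos hb) h0 c (adj_of_mult_pos hc)).symm⟩
    rintro (rfl | rfl)
    · exact nz b n true hp hn hpn
    · exact nz b p false hn hp hpn.symm

/-- If no vertex has signed degree two, then every vertex outside the edges of weight `0` has
exactly two neighbours, one of each sign, so that its component is a cycle. Its length is even since
the positive edges form a perfect matching of it. -/
theorem Tame.evenCycleAt_or_zeroEdgeAt (hT : W.Tame) (h2 : ∀ y, W.toSigned.deg true y ≠ 2)
    {x : V} (hx : x ∈ W.verts) : W.EvenCycleAt x ∨ W.ZeroEdgeAt x := by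
  classical
  by_cases hz : ∃ a, W.graph.Adj x a ∧ W.weight x a = 0
  · obtain ⟨a, ha, h0⟩ := hz
    exact .inr ⟨a, ha, h0, hT.isolated x a ha h0,
      hT.isolated a x ha.symm (by rw [W.weight_symm]; exact h0)⟩
  left
  push Not at hz
  have hcyc : W.nonzeroPart.IsCycles := by
    rintro v ⟨a, ha⟩
    obtain ⟨p, n, hpn, h⟩ := hT.neighborSet_nonzeroPart h2 ha
    rw [h, Set.ncard_pair hpn]
  have hne : (W.nonzeroPart.neighborSet x).Nonempty := by
    obtain ⟨a, ha⟩ := hT.exists_mult_pos hx true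
    exact ⟨a, adj_of_mult_pos ha, hz a (adj_of_mult_pos ha)⟩
  obtain ⟨c, hc, hsupp⟩ := hcyc.exists_cycle_toSubgraph_verts_eq_connectedComponentSupp
    (c := W.nonzeroPart.connectedComponentMk x) rfl hne
  have reach : ∀ a, W.graph.Reachable x a → W.nonzeroPart.Reachable x a ∧
      ∀ b, W.graph.Adj a b → W.weight a b ≠ 0 := by
    intro a ha
    rw [SimpleGraph.reachable_iff_reflTransGen] at ha
    induction ha with
    | refl => exact ⟨Reachable.refl _, hz⟩
    | @tail a b _ hab ih =>
      refine ⟨ih.1.trans (Adj.reachable ⟨hab, ih.2 b hab⟩), fun d hd h0 => ?_⟩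
      obtain rfl := hT.isolated b d hd h0 a hab.symm
      exact ih.2 b hab (by rw [W.weight_symm]; exact h0)
  have mem : ∀ a, a ∈ c.support ↔ W.nonzeroPart.Reachable x a := by
    intro a
    rw [← c.mem_verts_toSubgraph, hsupp, ConnectedComponent.mem_supp_iff,
      ConnectedComponent.eq]
    exact ⟨Reachable.symm, Reachable.symm⟩
  have hle : W.nonzeroPart ≤ W.graph := fun _ _ h => h.1
  refine ⟨c.mapLe hle, hc.mapLe hle, ?_, ?_⟩
  · rw [Walk.length_mapLe]
    have card : (c.support.tail.toFinset).card = c.length := by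
      rw [List.toFinset_card_of_nodup hc.support_nodup, List.length_tail, Walk.length_support]
      rfl
    have memS : ∀ a, a ∈ c.support.tail.toFinset ↔ W.nonzeroPart.Reachable x a := by
      intro a
      rw [List.mem_toFinset, ← mem]
      refine ⟨List.mem_of_mem_tail, fun ha => ?_⟩
      rw [c.mem_support_iff] at ha
      rcases ha with rfl | ha
      · cases c with
        | nil => exact absurd hc Walk.not_isCycle_nil
        | cons h p => simp
      · exact ha
    -- Every vertex of the cycle has one positive edge, which belongs to the cycle, so that the
    -- number of vertices is a sum of degrees.
    have ev := even_sum_sum_of_symm c.support.tail.toFinset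
      (fun a b => (W.toSigned.mult true a b : ℤ)) (fun a b => by simp [W.toSigned.symm true a b])
      (fun a => by simp [W.toSigned.irrefl])
    have one : ∀ a ∈ c.support.tail.toFinset,
        ∑ b ∈ c.support.tail.toFinset, (W.toSigned.mult true a b : ℤ) = 1 := by
      intro a ha
      rw [memS] at ha
      have h1 : W.toSigned.deg true a = 1 := by
        have := hT.balanced.deg_le a
        have := h2 a
        have h3 : 0 < W.toSigned.deg true a := by
          rw [← hT.mem_verts_iff]
          obtain h | ⟨b, -, h⟩ :=
            ((SimpleGraph.reachable_iff_reflTransGen _ _).1 ha).cases_tail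
          · rwa [h]
          · exact W.mem_verts h.1.symm
        omega
      rw [← Nat.cast_sum, ← Nat.cast_one, ← h1, Nat.cast_inj]
      refine Finset.sum_subset (Finset.subset_univ _) fun b _ hb => ?_
      by_contra hb0
      have hab := adj_of_mult_pos (Nat.pos_of_ne_zero hb0)
      refine hb ((memS b).2 (ha.trans (Adj.reachable ⟨hab, ?_⟩)))
      exact (reach a (ha.mono hle)).2 b hab
    rw [Finset.sum_congr rfl one, Finset.sum_const, card] at ev
    simpa using ev
  · intro a b ha hab
    obtain ⟨h1, h3⟩ := reach a ha
    rw [Walk.edges_mapLe_eq_edges, ← Walk.mem_edges_toSubgraph, Subgraph.mem_edgeSet]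
    have : W.nonzeroPart.LocallyFinite := fun v => Fintype.ofFinite _
    rw [hc.adj_toSubgraph_iff_of_isCycles hcyc (c.mem_verts_toSubgraph.2 ((mem a).2 h1))]
    exact ⟨hab, h3 b hab⟩

/-! ### Uniqueness of the reduction -/

/-- If all signed degrees are one, a path of constant sign has length at most one. -/
theorem Tame.adj_iff_linked (hT : W.Tame) (h2 : ∀ y, W.toSigned.deg true y ≠ 2) {a b : V} :
    W.graph.Adj a b ↔ W.toSigned.Linked a b := by
  have one : ∀ {a b}, W.graph.Adj a b → W.toSigned.deg true a = 1 := by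
    intro a b h
    have := (hT.mem_verts_iff a).1 (W.mem_verts h)
    have := hT.balanced.deg_le a
    have := h2 a
    omega
  constructor
  · intro h
    obtain ⟨σ, hσ⟩ := exists_mult_pos_of_adj h
    exact ⟨h.ne, one h, one h.symm, σ, .single hσ⟩
  · rintro ⟨hne, -, -, σ, h⟩
    suffices H : b = a ∨ 0 < W.toSigned.mult σ a b from
      adj_of_mult_pos (H.resolve_left (Ne.symm hne))
    clear hne
    induction h with
    | refl => exact .inl rfl
    | @tail c d _ hcd ih =>
      rcases ih with rfl | ih
      · exact .inr hcd
      · exact .inl (hT.eq_of_mult_pos h2 hcd (by rwa [W.toSigned.symm]))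

theorem Tame.mem_verts_iff_deg_eq_one (hT : W.Tame) (h2 : ∀ y, W.toSigned.deg true y ≠ 2)
    (y : V) : y ∈ W.verts ↔ W.toSigned.deg true y = 1 := by
  rw [hT.mem_verts_iff]
  have := hT.balanced.deg_le y
  have := h2 y
  omega

theorem Tame.weight_sq (hT : W.Tame) (h2 : ∀ y, W.toSigned.deg true y ≠ 2) {a b : V}
    (hab : W.graph.Adj a b) (h0 : W.weight a b ≠ 0) : W.weight a b * W.weight a b = 1 := by
  obtain ⟨σ, hσ⟩ := exists_mult_pos_of_adj hab
  have h1 := W.toSigned.mult_le_deg σ a b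
  have := hT.balanced.deg_eq σ a
  have := hT.balanced.deg_le a
  have := h2 a
  rw [toSigned_mult_of_adj hab] at h1 hσ
  rw [weight_eq_of_count_pos h0 hσ, show count (W.weight a b) σ = 1 by omega]
  cases σ <;> simp [signOf]

theorem Tame.weight_add (hT : W.Tame) (h2 : ∀ y, W.toSigned.deg true y ≠ 2) {a b c : V}
    (hab : W.graph.Adj a b) (hac : W.graph.Adj a c) (hbc : b ≠ c) :
    W.weight a b + W.weight a c = 0 ∧ W.weight a b ≠ 0 ∧ W.weight a c ≠ 0 := by
  have hb0 : W.weight a b ≠ 0 := fun h => hbc (hT.isolated a b hab h c hac).symm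
  have hc0 : W.weight a c ≠ 0 := fun h => hbc (hT.isolated a c hac h b hab)
  refine ⟨?_, hb0, hc0⟩
  obtain ⟨σ, hσ⟩ := exists_mult_pos_of_adj hab
  obtain ⟨τ, hτ⟩ := exists_mult_pos_of_adj hac
  have hne : τ = !σ := by
    rw [Bool.eq_not]
    rintro rfl
    exact hbc (hT.eq_of_mult_pos h2 hσ hτ)
  subst hne
  have h1 := W.toSigned.mult_le_deg σ a b
  have h3 := W.toSigned.mult_le_deg (!σ) a c
  have := hT.balanced.deg_eq σ a
  have := hT.balanced.deg_eq (!σ) a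
  have := hT.balanced.deg_le a
  have := h2 a
  rw [toSigned_mult_of_adj hab] at h1 hσ
  rw [toSigned_mult_of_adj hac] at h3 hτ
  rw [weight_eq_of_count_pos hb0 hσ, weight_eq_of_count_pos hc0 hτ,
    show count (W.weight a b) σ = 1 by omega, show count (W.weight a c) (!σ) = 1 by omega,
    signOf_not]
  ring

theorem Tame.weight_eq_zero_iff (hT : W.Tame) {a b : V} (hab : W.graph.Adj a b) :
    W.weight a b = 0 ↔ ∀ c, W.graph.Adj a c → c = b := by
  refine ⟨hT.isolated a b hab, fun h => weight_eq_zero_of_mult_pos fun σ => ?_⟩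
  obtain ⟨c, hc⟩ := hT.exists_mult_pos (W.mem_verts hab) σ
  exact h c (adj_of_mult_pos hc) ▸ hc

/-- Two tame graphs of signed degree one with the same linked pairs have the same edges. Their
weights are `±1` and change sign at each vertex, so that their product is constant on each
component. -/
theorem Tame.eqUpToSign (hT₁ : W₁.Tame) (hT₂ : W₂.Tame)
    (h₁ : ∀ y, W₁.toSigned.deg true y ≠ 2) (h₂ : ∀ y, W₂.toSigned.deg true y ≠ 2)
    (hdeg : ∀ y, W₁.toSigned.deg true y = 1 ↔ W₂.toSigned.deg true y = 1)
    (hlink : ∀ a b, W₁.toSigned.Linked a b ↔ W₂.toSigned.Linked a b) : W₁.EqUpToSign W₂ := by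
  classical
  have hadj : ∀ a b, W₁.graph.Adj a b ↔ W₂.graph.Adj a b := fun a b => by
    rw [hT₁.adj_iff_linked h₁, hT₂.adj_iff_linked h₂, hlink]
  refine ⟨?_, ?_, ?_⟩
  · ext y
    rw [hT₁.mem_verts_iff_deg_eq_one h₁, hT₂.mem_verts_iff_deg_eq_one h₂, hdeg]
  · ext a b
    exact hadj a b
  have zero : ∀ a b, W₁.graph.Adj a b → (W₁.weight a b = 0 ↔ W₂.weight a b = 0) := by
    intro a b hab
    rw [hT₁.weight_eq_zero_iff hab, hT₂.weight_eq_zero_iff ((hadj a b).1 hab)]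
    simp only [hadj]
  -- the quotient of the two weights is the same for all edges at a vertex
  have prod : ∀ a b c, W₁.graph.Adj a b → W₁.graph.Adj a c →
      W₁.weight a b * W₂.weight a b = W₁.weight a c * W₂.weight a c := by
    intro a b c hab hac
    by_cases hbc : b = c
    · rw [hbc]
    have e1 := (hT₁.weight_add h₁ hab hac hbc).1
    have e2 := (hT₂.weight_add h₂ ((hadj a b).1 hab) ((hadj a c).1 hac) hbc).1
    rw [eq_neg_of_add_eq_zero_left e1, eq_neg_of_add_eq_zero_left e2]
    ring
  have const : ∀ a b, W₁.graph.Reachable a b → ∀ c d, W₁.graph.Adj a c → W₁.graph.Adj b d →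
      W₁.weight a c * W₂.weight a c = W₁.weight b d * W₂.weight b d := by
    intro a b hab c d hac hbd
    rw [SimpleGraph.reachable_iff_reflTransGen] at hab
    induction hab generalizing d with
    | refl => exact prod a c d hac hbd
    | @tail b b' _ hbb' ih =>
      rw [ih b' hbb', W₁.weight_symm b b', W₂.weight_symm b b']
      exact prod b' b d hbb'.symm hbd
  -- the sign of a component is `-1` if the two weights of one of its edges are opposite
  refine ⟨fun C => if ∃ a b, W₁.graph.connectedComponentMk a = C ∧ W₁.graph.Adj a b ∧
    W₁.weight a b * W₂.weight a b = -1 then -1 else 1, fun a b hab => ?_⟩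
  dsimp only
  by_cases h0 : W₁.weight a b = 0
  · rw [h0, (zero a b hab).1 h0]
    simp
  have s1 := hT₁.weight_sq h₁ hab h0
  have s2 := hT₂.weight_sq h₂ ((hadj a b).1 hab) (fun h => h0 ((zero a b hab).2 h))
  have hp : W₁.weight a b * W₂.weight a b = 1 ∨ W₁.weight a b * W₂.weight a b = -1 := by
    rw [← mul_self_eq_one_iff, mul_mul_mul_comm, s1, s2, one_mul]
  have hw : W₂.weight a b = (W₁.weight a b * W₂.weight a b) * W₁.weight a b := by
    linear_combination -W₂.weight a b * s1
  rcases hp with hp | hp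
  · rw [if_neg, hw, hp]
    · simp
    · rintro ⟨a', b', hC, hab', hw'⟩
      rw [ConnectedComponent.eq] at hC
      rw [const a' a hC b' b hab' hab, hp] at hw'
      norm_num at hw'
  · rw [if_pos ⟨a, b, rfl, hab, hp⟩, hw, hp]
    simp

/-! ### Splitting and reductions -/

theorem Tame.allEvenCycleOrZeroEdge_of_reduces (hT : W.Tame) (hs : W.toSigned.AllSplit)
    (h : W.Reduces W') : W'.AllEvenCycleOrZeroEdge := by
  obtain ⟨hT', hsim⟩ := tame_similar_of_reflTransGen hT h.1
  exact fun x hx => hT'.evenCycleAt_or_zeroEdgeAt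
    (hT'.deg_ne_two_of_terminal (hsim.allSplit.1 hs) h.2) hx

theorem Tame.allSplit_of_reduces (hT : W.Tame) (hc : W.toSigned.AllCut) (h : W.Reduces W')
    (h' : W'.AllEvenCycleOrZeroEdge) : W.toSigned.AllSplit := by
  obtain ⟨hT', hsim⟩ := tame_similar_of_reflTransGen hT h.1
  exact hsim.allSplit.2 (hT'.allSplit_of_allEvenCycleOrZeroEdge (hsim.allCut hc) h')

theorem Tame.eqUpToSign_of_reduces (hT : W.Tame) (hs : W.toSigned.AllSplit)
    (h₁ : W.Reduces W₁) (h₂ : W.Reduces W₂) : W₁.EqUpToSign W₂ := by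
  obtain ⟨hT₁, s₁⟩ := tame_similar_of_reflTransGen hT h₁.1
  obtain ⟨hT₂, s₂⟩ := tame_similar_of_reflTransGen hT h₂.1
  exact hT₁.eqUpToSign hT₂ (hT₁.deg_ne_two_of_terminal (s₁.allSplit.1 hs) h₁.2)
    (hT₂.deg_ne_two_of_terminal (s₂.allSplit.1 hs) h₂.2)
    (fun y => (s₁.deg_one y).symm.trans (s₂.deg_one y))
    (fun a b => (s₁.linked a b).symm.trans (s₂.linked a b))

end WGraph

/-! ### Binomials of the toric ideal -/

section Binomials

variable {V : Type*} {G : SimpleGraph V}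

open scoped Classical in
/-- The exponent in `x` of the variable of the edge `{a, b}`, and `0` if there is no such edge. -/
def edgeValue (x : G.edgeSet →₀ ℕ) (a b : V) : ℕ :=
  if h : G.Adj a b then x ⟨s(a, b), h⟩ else 0

theorem edgeValue_symm (x : G.edgeSet →₀ ℕ) (a b : V) : edgeValue x a b = edgeValue x b a := by
  unfold edgeValue
  by_cases h : G.Adj a b
  · rw [dif_pos h, dif_pos h.symm]
    congr 1
    exact Subtype.ext Sym2.eq_swap
  · rw [dif_neg h, dif_neg (fun h' => h h'.symm)]

theorem edgeValue_self (x : G.edgeSet →₀ ℕ) (a : V) : edgeValue x a a = 0 := by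
  simp [edgeValue]

theorem edgeValue_add (x y : G.edgeSet →₀ ℕ) (a b : V) :
    edgeValue (x + y) a b = edgeValue x a b + edgeValue y a b := by
  unfold edgeValue
  split_ifs <;> simp

theorem edgeValue_mono {x y : G.edgeSet →₀ ℕ} (h : x ≤ y) (a b : V) :
    edgeValue x a b ≤ edgeValue y a b := by
  unfold edgeValue
  split_ifs
  · exact h _
  · exact le_rfl

theorem edgeValue_of_adj (x : G.edgeSet →₀ ℕ) {a b : V} (h : G.Adj a b) :
    edgeValue x a b = x ⟨s(a, b), h⟩ := by
  simp [edgeValue, h]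

open scoped Classical in
theorem edgeValue_single (e : G.edgeSet) (m : ℕ) (a b : V) :
    edgeValue (Finsupp.single e m) a b = if s(a, b) = e.1 then m else 0 := by
  unfold edgeValue
  by_cases h : G.Adj a b
  · rw [dif_pos h, Finsupp.single_apply]
    congr 1
    simp [Subtype.ext_iff, eq_comm]
  · rw [dif_neg h, if_neg]
    rintro e'
    exact h (by rw [← SimpleGraph.mem_edgeSet, e']; exact e.2)

theorem eq_of_edgeValue_eq {x y : G.edgeSet →₀ ℕ}
    (h : ∀ a b, G.Adj a b → edgeValue x a b = edgeValue y a b) : x = y := by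
  ext ⟨e, he⟩
  induction e with
  | _ a b =>
    have := h a b he
    rwa [edgeValue_of_adj x he, edgeValue_of_adj y he] at this

section

variable [Fintype V]

/-- The exponent of `t_a` in the image of the monomial `s^x` under `π`. -/
def vertexDegree (x : G.edgeSet →₀ ℕ) (a : V) : ℕ := ∑ b, edgeValue x a b

theorem vertexDegree_add (x y : G.edgeSet →₀ ℕ) (a : V) :
    vertexDegree (x + y) a = vertexDegree x a + vertexDegree y a := by
  simp [vertexDegree, edgeValue_add, Finset.sum_add_distrib]

theorem vertexDegree_zero (a : V) : vertexDegree (0 : G.edgeSet →₀ ℕ) a = 0 := by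
  simp [vertexDegree, edgeValue]

open scoped Classical in
theorem vertexDegree_single {i j : V} (h : G.Adj i j) (m : ℕ) (a : V) :
    vertexDegree (Finsupp.single (⟨s(i, j), h⟩ : G.edgeSet) m) a =
      (if a = i then m else 0) + if a = j then m else 0 := by
  have e : ∀ b, edgeValue (Finsupp.single (⟨s(i, j), h⟩ : G.edgeSet) m) a b =
      (if b = j then (if a = i then m else 0) else 0) +
        if b = i then (if a = j then m else 0) else 0 := by
    intro b
    rw [edgeValue_single]
    have := h.ne
    by_cases h1 : b = j <;> by_cases h2 : a = i <;> by_cases h3 : b = i <;> by_cases h4 : a = j <;>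
      simp_all
  unfold vertexDegree
  rw [Finset.sum_congr rfl fun b _ => e b, Finset.sum_add_distrib]
  simp

theorem toricMap_mon (K : Type*) [Field K] (x : G.edgeSet →₀ ℕ) :
    toricMap K G (mon K G x) =
      MvPolynomial.monomial (Finsupp.equivFunOnFinite.symm (vertexDegree x)) 1 := by
  classical
  induction x using Finsupp.induction_linear with
  | zero =>
    have : Finsupp.equivFunOnFinite.symm (vertexDegree (0 : G.edgeSet →₀ ℕ)) = 0 := by
      ext a; simp [vertexDegree_zero]
    rw [this]
    simp [mon]
  | add x y hx hy =>
    have e1 : mon K G (x + y) = mon K G x * mon K G y := by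
      simp [mon, MvPolynomial.monomial_mul]
    have e2 : Finsupp.equivFunOnFinite.symm (vertexDegree (x + y)) =
        Finsupp.equivFunOnFinite.symm (vertexDegree x) +
          Finsupp.equivFunOnFinite.symm (vertexDegree y) := by
      ext a; simp [vertexDegree_add]
    rw [e1, map_mul, hx, hy, e2, MvPolynomial.monomial_mul, one_mul]
  | single e m =>
    obtain ⟨e, he⟩ := e
    induction e with
    | _ i j =>
      have e1 : Finsupp.equivFunOnFinite.symm
          (vertexDegree (Finsupp.single (⟨s(i, j), he⟩ : G.edgeSet) m)) =
          Finsupp.single i m + Finsupp.single j m := by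
        ext a
        simp [vertexDegree_single he, Finsupp.single_apply, eq_comm]
      rw [e1]
      simp only [mon, toricMap, MvPolynomial.aeval_monomial, map_one, one_mul]
      rw [Finsupp.prod_single_index (by simp)]
      simp only [edgeMonomial, Sym2.lift_mk, mul_pow]
      rw [MvPolynomial.X_pow_eq_monomial, MvPolynomial.X_pow_eq_monomial,
        MvPolynomial.monomial_mul, one_mul]

theorem sub_mem_toricIdeal_iff (K : Type*) [Field K] (x y : G.edgeSet →₀ ℕ) :
    mon K G x - mon K G y ∈ toricIdeal K G ↔ vertexDegree x = vertexDegree y := by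
  rw [toricIdeal, RingHom.mem_ker, map_sub, sub_eq_zero]
  change toricMap K G _ = toricMap K G _ ↔ _
  rw [toricMap_mon, toricMap_mon, MvPolynomial.monomial_left_inj one_ne_zero]
  exact Finsupp.equivFunOnFinite.symm.injective.eq_iff

end

theorem mon_injective (K : Type*) [Field K] : Function.Injective (mon K G) := fun _ _ h =>
  (MvPolynomial.monomial_left_inj one_ne_zero).1 h

theorem mon_dvd_iff (K : Type*) [Field K] {x y : G.edgeSet →₀ ℕ} :
    mon K G x ∣ mon K G y ↔ x ≤ y := by
  simp [mon, MvPolynomial.monomial_dvd_monomial]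

/-- A nonzero binomial determines its two monomials up to order, even over a field of characteristic
two. -/
theorem mon_sub_mon_eq (K : Type*) [Field K] {a b c d : G.edgeSet →₀ ℕ} (hab : a ≠ b)
    (h : mon K G a - mon K G b = mon K G c - mon K G d) : (a = c ∧ b = d) ∨ (a = d ∧ b = c) := by
  classical
  have key : ∀ e, ((if a = e then 1 else 0) - (if b = e then 1 else 0) : K) =
      (if c = e then 1 else 0) - (if d = e then 1 else 0) := by
    intro e
    have := congrArg (MvPolynomial.coeff e) h
    simpa [mon, MvPolynomial.coeff_monomial] using this
  by_cases hac : a = c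
  · subst hac
    exact .inl ⟨rfl, mon_injective K (sub_right_injective h)⟩
  · have ka := key a
    rw [if_pos rfl, if_neg (Ne.symm hab), if_neg (Ne.symm hac)] at ka
    have hda : d = a := by
      by_contra hda
      rw [if_neg hda] at ka
      simp at ka
    subst hda
    have kb := key b
    rw [if_neg hab, if_pos rfl] at kb
    refine .inr ⟨rfl, ?_⟩
    by_contra hbc
    rw [if_neg (Ne.symm hbc)] at kb
    simp at kb

/-- Primitivity of the binomial `s^X - s^Y` in terms of exponent vectors. -/
structure MinimalPair [Fintype V] (X Y : G.edgeSet →₀ ℕ) : Prop where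
  ne : X ≠ Y
  deg_eq : vertexDegree X = vertexDegree Y
  minimal : ∀ x ≤ X, ∀ y ≤ Y, vertexDegree x = vertexDegree y → x = y ∨ (x = X ∧ y = Y)

theorem isPrimitive_iff_minimalPair [Fintype V] (K : Type*) [Field K] (X Y : G.edgeSet →₀ ℕ) :
    IsPrimitive K G (mon K G X - mon K G Y) ↔ MinimalPair X Y := by
  constructor
  · rintro ⟨h0, hmem, x, y, hf, hmin⟩
    have hXY : X ≠ Y := fun e => h0 (by rw [e, sub_self])
    rw [sub_mem_toricIdeal_iff] at hmem
    refine ⟨hXY, hmem, fun x' hx' y' hy' hd => ?_⟩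
    by_contra hcon
    push Not at hcon
    -- In characteristic two the monomials that witness primitivity may come in the other order.
    rcases mon_sub_mon_eq K hXY hf with ⟨rfl, rfl⟩ | ⟨rfl, rfl⟩
    · refine hmin ⟨x', y', (sub_mem_toricIdeal_iff K _ _).2 hd, ?_, ?_, (mon_dvd_iff K).2 hx',
        (mon_dvd_iff K).2 hy'⟩
      · exact fun h => hcon.1 (mon_injective K (sub_eq_zero.1 h))
      · intro h
        rcases mon_sub_mon_eq K hcon.1 h with ⟨h1, h2⟩ | ⟨rfl, rfl⟩
        · exact hcon.2 h1 h2
        · exact hXY (le_antisymm hy' hx')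
    · refine hmin ⟨y', x', (sub_mem_toricIdeal_iff K _ _).2 hd.symm, ?_, ?_, (mon_dvd_iff K).2 hy',
        (mon_dvd_iff K).2 hx'⟩
      · exact fun h => hcon.1 (mon_injective K (sub_eq_zero.1 h)).symm
      · intro h
        rcases mon_sub_mon_eq K (Ne.symm hcon.1) h with ⟨rfl, rfl⟩ | ⟨h1, h2⟩
        · exact hXY (le_antisymm hy' hx')
        · exact hcon.2 h2 h1
  · rintro ⟨hne, hd, hmin⟩
    refine ⟨fun h => hne (mon_injective K (sub_eq_zero.1 h)), (sub_mem_toricIdeal_iff K _ _).2 hd,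
      X, Y, rfl, ?_⟩
    rintro ⟨x', y', h1, h2, h3, h4, h5⟩
    rcases hmin x' ((mon_dvd_iff K).1 h4) y' ((mon_dvd_iff K).1 h5)
      ((sub_mem_toricIdeal_iff K _ _).1 h1) with rfl | ⟨rfl, rfl⟩
    · exact h2 (sub_self _)
    · exact h3 rfl

/-- The two exponent vectors of a minimal pair have disjoint supports. -/
theorem MinimalPair.disjoint [Fintype V] {X Y : G.edgeSet →₀ ℕ} (h : MinimalPair X Y)
    (e : G.edgeSet) : X e = 0 ∨ Y e = 0 := by
  by_contra! hcon
  obtain ⟨hX, hY⟩ := hcon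
  have hx : X - Finsupp.single e 1 + Finsupp.single e 1 = X := tsub_add_cancel_of_le (by
    rw [Finsupp.single_le_iff]; omega)
  have hy : Y - Finsupp.single e 1 + Finsupp.single e 1 = Y := tsub_add_cancel_of_le (by
    rw [Finsupp.single_le_iff]; omega)
  have hd : vertexDegree (X - Finsupp.single e 1) = vertexDegree (Y - Finsupp.single e 1) := by
    funext a
    have := congrFun h.deg_eq a
    rw [← hx, ← hy, vertexDegree_add, vertexDegree_add] at this
    omega
  rcases h.minimal _ tsub_le_self _ tsub_le_self hd with h1 | ⟨h1, -⟩
  · exact h.ne (by rw [← hx, ← hy, h1])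
  · have := DFunLike.congr_fun h1 e
    simp at this
    omega

end Binomials

/-! ### Closed walks -/

section ClosedWalks

variable {V : Type*} {G : SimpleGraph V} {v : V}

/-- The sign of the position `k` of a walk, counted from zero: `true` for the positions that
contribute to the positive monomial of the binomial. -/
def parity (k : ℕ) : Bool := decide (Even k)

theorem parity_succ (k : ℕ) : parity (k + 1) = !parity k := by
  by_cases h : Even k <;> simp [parity, Nat.even_add_one, h]

theorem parity_eq_false_iff {k : ℕ} : parity k = false ↔ Odd k := by
  simp [parity]

theorem parity_eq_true_iff {k : ℕ} : parity k = true ↔ Even k := by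
  simp [parity]

theorem signOf_parity_succ (k : ℕ) :
    WGraph.signOf (parity (k + 1)) = -WGraph.signOf (parity k) := by
  rw [parity_succ, WGraph.signOf_not]

/-- The exponent vector of the product of the variables of the edges at those positions in `P` which
have sign `τ`. -/
def positionVec (w : G.Walk v v) (P : Finset (Fin w.length)) (τ : Bool) : G.edgeSet →₀ ℕ :=
  ∑ k ∈ P.filter (fun k : Fin w.length => parity k = τ), Finsupp.single (walkEdge w k) 1

theorem walkBinomial_eq (K : Type*) [Field K] (w : G.Walk v v) :
    walkBinomial K w = mon K G (positionVec w Finset.univ true) -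
      mon K G (positionVec w Finset.univ false) := by
  unfold walkBinomial mon positionVec
  rw [MvPolynomial.monomial_sum_one, MvPolynomial.monomial_sum_one]
  congr 1
  · refine Finset.prod_congr (Finset.filter_congr fun k _ => ?_) fun _ _ => rfl
    rw [parity_eq_true_iff]
  · refine Finset.prod_congr (Finset.filter_congr fun k _ => ?_) fun _ _ => rfl
    rw [parity_eq_false_iff]

open scoped Classical in
theorem positionVec_apply (w : G.Walk v v) (P : Finset (Fin w.length)) (τ : Bool)
    (e : G.edgeSet) :
    positionVec w P τ e =
      (P.filter fun k : Fin w.length => parity k = τ ∧ walkEdge w k = e).card := by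
  unfold positionVec
  rw [Finsupp.finsetSum_apply]
  simp only [Finsupp.single_apply]
  rw [Finset.sum_boole, Finset.filter_filter]
  rfl

theorem positionVec_pos_iff (w : G.Walk v v) (P : Finset (Fin w.length)) (τ : Bool)
    (e : G.edgeSet) :
    0 < positionVec w P τ e ↔ ∃ k ∈ P, parity k = τ ∧ walkEdge w k = e := by
  classical
  rw [positionVec_apply, Finset.card_pos]
  simp [Finset.Nonempty]

theorem positionVec_mono (w : G.Walk v v) {P Q : Finset (Fin w.length)} (h : P ⊆ Q) (τ : Bool) :
    positionVec w P τ ≤ positionVec w Q τ := by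
  classical
  intro e
  rw [positionVec_apply, positionVec_apply]
  exact Finset.card_le_card (Finset.filter_subset_filter _ h)

theorem edgeValue_positionVec_pos_iff (w : G.Walk v v) (P : Finset (Fin w.length)) (τ : Bool)
    (a b : V) :
    0 < edgeValue (positionVec w P τ) a b ↔
      ∃ k ∈ P, parity k = τ ∧ (walkEdge w k : Sym2 V) = s(a, b) := by
  by_cases h : G.Adj a b
  · rw [edgeValue_of_adj _ h, positionVec_pos_iff]
    simp only [Subtype.ext_iff]
  · simp only [edgeValue, h, dif_neg, not_false_eq_true, lt_irrefl, false_iff]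
    rintro ⟨k, -, -, e⟩
    exact h (by rw [← SimpleGraph.mem_edgeSet, ← e]; exact (walkEdge w k).2)

theorem edgeValue_positionVec_eq_zero (w : G.Walk v v)
    (hd : ∀ k l : Fin w.length, Even (k : ℕ) → Odd (l : ℕ) → walkEdge w k ≠ walkEdge w l)
    (P Q : Finset (Fin w.length)) (τ : Bool) {a b : V}
    (h : 0 < edgeValue (positionVec w P τ) a b) : edgeValue (positionVec w Q (!τ)) a b = 0 := by
  by_contra h0
  obtain ⟨k, -, hk, ek⟩ := (edgeValue_positionVec_pos_iff w P τ a b).1 h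
  obtain ⟨l, -, hl, el⟩ := (edgeValue_positionVec_pos_iff w Q _ a b).1 (Nat.pos_of_ne_zero h0)
  have e : walkEdge w k = walkEdge w l := Subtype.ext (ek.trans el.symm)
  cases τ
  · exact hd l k (parity_eq_true_iff.1 hl) (parity_eq_false_iff.1 hk) e.symm
  · exact hd k l (parity_eq_true_iff.1 hk) (parity_eq_false_iff.1 hl) e

open scoped Classical in
/-- The signed number of times that the positions in `P` meet the vertex `x`. -/
def balance (w : G.Walk v v) (P : Finset (Fin w.length)) (x : V) : ℤ :=
  ∑ k ∈ P, WGraph.signOf (parity k) *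
    ((if x = w.getVert k then 1 else 0) + if x = w.getVert (k + 1) then 1 else 0)

/-- The positions `a, a + 1, …, b - 1` of a walk. -/
def segment (w : G.Walk v v) (a b : ℕ) : Finset (Fin w.length) :=
  Finset.univ.filter fun k => a ≤ (k : ℕ) ∧ (k : ℕ) < b

theorem mem_segment {w : G.Walk v v} {a b : ℕ} {k : Fin w.length} :
    k ∈ segment w a b ↔ a ≤ (k : ℕ) ∧ (k : ℕ) < b := by
  simp [segment]

open scoped Classical in
/-- The signs alternate along a walk, so the inner vertices of a segment cancel. -/
theorem balance_segment (w : G.Walk v v) {a b : ℕ} (hab : a ≤ b) (hb : b ≤ w.length) (x : V) :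
    balance w (segment w a b) x =
      WGraph.signOf (parity a) * (if x = w.getVert a then 1 else 0) -
        WGraph.signOf (parity b) * (if x = w.getVert b then 1 else 0) := by
  induction b, hab using Nat.le_induction with
  | base =>
    have : segment w a a = ∅ := by
      ext k
      simp [mem_segment]
    rw [this, balance, Finset.sum_empty, sub_self]
  | succ b hab ih =>
    have : segment w a (b + 1) = insert ⟨b, hb⟩ (segment w a b) := by
      ext k
      simp only [mem_segment, Finset.mem_insert, Fin.ext_iff]
      omega
    have hn : (⟨b, hb⟩ : Fin w.length) ∉ segment w a b := by simp [mem_segment]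
    have ih := ih (by omega)
    unfold balance at ih ⊢
    rw [this, Finset.sum_insert hn, ih, signOf_parity_succ]
    ring

theorem balance_union (w : G.Walk v v) {P Q : Finset (Fin w.length)} (h : Disjoint P Q) (x : V) :
    balance w (P.disjUnion Q h) x = balance w P x + balance w Q x :=
  Finset.sum_disjUnion h

theorem univ_eq_segment (w : G.Walk v v) : Finset.univ = segment w 0 w.length := by
  ext k
  simp [mem_segment]

theorem balance_univ (w : G.Walk v v) (hw : Even w.length) (x : V) :
    balance w Finset.univ x = 0 := by
  classical
  rw [univ_eq_segment, balance_segment w (Nat.zero_le _) le_rfl, parity_eq_true_iff.2 hw,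
    parity_eq_true_iff.2 (Even.zero)]
  simp

/-! ### The weighted graph of a walk -/

theorem ofWalk_adj_iff (w : G.Walk v v) {a b : V} :
    (ofWalk w).graph.Adj a b ↔ ∃ k : Fin w.length, (walkEdge w k : Sym2 V) = s(a, b) := by
  change s(a, b) ∈ w.edges ↔ _
  rw [List.mem_iff_getElem]
  constructor
  · rintro ⟨i, hi, h⟩
    rw [Walk.getElem_edges] at h
    rw [Walk.length_edges] at hi
    exact ⟨⟨i, hi⟩, h⟩
  · rintro ⟨k, h⟩
    refine ⟨k, by rw [Walk.length_edges]; exact k.2, ?_⟩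
    rw [Walk.getElem_edges]
    exact h

/-- If no edge occurs at positions of both signs, then each position of the walk contributes one
edge of its sign to the signed multigraph. -/
theorem toSigned_ofWalk (w : G.Walk v v)
    (hd : ∀ k l : Fin w.length, Even (k : ℕ) → Odd (l : ℕ) → walkEdge w k ≠ walkEdge w l)
    (τ : Bool) (a b : V) :
    (ofWalk w).toSigned.mult τ a b = edgeValue (positionVec w Finset.univ τ) a b := by
  classical
  by_cases h : (ofWalk w).graph.Adj a b
  · have hG : G.Adj a b := w.adj_of_mem_edges h
    have hwt : (ofWalk w).weight a b = edgeValue (positionVec w Finset.univ true) a b -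
        edgeValue (positionVec w Finset.univ false) a b := by
      rw [edgeValue_of_adj _ hG, edgeValue_of_adj _ hG, positionVec_apply, positionVec_apply]
      simp only [ofWalk, walkWeight, parity_eq_true_iff, parity_eq_false_iff, Subtype.ext_iff]
    obtain ⟨k, hk⟩ := (ofWalk_adj_iff w).1 h
    rw [WGraph.toSigned_mult_of_adj h, hwt]
    have hpos := (edgeValue_positionVec_pos_iff w Finset.univ (parity k) a b).2
      ⟨k, Finset.mem_univ _, rfl, hk⟩
    have hzero := edgeValue_positionVec_eq_zero w hd Finset.univ Finset.univ _ hpos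
    cases hp : parity k <;> rw [hp] at hpos hzero <;> simp only [Bool.not_true, Bool.not_false]
      at hzero <;> cases τ <;> simp [WGraph.count, WGraph.signOf, hzero, hpos.ne']
  · rw [WGraph.toSigned_mult_of_not_adj h]
    by_contra h0
    obtain ⟨k, -, -, hk⟩ := (edgeValue_positionVec_pos_iff w _ _ _ _).1
      (Nat.pos_of_ne_zero (Ne.symm h0))
    exact h ((ofWalk_adj_iff w).2 ⟨k, hk⟩)

theorem weight_ofWalk_ne_zero (w : G.Walk v v)
    (hd : ∀ k l : Fin w.length, Even (k : ℕ) → Odd (l : ℕ) → walkEdge w k ≠ walkEdge w l) {a b : V}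
    (h : (ofWalk w).graph.Adj a b) : (ofWalk w).weight a b ≠ 0 := by
  intro h0
  have hp : ∀ τ, 0 < (ofWalk w).toSigned.mult τ a b := fun τ => by
    rw [WGraph.toSigned_mult_of_adj h, h0]; simp [WGraph.count]
  have h1 := hp true
  rw [toSigned_ofWalk w hd] at h1
  have h2 := hp (!true)
  rw [toSigned_ofWalk w hd, edgeValue_positionVec_eq_zero w hd _ _ _ h1] at h2
  exact lt_irrefl _ h2

variable [Fintype V]

open scoped Classical in
theorem vertexDegree_positionVec (w : G.Walk v v) (P : Finset (Fin w.length)) (τ : Bool) (x : V) :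
    vertexDegree (positionVec w P τ) x = ∑ k ∈ P.filter (fun k : Fin w.length => parity k = τ),
      ((if x = w.getVert k then 1 else 0) + if x = w.getVert (k + 1) then 1 else 0) := by
  unfold positionVec
  induction P.filter (fun k : Fin w.length => parity k = τ) using Finset.induction_on with
  | empty => simp [vertexDegree_zero]
  | insert k s hk ih =>
    rw [Finset.sum_insert hk, Finset.sum_insert hk, vertexDegree_add, ih]
    congr 1
    exact vertexDegree_single _ _ _

theorem balance_eq (w : G.Walk v v) (P : Finset (Fin w.length)) (x : V) :
    balance w P x = vertexDegree (positionVec w P true) x -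
      vertexDegree (positionVec w P false) x := by
  classical
  rw [vertexDegree_positionVec, vertexDegree_positionVec, Finset.sum_filter, Finset.sum_filter,
    Nat.cast_sum, Nat.cast_sum, ← Finset.sum_sub_distrib, balance]
  refine Finset.sum_congr rfl fun k _ => ?_
  cases h : parity k <;> simp [WGraph.signOf]

theorem vertexDegree_true_eq_false (w : G.Walk v v) (hw : Even w.length) :
    vertexDegree (positionVec w Finset.univ true) =
      vertexDegree (positionVec w Finset.univ false) := by
  funext x
  have := balance_univ w hw x
  rw [balance_eq] at this
  omega

open scoped Classical in
/-- The vertex `x` is met twice for every visit of the walk. -/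
theorem vertexDegree_add_eq (w : G.Walk v v) (x : V) :
    vertexDegree (positionVec w Finset.univ true) x +
      vertexDegree (positionVec w Finset.univ false) x =
      2 * (Finset.univ.filter fun k : Fin w.length => x = w.getVert k).card := by
  rw [vertexDegree_positionVec, vertexDegree_positionVec]
  have : ∀ k : Fin w.length, ¬ parity k = true ↔ parity k = false := by simp
  simp only [← this]
  rw [Finset.sum_filter_add_sum_filter_not, Finset.sum_add_distrib, Finset.card_filter]
  have e : ∑ k : Fin w.length, (if x = w.getVert (k + 1) then 1 else 0) =
      ∑ k : Fin w.length, if x = w.getVert k then 1 else 0 := by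
    rw [Fin.sum_univ_eq_sum_range (fun k => if x = w.getVert (k + 1) then 1 else 0),
      Fin.sum_univ_eq_sum_range (fun k => if x = w.getVert k then 1 else 0)]
    have h1 := Finset.sum_range_succ (fun k => if x = w.getVert k then 1 else 0) w.length
    have h2 := Finset.sum_range_succ' (fun k => if x = w.getVert k then 1 else 0) w.length
    simp only [Walk.getVert_length, Walk.getVert_zero] at h1 h2
    omega
  rw [two_mul, e]

theorem deg_ofWalk (w : G.Walk v v)
    (hd : ∀ k l : Fin w.length, Even (k : ℕ) → Odd (l : ℕ) → walkEdge w k ≠ walkEdge w l)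
    (τ : Bool) (x : V) :
    (ofWalk w).toSigned.deg τ x = vertexDegree (positionVec w Finset.univ τ) x :=
  Finset.sum_congr rfl fun b _ => toSigned_ofWalk w hd τ x b

end ClosedWalks

/-! ### Primitivity from splitting -/

section Primitivity

variable {V : Type*} [Fintype V] {G : SimpleGraph V} {v : V}

theorem wdeg_ofWalk (w : G.Walk v v)
    (hd : ∀ k l : Fin w.length, Even (k : ℕ) → Odd (l : ℕ) → walkEdge w k ≠ walkEdge w l) (x : V) :
    (ofWalk w).wdeg x =
      (ofWalk w).toSigned.deg true x + (ofWalk w).toSigned.deg false x := by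
  classical
  unfold WGraph.wdeg SignedGraph.deg
  rw [Finset.sum_filter, Nat.cast_sum, Nat.cast_sum, ← Finset.sum_add_distrib]
  refine Finset.sum_congr rfl fun b _ => ?_
  split_ifs with h
  · have h0 := weight_ofWalk_ne_zero w hd h
    rw [WGraph.toSigned_mult_of_adj h, WGraph.toSigned_mult_of_adj h]
    simp only [WGraph.count, h0, if_false, WGraph.signOf, cond_true, cond_false]
    rcases abs_cases ((ofWalk w).weight x b) with ⟨h1, h2⟩ | ⟨h1, h2⟩ <;> omega
  · rw [WGraph.toSigned_mult_of_not_adj h, WGraph.toSigned_mult_of_not_adj h]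
    simp

theorem deg_ofWalk_eq (w : G.Walk v v) (hw : Even w.length)
    (hd : ∀ k l : Fin w.length, Even (k : ℕ) → Odd (l : ℕ) → walkEdge w k ≠ walkEdge w l)
    (τ : Bool) (x : V) :
    (ofWalk w).toSigned.deg τ x = (ofWalk w).toSigned.deg true x := by
  cases τ
  · rw [deg_ofWalk w hd, deg_ofWalk w hd, vertexDegree_true_eq_false w hw]
  · rfl

/-- The graph of a walk satisfying (i) is tame; it has no edges of weight `0`. -/
theorem ConditionOne.tame {w : G.Walk v v} (hw : Even w.length) (h : ConditionOne w) :
    (ofWalk w).Tame := by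
  obtain ⟨hd, hdeg, -⟩ := h
  have out : ∀ x, x ∉ (ofWalk w).verts → (ofWalk w).toSigned.deg true x = 0 := by
    intro x hx
    refine Finset.sum_eq_zero fun b _ => ?_
    exact WGraph.toSigned_mult_of_not_adj (fun h => hx ((ofWalk w).mem_verts h)) _
  have hin : ∀ x ∈ (ofWalk w).verts, (ofWalk w).toSigned.deg true x = 1 ∨
      (ofWalk w).toSigned.deg true x = 2 := by
    intro x hx
    have := hdeg x hx
    rw [wdeg_ofWalk w hd, deg_ofWalk_eq w hw hd false] at this
    omega
  refine ⟨⟨fun σ y => deg_ofWalk_eq w hw hd σ y, fun y => ?_⟩, fun y => ?_, fun a b hab h0 => ?_⟩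
  · by_cases hy : y ∈ (ofWalk w).verts
    · rcases hin y hy with h | h <;> omega
    · rw [out y hy]; omega
  · by_cases hy : y ∈ (ofWalk w).verts
    · have := hin y hy
      simp only [hy, true_iff]
      omega
    · simp [hy, out y hy]
  · exact absurd h0 (weight_ofWalk_ne_zero w hd hab)

theorem ConditionOne.allCut {w : G.Walk v v} (hw : Even w.length) (h : ConditionOne w) :
    (ofWalk w).toSigned.AllCut := by
  intro y hy
  have hT := h.tame hw
  obtain ⟨hd, -, hcut⟩ := h
  refine (hcut y ((hT.mem_verts_iff y).2 (by omega)) ?_).cuts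
  rw [wdeg_ofWalk w hd, deg_ofWalk_eq w hw hd false, hy]
  norm_num

/-- Let `π(s^x) = π(s^y)` with `x` and `y` supported on the positive and negative edges of `M`,
respectively, and let `A` be the part of `M - a` reached by the positive edges at `a`. The sum over
`A` of the degrees in `x` minus the degrees in `y` is zero. Edges within `A` contribute an even
number to it; if `a` splits, the other edges that contribute are the positive edges at `a`. -/
theorem even_of_splits {M : SignedGraph V} {x y : G.edgeSet →₀ ℕ} {a : V} (hs : M.Splits a)
    (hx : ∀ b c, 0 < edgeValue x b c → 0 < M.mult true b c)
    (hy : ∀ b c, 0 < edgeValue y b c → 0 < M.mult false b c)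
    (hd : vertexDegree x = vertexDegree y) : Even (vertexDegree x a) := by
  classical
  let A : Finset V := Finset.univ.filter fun c => ∃ b, 0 < M.mult true a b ∧ M.Conn a b c
  have memA : ∀ c, c ∈ A ↔ ∃ b, 0 < M.mult true a b ∧ M.Conn a b c := by simp [A]
  have haA : ∀ c ∈ A, c ≠ a := by
    intro c hc
    obtain ⟨b, hb, hbc⟩ := (memA c).1 hc
    obtain rfl | ⟨d, -, h⟩ := hbc.cases_tail
    · exact fun e => SignedGraph.Adj.ne ⟨_, hb⟩ e.symm
    · exact h.2.2
  let h : V → V → ℤ := fun c d => (edgeValue x c d : ℤ) - edgeValue y c d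
  have hsymm : ∀ c d, h c d = h d c := fun c d => by
    simp only [h]; rw [edgeValue_symm x, edgeValue_symm y]
  have hev := even_sum_sum_of_symm A h hsymm (fun c => by simp [h, edgeValue_self])
  have hrow : ∀ c ∈ A, ∑ d ∈ A, h c d = - h c a := by
    intro c hc
    have htot : ∑ d, h c d = 0 := by
      have := congrFun hd c
      simp only [h, Finset.sum_sub_distrib, ← Nat.cast_sum]
      unfold vertexDegree at this
      rw [this, sub_self]
    have hout : ∑ d ∈ Aᶜ, h c d = h c a := by
      refine Finset.sum_eq_single a (fun d hd hda => ?_) (fun h' => ?_)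
      · rw [Finset.mem_compl] at hd
        have hadj : ¬ M.Adj c d := by
          intro hadj
          obtain ⟨b, hb, hbc⟩ := (memA c).1 hc
          exact hd ((memA d).2 ⟨b, hb, hbc.tail ⟨hadj, haA c hc, hda⟩⟩)
        have hx0 : edgeValue x c d = 0 := by
          by_contra h0
          exact hadj ⟨_, hx c d (Nat.pos_of_ne_zero h0)⟩
        have hy0 : edgeValue y c d = 0 := by
          by_contra h0
          exact hadj ⟨_, hy c d (Nat.pos_of_ne_zero h0)⟩
        simp [h, hx0, hy0]
      · exact absurd (Finset.mem_compl.2 fun ha => haA a ha rfl) h'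
    have := Finset.sum_add_sum_compl A (h c)
    rw [hout, htot] at this
    omega
  rw [Finset.sum_congr rfl hrow, Finset.sum_neg_distrib, even_neg] at hev
  have hfin : ∑ c ∈ A, h c a = vertexDegree x a := by
    have e1 : ∀ c ∈ A, h c a = edgeValue x a c := by
      intro c hc
      have hy0 : edgeValue y c a = 0 := by
        by_contra h0
        obtain ⟨b, hb, hbc⟩ := (memA c).1 hc
        rw [edgeValue_symm] at h0
        exact hs b c hb (hy a c (Nat.pos_of_ne_zero h0)) hbc
      simp only [h, hy0]
      rw [edgeValue_symm]
      simp
    rw [Finset.sum_congr rfl e1, ← Nat.cast_sum, Nat.cast_inj]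
    refine Finset.sum_subset (Finset.subset_univ _) fun c _ hc => ?_
    by_contra h0
    exact hc ((memA c).2 ⟨c, hx a c (Nat.pos_of_ne_zero h0), .refl⟩)
  rw [hfin] at hev
  exact_mod_cast hev

theorem edgeValue_eq_of_vertexDegree_eq {x X : G.edgeSet →₀ ℕ} (h : x ≤ X) {a : V}
    (hd : vertexDegree x a = vertexDegree X a) (b : V) : edgeValue x a b = edgeValue X a b :=
  (Finset.sum_eq_sum_iff_of_le fun b _ => edgeValue_mono h a b).1 hd b (Finset.mem_univ b)

theorem edgeValue_eq_zero_of_vertexDegree_eq_zero {x : G.edgeSet →₀ ℕ} {a : V}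
    (hd : vertexDegree x a = 0) (b : V) : edgeValue x a b = 0 :=
  (Finset.sum_eq_zero_iff_of_nonneg fun _ _ => Nat.zero_le _).1 hd b (Finset.mem_univ b)

theorem vertexDegree_mono {x X : G.edgeSet →₀ ℕ} (h : x ≤ X) (a : V) :
    vertexDegree x a ≤ vertexDegree X a :=
  Finset.sum_le_sum fun b _ => edgeValue_mono h a b

/-- If all vertices of degree two split, a smaller pair is, at every vertex, either zero or
everything, and moving along the walk shows that the alternative is the same at all vertices. -/
theorem ConditionOne.minimalPair {w : G.Walk v v} (hw : Even w.length) (h : ConditionOne w)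
    (hs : (ofWalk w).toSigned.AllSplit) :
    MinimalPair (positionVec w Finset.univ true) (positionVec w Finset.univ false) := by
  have hT := h.tame hw
  obtain ⟨hd, -, -⟩ := h
  set X := positionVec w Finset.univ true with hX
  set Y := positionVec w Finset.univ false with hY
  have hXY : vertexDegree X = vertexDegree Y := vertexDegree_true_eq_false w hw
  have hXm : ∀ a b, (ofWalk w).toSigned.mult true a b = edgeValue X a b :=
    toSigned_ofWalk w hd true
  have hYm : ∀ a b, (ofWalk w).toSigned.mult false a b = edgeValue Y a b :=
    toSigned_ofWalk w hd false
  refine ⟨?_, hXY, fun x hx y hy hxy => ?_⟩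
  · intro e
    have hv : v ∈ (ofWalk w).verts := w.start_mem_support
    obtain ⟨b, hb⟩ := hT.exists_mult_pos hv true
    rw [hXm] at hb
    have := edgeValue_positionVec_eq_zero w hd Finset.univ Finset.univ _ hb
    rw [Bool.not_true, ← hY, ← e] at this
    omega
  -- At each vertex the pair `(x, y)` is zero or all of `(X, Y)`.
  have local' : ∀ a, (∀ b, edgeValue x a b = 0 ∧ edgeValue y a b = 0) ∨
      (∀ b, edgeValue x a b = edgeValue X a b ∧ edgeValue y a b = edgeValue Y a b) := by
    intro a
    have h1 := vertexDegree_mono hx a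
    have h2 : vertexDegree X a ≤ 2 := by
      rw [← deg_ofWalk w hd]; exact hT.balanced.deg_le a
    have h3 := congrFun hxy a
    have h4 := congrFun hXY a
    have h5 : vertexDegree X a = 2 → Even (vertexDegree x a) := by
      intro h2
      refine even_of_splits (hs a (by rw [deg_ofWalk w hd]; exact h2)) (fun b c hbc => ?_)
        (fun b c hbc => ?_) hxy
      · rw [hXm]; exact hbc.trans_le (edgeValue_mono hx b c)
      · rw [hYm]; exact hbc.trans_le (edgeValue_mono hy b c)
    have h6 : vertexDegree x a = 0 ∨ vertexDegree x a = vertexDegree X a := by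
      by_cases h7 : vertexDegree X a = 2
      · obtain ⟨m, hm⟩ := h5 h7
        omega
      · omega
    rcases h6 with h6 | h6
    · exact .inl fun b => ⟨edgeValue_eq_zero_of_vertexDegree_eq_zero h6 b,
        edgeValue_eq_zero_of_vertexDegree_eq_zero (h3 ▸ h6) b⟩
    · exact .inr fun b => ⟨edgeValue_eq_of_vertexDegree_eq hx h6 b,
        edgeValue_eq_of_vertexDegree_eq hy (by omega) b⟩
  have pos : ∀ k : ℕ, k < w.length → 0 < edgeValue X (w.getVert k) (w.getVert (k + 1)) +
      edgeValue Y (w.getVert k) (w.getVert (k + 1)) := by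
    intro k hk
    have := (edgeValue_positionVec_pos_iff w Finset.univ (parity k) (w.getVert k)
      (w.getVert (k + 1))).2 ⟨⟨k, hk⟩, Finset.mem_univ _, rfl, rfl⟩
    cases hp : parity k <;> rw [hp] at this
    · rw [← hY] at this; omega
    · rw [← hX] at this; omega
  have onWalk : ∀ a b, 0 < edgeValue X a b + edgeValue Y a b →
      ∃ k ≤ w.length, w.getVert k = a := by
    intro a b hab
    have : ∃ τ, 0 < edgeValue (positionVec w Finset.univ τ) a b := by
      by_cases h0 : 0 < edgeValue X a b
      · exact ⟨true, by rw [← hX]; exact h0⟩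
      · exact ⟨false, by rw [← hY]; omega⟩
    obtain ⟨τ, hτ⟩ := this
    obtain ⟨k, -, -, hk⟩ := (edgeValue_positionVec_pos_iff w _ _ _ _).1 hτ
    rcases Sym2.eq_iff.1 hk with ⟨h1, -⟩ | ⟨-, h1⟩
    · exact ⟨k, k.2.le, h1⟩
    · exact ⟨k + 1, k.2, h1⟩
  rcases local' (w.getVert 0) with h0 | h0
  · left
    have all : ∀ k ≤ w.length, ∀ b, edgeValue x (w.getVert k) b = 0 ∧
        edgeValue y (w.getVert k) b = 0 := by
      intro k hk
      induction k with
      | zero => exact h0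
      | succ k ih =>
        refine (local' _).resolve_right fun h1 => ?_
        have h2 := ih (by omega) (w.getVert (k + 1))
        have h3 := h1 (w.getVert k)
        have := pos k (by omega)
        rw [edgeValue_symm x, edgeValue_symm X, edgeValue_symm y, edgeValue_symm Y] at h3
        omega
    refine eq_of_edgeValue_eq fun a b _ => ?_
    have hx' := edgeValue_mono hx a b
    have hy' := edgeValue_mono hy a b
    by_cases hp : 0 < edgeValue X a b + edgeValue Y a b
    · obtain ⟨k, hk, rfl⟩ := onWalk a b hp
      have := all k hk b
      omega
    · omega
  · right
    have all : ∀ k ≤ w.length, ∀ b, edgeValue x (w.getVert k) b = edgeValue X (w.getVert k) b ∧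
        edgeValue y (w.getVert k) b = edgeValue Y (w.getVert k) b := by
      intro k hk
      induction k with
      | zero => exact h0
      | succ k ih =>
        refine (local' _).resolve_left fun h1 => ?_
        have h2 := ih (by omega) (w.getVert (k + 1))
        have h3 := h1 (w.getVert k)
        have := pos k (by omega)
        rw [edgeValue_symm x, edgeValue_symm y] at h3
        omega
    have fin : ∀ a b, edgeValue x a b = edgeValue X a b ∧ edgeValue y a b = edgeValue Y a b := by
      intro a b
      have hx' := edgeValue_mono hx a b
      have hy' := edgeValue_mono hy a b
      by_cases hp : 0 < edgeValue X a b + edgeValue Y a b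
      · obtain ⟨k, hk, rfl⟩ := onWalk a b hp
        exact all k hk b
      · omega
    exact ⟨eq_of_edgeValue_eq fun a b _ => (fin a b).1, eq_of_edgeValue_eq fun a b _ => (fin a b).2⟩

/-! ### Splitting from primitivity -/

section Minimal

variable {w : G.Walk v v}

theorem MinimalPair.positions_disjoint
    (h : MinimalPair (positionVec w Finset.univ true) (positionVec w Finset.univ false))
    (k l : Fin w.length) (hk : Even (k : ℕ)) (hl : Odd (l : ℕ)) :
    walkEdge w k ≠ walkEdge w l := by
  intro e
  have h1 := (positionVec_pos_iff w Finset.univ true (walkEdge w k)).2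
    ⟨k, Finset.mem_univ _, parity_eq_true_iff.2 hk, rfl⟩
  have h2 := (positionVec_pos_iff w Finset.univ false (walkEdge w k)).2
    ⟨l, Finset.mem_univ _, parity_eq_false_iff.2 hl, e.symm⟩
  rcases h.disjoint (walkEdge w k) with h | h <;> omega

/-- A nonempty set of positions of balance zero yields a binomial of the toric ideal, and minimality
makes it contain all positions. -/
theorem MinimalPair.eq_univ_of_balance
    (h : MinimalPair (positionVec w Finset.univ true) (positionVec w Finset.univ false))
    {P : Finset (Fin w.length)} (hP : ∀ x, balance w P x = 0) (hne : P.Nonempty)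
    (l : Fin w.length) :
    l ∈ P := by
  classical
  by_contra hl
  have hd : vertexDegree (positionVec w P true) = vertexDegree (positionVec w P false) := by
    funext x
    have := hP x
    rw [balance_eq] at this
    omega
  rcases h.minimal _ (positionVec_mono w (Finset.subset_univ P) true) _
    (positionVec_mono w (Finset.subset_univ P) false) hd with e | ⟨e1, e2⟩
  · obtain ⟨k, hk⟩ := hne
    have h1 : ∀ τ, 0 < positionVec w P τ (walkEdge w k) := by
      have := (positionVec_pos_iff w P (parity k) (walkEdge w k)).2 ⟨k, hk, rfl, rfl⟩
      intro τ
      cases τ <;> cases hp : parity k <;> rw [hp] at this <;> simp_all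
    obtain ⟨k', -, hk', ek'⟩ := (positionVec_pos_iff w P true _).1 (h1 true)
    obtain ⟨l', -, hl', el'⟩ := (positionVec_pos_iff w P false _).1 (h1 false)
    exact h.positions_disjoint k' l' (parity_eq_true_iff.1 hk') (parity_eq_false_iff.1 hl')
      (ek'.trans el'.symm)
  · have h1 : ∀ τ, positionVec w P τ = positionVec w Finset.univ τ := by
      intro τ; cases τ
      exacts [e2, e1]
    have := DFunLike.congr_fun (h1 (parity l)) (walkEdge w l)
    rw [positionVec_apply, positionVec_apply] at this
    refine absurd this (ne_of_lt (Finset.card_lt_card ⟨Finset.filter_subset_filter _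
      (Finset.subset_univ P), fun hsub => hl ?_⟩))
    exact (Finset.mem_filter.1 (hsub (Finset.mem_filter.2 ⟨Finset.mem_univ l, rfl, rfl⟩))).1

/-- Two visits of a vertex occur at positions of different sign; otherwise the segment between them
is balanced. -/
theorem MinimalPair.parity_ne
    (h : MinimalPair (positionVec w Finset.univ true) (positionVec w Finset.univ false))
    {a b : ℕ} (hab : a < b) (hb : b < w.length) (e : w.getVert a = w.getVert b) :
    parity b = !parity a := by
  classical
  by_contra hp
  have hp : parity b = parity a := by
    revert hp; cases parity a <;> cases parity b <;> simp
  have := h.eq_univ_of_balance (P := segment w a b) (fun x => by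
    rw [balance_segment w hab.le hb.le, e, hp, sub_self])
    ⟨⟨a, hab.trans hb⟩, mem_segment.2 ⟨le_rfl, hab⟩⟩ ⟨b, hb⟩
  exact lt_irrefl _ (mem_segment.1 this).2

open scoped Classical in
theorem MinimalPair.card_visits_le
    (h : MinimalPair (positionVec w Finset.univ true) (positionVec w Finset.univ false)) (x : V) :
    (Finset.univ.filter fun k : Fin w.length => x = w.getVert k).card ≤ 2 := by
  have := Finset.card_le_card_of_injOn (s := Finset.univ.filter
    fun k : Fin w.length => x = w.getVert k) (t := (Finset.univ : Finset Bool))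
    (fun k => parity k) (fun _ _ => Finset.mem_univ _) (by
      intro k hk l hl e
      simp only [Finset.coe_filter, Finset.mem_univ, true_and, Set.mem_ofPred_eq] at hk hl
      simp only at e
      rcases lt_trichotomy (k : ℕ) l with hlt | heq | hlt
      · have := h.parity_ne hlt l.2 (hk.symm.trans hl)
        rw [e] at this
        simp at this
      · exact Fin.ext heq
      · have := h.parity_ne hlt k.2 (hl.symm.trans hk)
        rw [e] at this
        simp at this)
  simpa using this

/-- Let the walk visit `x` at the positions `lo < hi`. A vertex visited between these positions is
not visited outside them. -/
theorem MinimalPair.getVert_ne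
    (h : MinimalPair (positionVec w Finset.univ true) (positionVec w Finset.univ false))
    {lo hi m k : ℕ} (hhi : hi < w.length) (e : w.getVert lo = w.getVert hi)
    (hlm : lo < m) (hmh : m < hi) (hk : k < w.length) (hout : k < lo ∨ hi < k) :
    w.getVert m ≠ w.getVert k := by
  classical
  intro emk
  have p1 := h.parity_ne (hlm.trans hmh) hhi e
  rcases hout with hkl | hhk
  -- In both cases the segments end at `x` twice and at the other vertex twice, with opposite signs.
  · have p2 := h.parity_ne (hkl.trans hlm) (hmh.trans hhi) emk.symm
    have hdis : Disjoint (segment w k lo) (segment w m hi) := by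
      rw [Finset.disjoint_left]
      intro j hj hj'
      rw [mem_segment] at hj hj'
      omega
    have := h.eq_univ_of_balance (P := (segment w k lo).disjUnion (segment w m hi) hdis)
      (fun x => by
        rw [balance_union, balance_segment w hkl.le (by omega), balance_segment w hmh.le hhi.le,
          p1, p2, WGraph.signOf_not, WGraph.signOf_not, e, emk]
        ring)
      ⟨⟨k, hk⟩, by simp [mem_segment, hkl]⟩ ⟨hi, hhi⟩
    simp only [Finset.mem_disjUnion, mem_segment] at this
    omega
  · have p2 := h.parity_ne (hmh.trans hhk) hk emk
    have hdis : Disjoint (segment w lo m) (segment w hi k) := by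
      rw [Finset.disjoint_left]
      intro j hj hj'
      rw [mem_segment] at hj hj'
      omega
    have := h.eq_univ_of_balance (P := (segment w lo m).disjUnion (segment w hi k) hdis)
      (fun x => by
        rw [balance_union, balance_segment w hlm.le (by omega), balance_segment w hhk.le hk.le,
          p1, p2, WGraph.signOf_not, WGraph.signOf_not, e, emk]
        ring)
      ⟨⟨lo, by omega⟩, by simp [mem_segment, hlm]⟩ ⟨m, by omega⟩
    simp only [Finset.mem_disjUnion, mem_segment] at this
    omega

/-- Let the walk visit `x` exactly at the positions `lo < hi`. The vertices strictly between these
visits form a union of components of `G_w - x` by `MinimalPair.getVert_ne`, and the edges at `x`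
leading there are those at the positions `lo` and `hi - 1`, which have the same sign. -/
theorem MinimalPair.splits
    (h : MinimalPair (positionVec w Finset.univ true) (positionVec w Finset.univ false))
    (hw : Even w.length) {lo hi : ℕ} {x : V} (hlh : lo < hi) (hhi : hi < w.length)
    (elo : w.getVert lo = x) (ehi : w.getVert hi = x)
    (only : ∀ k < w.length, w.getVert k = x → k = lo ∨ k = hi) :
    (ofWalk w).toSigned.Splits x := by
  have hd := h.positions_disjoint
  have p1 := h.parity_ne hlh hhi (elo.trans ehi.symm)
  let A : Set V := {c | ∃ m, lo < m ∧ m < hi ∧ w.getVert m = c}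
  have out : ∀ k, k < w.length → (k < lo ∨ hi < k) → w.getVert k ∉ A := by
    rintro k hk ho ⟨m, h1, h2, e⟩
    exact h.getVert_ne hhi (elo.trans ehi.symm) h1 h2 hk ho e
  have inn : ∀ k, lo < k → k < hi → w.getVert k ∈ A := fun k h1 h2 => ⟨k, h1, h2, rfl⟩
  have succ_ne : ∀ k < w.length, w.getVert k ≠ w.getVert (k + 1) := fun k hk =>
    (w.adj_getVert_succ hk).ne
  have e0 : w.getVert w.length = w.getVert 0 := by simp
  -- The successor of the last position is the position `0`.
  have last : ∀ k, k + 1 = w.length → w.getVert (k + 1) = w.getVert 0 := by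
    intro k hk; rw [hk, e0]
  have edge : ∀ k, k < w.length → w.getVert k ≠ x → w.getVert (k + 1) ≠ x →
      (w.getVert k ∈ A ↔ w.getVert (k + 1) ∈ A) := by
    intro k hk h1 h2
    have hk1 : k ≠ lo := fun e => h1 (e ▸ elo)
    have hk2 : k ≠ hi := fun e => h1 (e ▸ ehi)
    have hk3 : k + 1 ≠ lo := fun e => h2 (e ▸ elo)
    have hk4 : k + 1 ≠ hi := fun e => h2 (e ▸ ehi)
    by_cases hin : lo < k ∧ k < hi
    · exact iff_of_true (inn k hin.1 hin.2) (inn (k + 1) (by omega) (by omega))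
    · refine iff_of_false (out k hk (by omega)) ?_
      by_cases hkn : k + 1 = w.length
      · rw [last k hkn] at h2 ⊢
        have : lo ≠ 0 := fun e => h2 (e ▸ elo)
        exact out 0 (by omega) (by omega)
      · exact out (k + 1) (by omega) (by omega)
  have sign : ∀ τ b, 0 < (ofWalk w).toSigned.mult τ x b → (b ∈ A ↔ τ = parity lo) := by
    intro τ b hb
    rw [toSigned_ofWalk w hd, edgeValue_positionVec_pos_iff] at hb
    obtain ⟨⟨k, hk⟩, -, rfl, hb⟩ := hb
    have hne := succ_ne k hk
    rcases Sym2.eq_iff.1 hb with ⟨h1, h2⟩ | ⟨h1, h2⟩ <;> simp only at h1 h2 ⊢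
    · subst h2
      rcases only k hk h1 with rfl | rfl
      · refine iff_of_true (inn _ (by omega) ?_) rfl
        have : k + 1 ≠ hi := by
          rintro rfl
          exact hne (h1.trans ehi.symm)
        omega
      · refine iff_of_false ?_ (by rw [p1]; simp)
        by_cases hkn : k + 1 = w.length
        · rw [last k hkn] at hne ⊢
          have : lo ≠ 0 := by
            rintro rfl
            exact hne (h1.trans elo.symm)
          exact out 0 (by omega) (by omega)
        · exact out (k + 1) (by omega) (by omega)
    · subst h1
      by_cases hkn : k + 1 = w.length
      · have hlo : lo = 0 := by
          rw [last k hkn] at h2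
          rcases only 0 (by omega) h2 with h | h <;> omega
        refine iff_of_false (out k hk ?_) ?_
        · have : k ≠ hi := by
            rintro rfl
            exact hne (ehi.trans h2.symm)
          omega
        · rw [hlo, parity_eq_true_iff.2 Even.zero]
          rw [← hkn, Nat.even_add_one] at hw
          simpa [parity] using hw
      · rcases only (k + 1) (by omega) h2 with rfl | rfl
        · refine iff_of_false (out k hk (by omega)) ?_
          rw [parity_succ]; simp
        · refine iff_of_true (inn k ?_ (by omega)) ?_
          · have : k ≠ lo := by
              rintro rfl
              exact hne (elo.trans h2.symm)
            omega
          · rw [parity_succ] at p1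
            simpa using p1
  refine SignedGraph.splits_of x (parity lo) fun a b ha hb hc => ?_
  have haA := (sign _ a ha).2 rfl
  have hbA : b ∉ A := fun hbA => by
    have := (sign _ b hb).1 hbA
    simp at this
  refine hbA (hc.mem_of_closed haA fun c hcA d hcd hcx hdx => ?_)
  obtain ⟨⟨k, hk⟩, e⟩ := (ofWalk_adj_iff w).1 (WGraph.toSigned_adj.1 hcd)
  rcases Sym2.eq_iff.1 e with ⟨h1, h2⟩ | ⟨h1, h2⟩ <;> simp only at h1 h2
  · subst h1 h2
    exact (edge k hk hcx hdx).1 hcA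
  · subst h1 h2
    exact (edge k hk hdx hcx).2 hcA

theorem MinimalPair.conditionOne
    (h : MinimalPair (positionVec w Finset.univ true) (positionVec w Finset.univ false))
    (hw : Even w.length) : ConditionOne w ∧ (ofWalk w).toSigned.AllSplit := by
  classical
  have hd := h.positions_disjoint
  have visits : ∀ x, (ofWalk w).toSigned.deg true x =
      (Finset.univ.filter fun k : Fin w.length => x = w.getVert k).card := by
    intro x
    have h1 := vertexDegree_add_eq w x
    rw [← deg_ofWalk w hd, ← deg_ofWalk w hd, deg_ofWalk_eq w hw hd false] at h1
    omega
  have hsplit : (ofWalk w).toSigned.AllSplit := by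
    intro x hx
    rw [visits, Finset.card_eq_two] at hx
    obtain ⟨k, l, hkl, hx⟩ := hx
    have mem : ∀ j : Fin w.length, x = w.getVert j ↔ j = k ∨ j = l := by
      intro j
      have := Finset.ext_iff.1 hx j
      simpa using this
    have only : ∀ j < w.length, w.getVert j = x → j = k ∨ j = l := by
      intro j hj e
      exact ((mem ⟨j, hj⟩).1 e.symm).imp (congrArg Fin.val) (congrArg Fin.val)
    have ek := ((mem k).2 (.inl rfl)).symm
    have el := ((mem l).2 (.inr rfl)).symm
    rcases lt_or_gt_of_ne (fun e => hkl (Fin.ext e) : (k : ℕ) ≠ l) with hlt | hlt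
    · exact h.splits hw hlt l.2 ek el only
    · exact h.splits hw hlt k.2 el ek fun j hj e => (only j hj e).symm
  -- The binomial of a walk of length zero is `1 - 1`.
  have hlen : 0 < w.length := by
    by_contra h0
    apply h.ne
    have : IsEmpty (Fin w.length) := by
      rw [show w.length = 0 by omega]; infer_instance
    simp [positionVec]
  refine ⟨⟨hd, fun x hx => ?_, fun x hx h4 => ?_⟩, hsplit⟩
  · obtain ⟨n, rfl, hn⟩ := Walk.mem_support_iff_exists_getVert.1 (show x ∈ w.support from hx)
    have hpos : 0 < (Finset.univ.filter
        fun k : Fin w.length => w.getVert n = w.getVert k).card := by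
      rw [Finset.card_pos]
      rcases hn.lt_or_eq with hn | rfl
      · exact ⟨⟨n, hn⟩, by simp⟩
      · exact ⟨⟨0, hlen⟩, by simp⟩
    have hle := h.card_visits_le (w.getVert n)
    rw [wdeg_ofWalk w hd, deg_ofWalk_eq w hw hd false, visits]
    omega
  · rw [wdeg_ofWalk w hd, deg_ofWalk_eq w hw hd false] at h4
    have h2 : (ofWalk w).toSigned.deg true x = 2 := by omega
    obtain ⟨a, ha⟩ := (ofWalk w).toSigned.exists_mult_pos (σ := true) (y := x) (by omega)
    obtain ⟨b, hb⟩ := (ofWalk w).toSigned.exists_mult_pos (σ := false) (y := x)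
      (by rw [deg_ofWalk_eq w hw hd]; omega)
    exact WGraph.isCutVertex_of_cuts ⟨a, b, ⟨_, ha⟩, ⟨_, hb⟩, hsplit x h2 a b ha hb⟩

end Minimal

/-- The criterion for primitivity by splitting, which no longer refers to binomials. -/
theorem isPrimitive_iff (K : Type*) [Field K] {w : G.Walk v v} (hw : Even w.length) :
    IsPrimitive K G (walkBinomial K w) ↔ ConditionOne w ∧ (ofWalk w).toSigned.AllSplit := by
  rw [walkBinomial_eq, isPrimitive_iff_minimalPair]
  exact ⟨fun h => h.conditionOne hw, fun h => h.1.minimalPair hw h.2⟩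

end Primitivity

end GraverWalk

end

theorem proposition3p2 {V : Type*} [Fintype V] (K : Type*) [Field K]
    (G : SimpleGraph V) (hG : G.Connected) {v : V} (w : G.Walk v v) (hw : Even w.length) :
    -- primitive iff (i) and every way of carrying out the operations ends well
    (GraverWalk.IsPrimitive K G (GraverWalk.walkBinomial K w) ↔
      GraverWalk.ConditionOne w ∧
        ∀ W', (GraverWalk.ofWalk w).Reduces W' → W'.AllEvenCycleOrZeroEdge) ∧
    -- primitive iff (i) and some way of carrying out the operations ends well
    (GraverWalk.IsPrimitive K G (GraverWalk.walkBinomial K w) ↔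
      GraverWalk.ConditionOne w ∧
        ∃ W', (GraverWalk.ofWalk w).Reduces W' ∧ W'.AllEvenCycleOrZeroEdge) ∧
    -- the resulting graph does not depend on the order, up to signs of components
    (GraverWalk.IsPrimitive K G (GraverWalk.walkBinomial K w) →
      ∀ W₁ W₂, (GraverWalk.ofWalk w).Reduces W₁ → (GraverWalk.ofWalk w).Reduces W₂ →
        W₁.EqUpToSign W₂) := by
  rw [GraverWalk.isPrimitive_iff K hw]
  obtain ⟨W₀, h₀⟩ := (GraverWalk.ofWalk w).exists_reduces
  refine ⟨⟨fun h => ⟨h.1, fun W' h' => ?_⟩, fun h => ⟨h.1, ?_⟩⟩,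
    ⟨fun h => ⟨h.1, W₀, h₀, ?_⟩, ?_⟩, fun h W₁ W₂ h₁ h₂ => ?_⟩
  · exact (h.1.tame hw).allEvenCycleOrZeroEdge_of_reduces h.2 h'
  · exact (h.1.tame hw).allSplit_of_reduces (h.1.allCut hw) h₀ (h.2 W₀ h₀)
  · exact (h.1.tame hw).allEvenCycleOrZeroEdge_of_reduces h.2 h₀
  · rintro ⟨h, W', h', hW'⟩
    exact ⟨h, (h.tame hw).allSplit_of_reduces (h.allCut hw) h' hW'⟩
  · exact (h.1.tame hw).eqUpToSign_of_reduces h.2 h₁ h₂
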